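/- Let $K:\mathbb R\to\mathbb R$ be an even, $\pi$-periodic function in $W^{1,\infty}$, with Fourier expansion $K(\theta)=\sum_{m\ge 0}k_m\cos(2m\theta)$, and let $\tilde K=K-\frac1{2\pi}\int_0^{2\pi}K\,d\theta$. Let $H$ be the Hilbert space of all $V\in H^1([0,2\pi])$ (with the $H^1$-inner product) such that $V(\theta)=V(\theta+\pi)$ a.e., $V(\theta)=V(2\pi-\theta)$ a.e. and $\int_0^{2\pi}V\,d\theta=0$, and let $\Gamma:H\to H$, $$\Gamma(V)(\theta)=\frac{\int_0^{2\pi}\tilde K(\theta-\theta')e^{-V(\theta')}\,d\theta'}{\int_0^{2\pi}e^{-V(\theta')}\,d\theta'}.$$ Consider the problem $V=\lambda\Gamma(V)$, $V\in H$, which has the trivial solution $V=0$ for every $\lambda$. A solution $V$ for the parameter $\lambda$ is called stable if the spectrum of the linearization $\lambda D\Gamma(V)-I$ lies in $\{\operatorname{Re}z<0\}$, and unstable if this spectrum meets $\{\operatorname{Re}z>0\}$. Suppose that $k_m<0$ for all $m\ge1$ and $-k_1>-k_2>\cdots>0$. Put $\lambda_m=-2/k_m$ and $\phi_m(\theta)=\cos(2m\theta)$.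 Then for every $m\ge1$: (a) (Bifurcation points) Two branches of nontrivial solutions bifurcate from the trivial solution at $\lambda_m$: there are $\delta>0$ and continuous functions $\Lambda:(-\delta,\delta)\to\mathbb R$, $z:(-\delta,\delta)\to H$ with $\Lambda(0)=\lambda_m$, $z(0)=0$, $z(t)\perp\phi_m$ in $H$, such that, with $V_t=t(\phi_m+z(t))$, the solutions $(\lambda,V)$ in some neighbourhood of $(\lambda_m,0)$ in $\mathbb R\times H$ are exactly the trivial ones and the pairs $(\Lambda(t),V_t)$, $|t|<\delta$. The two branches are those with $t>0$ and with $t<0$. Moreover $\delta$ can be chosen such that the following hold for all $0<|t|<\delta$, that is, on both branches. (b) (Criticality) If $\frac{2k_{2m}}{k_m}<1$, the bifurcation is supercritical: $\Lambda(t)>\lambda_m$. If $\frac{2k_{2m}}{k_m}>1$, it is subcritical: $\Lambda(t)<\lambda_m$. (c) (Stability) If $m\ge2$, the bifurcated solutions $V_t$ (for the parameter $\Lambda(t)$) are unstable. If $m=1$, they are stable if $\frac{2k_2}{k_1}<1$ and unstable if $\frac{2k_2}{k_1}>1$. -/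

import Mathlib

open Real Set MeasureTheory
open scoped NNReal ContDiff

noncomputable section

namespace DoiOnsager

/-- Lebesgue measure on the interval of angles `[0, 2π]` (up to the null set of endpoints). -/
abbrev angleMeasure : Measure ℝ := volume.restrict (Ioc 0 (2 * π))

/-- The real Lebesgue space `L²([0, 2π])`. -/
abbrev L2 : Type := Lp ℝ 2 angleMeasure

/-- `w` is the weak derivative of `v` on `(0, 2π)`, tested against smooth functions with
compact support in `(0, 2π)`. -/
def IsWeakDeriv (v w : ℝ → ℝ) : Prop :=
  ∀ φ : ℝ → ℝ, ContDiff ℝ ∞ φ → HasCompactSupport φ → tsupport φ ⊆ Ioo 0 (2 * π) →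
    ∫ θ in (0)..(2 * π), v θ * deriv φ θ = -∫ θ in (0)..(2 * π), w θ * φ θ

lemma ae_angle_iff {p : ℝ → Prop} :
    (∀ᵐ θ ∂angleMeasure, p θ) ↔ ∀ᵐ θ, θ ∈ Ioc 0 (2 * π) → p θ :=
  ae_restrict_iff' measurableSet_Ioc

lemma ae_shift {p : ℝ → Prop} (h : ∀ᵐ θ ∂angleMeasure, p θ) :
    ∀ᵐ θ, θ ∈ Ioo 0 π → p θ ∧ p (θ + π) := by
  rw [ae_angle_iff] at h
  have h2 := (measurePreserving_add_right volume π).quasiMeasurePreserving.ae h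
  filter_upwards [h, h2] with θ h1 h2 hθ
  have := pi_pos
  exact ⟨h1 ⟨hθ.1, by linarith [hθ.2]⟩, h2 ⟨by linarith [hθ.1], by linarith [hθ.2]⟩⟩

lemma ae_reflect {p : ℝ → Prop} (h : ∀ᵐ θ ∂angleMeasure, p θ) :
    ∀ᵐ θ, θ ∈ Ioo 0 (2 * π) → p θ ∧ p (2 * π - θ) := by
  rw [ae_angle_iff] at h
  have h2 := (Measure.measurePreserving_sub_left volume (2 * π)).quasiMeasurePreserving.ae h
  filter_upwards [h, h2] with θ h1 h2 hθ
  exact ⟨h1 ⟨hθ.1, hθ.2.le⟩, h2 ⟨by linarith [hθ.2], by linarith [hθ.1]⟩⟩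

lemma interval_eq (f : ℝ → ℝ) :
    ∫ θ in (0)..(2 * π), f θ = ∫ θ, f θ ∂angleMeasure :=
  intervalIntegral.integral_of_le (by positivity)

lemma integrable_L2 (v : L2) : Integrable v angleMeasure :=
  (Lp.memLp v).integrable (by norm_num)

lemma integrable_L2_mul (v : L2) {φ : ℝ → ℝ} (hφ : Continuous φ) (hc : HasCompactSupport φ) :
    Integrable (fun θ => v θ * φ θ) angleMeasure := by
  obtain ⟨C, hC⟩ := hc.exists_bound_of_continuous hφ
  exact (integrable_L2 v).mul_bdd (c := C) hφ.aestronglyMeasurable (.of_forall hC)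

/-- The real Hilbert space `H` of all `V ∈ H¹([0, 2π])` with `V(θ) = V(θ + π)` a.e.,
`∫ V = 0` and `V(θ) = V(2π - θ)` a.e.  An element of `H¹` is represented by the pair of its
function and its weak derivative in `L² × L²`, so that the inner product inherited from the
`ℓ²`-product `L² × L²` is the `H¹`-inner product `∫ U V + ∫ U' V'`. -/
def H : Submodule ℝ (WithLp 2 (L2 × L2)) where
  carrier := {p |
    IsWeakDeriv p.fst p.snd ∧
    (∀ᵐ θ : ℝ, θ ∈ Ioo 0 π → p.fst (θ + π) = p.fst θ) ∧
    (∫ θ in (0)..(2 * π), p.fst θ) = 0 ∧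
    (∀ᵐ θ : ℝ, θ ∈ Ioo 0 (2 * π) → p.fst (2 * π - θ) = p.fst θ)}
  zero_mem' := by
    have h0 : ((0 : L2) : ℝ → ℝ) =ᵐ[angleMeasure] fun _ => 0 := Lp.coeFn_zero _ _ _
    refine ⟨fun φ _ _ _ => ?_, ?_, ?_, ?_⟩
    · have e (ψ : ℝ → ℝ) : ∫ θ, ((0 : L2) : ℝ → ℝ) θ * ψ θ ∂angleMeasure = 0 := by
        rw [integral_congr_ae (g := fun _ => (0 : ℝ))
          (by filter_upwards [h0] with θ h; rw [h, zero_mul])]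
        simp
      rw [interval_eq, interval_eq]
      exact (e (deriv φ)).trans ((congrArg Neg.neg (e φ)).trans neg_zero).symm
    · filter_upwards [ae_shift h0] with θ h hθ
      exact (h hθ).2.trans (h hθ).1.symm
    · rw [interval_eq]
      exact (integral_congr_ae h0).trans (by simp)
    · filter_upwards [ae_reflect h0] with θ h hθ
      exact (h hθ).2.trans (h hθ).1.symm
  add_mem' := by
    rintro p q ⟨hp1, hp2, hp3, hp4⟩ ⟨hq1, hq2, hq3, hq4⟩
    have ha (u v : L2) : ∀ᵐ θ ∂angleMeasure, (u + v : L2) θ = u θ + v θ := Lp.coeFn_add u v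
    have e (u v : L2) (ψ : ℝ → ℝ) (h : Continuous ψ) (hc : HasCompactSupport ψ) :
        ∫ θ, (u + v : L2) θ * ψ θ ∂angleMeasure =
          ∫ θ, u θ * ψ θ ∂angleMeasure + ∫ θ, v θ * ψ θ ∂angleMeasure := by
      rw [← integral_add (integrable_L2_mul u h hc) (integrable_L2_mul v h hc)]
      refine integral_congr_ae ?_
      filter_upwards [ha u v] with θ h
      rw [h]; ring
    refine ⟨fun φ h1 h2 h3 => ?_, ?_, ?_, ?_⟩
    · have hp := hp1 φ h1 h2 h3
      have hq := hq1 φ h1 h2 h3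
      rw [interval_eq, interval_eq] at *
      rw [WithLp.add_fst, WithLp.add_snd, e _ _ _ (h1.continuous_deriv (by simp)) h2.deriv,
        e _ _ _ h1.continuous h2, hp, hq]
      ring
    · filter_upwards [ae_shift (ha p.fst q.fst), hp2, hq2] with θ h h1 h2 hθ
      rw [WithLp.add_fst, (h hθ).1, (h hθ).2, h1 hθ, h2 hθ]
    · rw [interval_eq] at *
      rw [WithLp.add_fst, integral_congr_ae (ha p.fst q.fst),
        integral_add (integrable_L2 _) (integrable_L2 _), hp3, hq3, add_zero]
    · filter_upwards [ae_reflect (ha p.fst q.fst), hp4, hq4] with θ h h1 h2 hθ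
      rw [WithLp.add_fst, (h hθ).1, (h hθ).2, h1 hθ, h2 hθ]
  smul_mem' := by
    rintro c p ⟨hp1, hp2, hp3, hp4⟩
    have ha (u : L2) : ∀ᵐ θ ∂angleMeasure, (c • u : L2) θ = c * u θ := Lp.coeFn_smul c u
    have e (u : L2) (ψ : ℝ → ℝ) :
        ∫ θ, (c • u : L2) θ * ψ θ ∂angleMeasure = c * ∫ θ, u θ * ψ θ ∂angleMeasure := by
      rw [← integral_const_mul]
      refine integral_congr_ae ?_
      filter_upwards [ha u] with θ h
      rw [h]; ring
    refine ⟨fun φ h1 h2 h3 => ?_, ?_, ?_, ?_⟩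
    · have hp := hp1 φ h1 h2 h3
      rw [interval_eq, interval_eq] at *
      rw [WithLp.smul_fst, WithLp.smul_snd, e, e, hp]
      ring
    · filter_upwards [ae_shift (ha p.fst), hp2] with θ h h1 hθ
      rw [WithLp.smul_fst, (h hθ).1, (h hθ).2, h1 hθ]
    · rw [interval_eq] at *
      rw [WithLp.smul_fst, integral_congr_ae (ha p.fst), integral_const_mul, hp3, mul_zero]
    · filter_upwards [ae_reflect (ha p.fst), hp4] with θ h h1 hθ
      rw [WithLp.smul_fst, (h hθ).1, (h hθ).2, h1 hθ]

/-- The function on `[0, 2π]` underlying an element of `H` (defined almost everywhere). -/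
def fn (V : H) : ℝ → ℝ := V.1.fst

lemma bounded_memLp {f : ℝ → ℝ} (hm : Measurable f) {C : ℝ} (hC : ∀ θ ∈ Ioc 0 (2 * π), ‖f θ‖ ≤ C) :
    MemLp f 2 angleMeasure :=
  MemLp.of_bound hm.aestronglyMeasurable C ((ae_restrict_iff' measurableSet_Ioc).2 (.of_forall hC))

lemma memLp_lipschitz {C : ℝ≥0} {g : ℝ → ℝ} (hg : LipschitzWith C g) :
    MemLp g 2 angleMeasure := by
  obtain ⟨B, hB⟩ := (isCompact_Icc (a := (0 : ℝ)) (b := 2 * π)).exists_bound_of_continuousOn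
    hg.continuous.continuousOn
  exact bounded_memLp hg.continuous.measurable fun θ hθ => hB θ ⟨hθ.1.le, hθ.2⟩

lemma memLp_deriv_lipschitz {C : ℝ≥0} {g : ℝ → ℝ} (hg : LipschitzWith C g) :
    MemLp (deriv g) 2 angleMeasure :=
  bounded_memLp (measurable_deriv g) fun _ _ => norm_deriv_le_of_lipschitz hg

lemma isWeakDeriv_lipschitz {C : ℝ≥0} {g : ℝ → ℝ} (hg : LipschitzWith C g) :
    IsWeakDeriv g (deriv g) := by
  intro φ h1 h2 h3
  have e0 : φ 0 = 0 := image_eq_zero_of_notMem_tsupport fun h => by simpa using (h3 h).1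
  have e1 : φ (2 * π) = 0 := image_eq_zero_of_notMem_tsupport fun h => by simpa using (h3 h).2
  have := AbsolutelyContinuousOnInterval.integral_mul_deriv_eq_deriv_mul (a := 0) (b := 2 * π)
    (hg.lipschitzOnWith (s := _)).absolutelyContinuousOnInterval
    ((h1.of_le (by simp)).contDiffOn (s := _)).absolutelyContinuousOnInterval
  rw [this, e0, e1]
  ring

/-- The element of `H` given by an everywhere defined Lipschitz function with the symmetries of
`H` (its weak derivative is its a.e. pointwise derivative). -/
def ofLipschitz (g : ℝ → ℝ) (hg : ∃ C : ℝ≥0, LipschitzWith C g)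
    (hper : ∀ θ, g (θ + π) = g θ) (hmean : ∫ θ in (0)..(2 * π), g θ = 0)
    (heven : ∀ θ, g (2 * π - θ) = g θ) : H :=
  ⟨WithLp.toLp 2 ((memLp_lipschitz hg.choose_spec).toLp g,
      (memLp_deriv_lipschitz hg.choose_spec).toLp (deriv g)), by
    have c1 := (memLp_lipschitz hg.choose_spec).coeFn_toLp
    have c2 := (memLp_deriv_lipschitz hg.choose_spec).coeFn_toLp
    refine ⟨fun φ h1 h2 h3 => ?_, ?_, ?_, ?_⟩
    · have := isWeakDeriv_lipschitz hg.choose_spec φ h1 h2 h3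
      rw [interval_eq, interval_eq] at *
      refine Eq.trans (integral_congr_ae ?_) (this.trans (congrArg _ (integral_congr_ae ?_)))
      · filter_upwards [c1] with θ h
        exact congrArg (· * _) h
      · filter_upwards [c2] with θ h
        exact congrArg (· * _) h.symm
    · filter_upwards [ae_shift c1] with θ h hθ
      exact (h hθ).2.trans ((hper θ).trans (h hθ).1.symm)
    · rw [interval_eq] at *
      exact (integral_congr_ae c1).trans hmean
    · filter_upwards [ae_reflect c1] with θ h hθ
      exact (h hθ).2.trans ((heven θ).trans (h hθ).1.symm)⟩

lemma ofLipschitz_ae (g : ℝ → ℝ) (hg : ∃ C : ℝ≥0, LipschitzWith C g)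
    (hper : ∀ θ, g (θ + π) = g θ) (hmean : ∫ θ in (0)..(2 * π), g θ = 0)
    (heven : ∀ θ, g (2 * π - θ) = g θ) :
    fn (ofLipschitz g hg hper hmean heven) =ᵐ[angleMeasure] g :=
  (memLp_lipschitz hg.choose_spec).coeFn_toLp

/-- An interaction kernel in two dimensions: an even, `π`-periodic function in `W^{1,∞}`, that is
(for the continuous representative) a Lipschitz function. -/
structure Kernel where
  /-- The kernel as a function of the angle. -/
  toFun : ℝ → ℝ
  lipschitz : ∃ C : ℝ≥0, LipschitzWith C toFun
  even : ∀ θ, toFun (-θ) = toFun θ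
  periodic : ∀ θ, toFun (θ + π) = toFun θ

/-- For `m ≥ 1`, the coefficient `k_m` of `cos (2mθ)` in the Fourier expansion
`K(θ) = ∑_{m ≥ 0} k_m cos (2mθ)`. -/
def Kernel.coeff (K : Kernel) (m : ℕ) : ℝ :=
  (1 / π) * ∫ θ in (0)..(2 * π), K.toFun θ * cos (2 * m * θ)

/-- The mean-free kernel `K̃ = K - (1 / 2π) ∫ K`. -/
def Kernel.tilde (K : Kernel) (θ : ℝ) : ℝ :=
  K.toFun θ - (1 / (2 * π)) * ∫ s in (0)..(2 * π), K.toFun s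

/-- The function `Γ(V)(θ) = ∫ K̃(θ - θ') e^{-V(θ')} dθ' / ∫ e^{-V(θ)} dθ`. -/
def gammaFun (K : Kernel) (V : H) (θ : ℝ) : ℝ :=
  (∫ s in (0)..(2 * π), K.tilde (θ - s) * exp (-fn V s)) /
    ∫ s in (0)..(2 * π), exp (-fn V s)

lemma Kernel.tilde_continuous (K : Kernel) : Continuous K.tilde :=
  K.lipschitz.choose_spec.continuous.sub continuous_const

lemma Kernel.tilde_periodic (K : Kernel) (θ : ℝ) : K.tilde (θ + π) = K.tilde θ := by
  simp [Kernel.tilde, K.periodic]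

lemma Kernel.tilde_periodic_two_pi (K : Kernel) : Function.Periodic K.tilde (2 * π) := fun θ => by
  rw [show θ + 2 * π = θ + π + π by ring, K.tilde_periodic, K.tilde_periodic]

lemma Kernel.tilde_even (K : Kernel) (θ : ℝ) : K.tilde (-θ) = K.tilde θ := by
  simp [Kernel.tilde, K.even]

lemma Kernel.tilde_bounded (K : Kernel) : ∃ B, ∀ θ, ‖K.tilde θ‖ ≤ B := by
  obtain ⟨B, hB⟩ := (isCompact_Icc (a := (0 : ℝ)) (b := 2 * π)).exists_bound_of_continuousOn
    K.tilde_continuous.continuousOn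
  refine ⟨B, fun θ => ?_⟩
  obtain ⟨y, hy, e⟩ := K.tilde_periodic_two_pi.exists_mem_Ico₀ (by positivity) θ
  rw [e]
  exact hB y ⟨hy.1, hy.2.le⟩

lemma Kernel.tilde_mean (K : Kernel) (s : ℝ) : ∫ θ in (0)..(2 * π), K.tilde (θ - s) = 0 := by
  rw [intervalIntegral.integral_comp_sub_right (fun x => K.tilde x)]
  have h := K.tilde_periodic_two_pi.intervalIntegral_add_eq (0 - s) 0
  rw [show 0 - s + 2 * π = 2 * π - s by ring, zero_add] at h
  rw [h]
  unfold Kernel.tilde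
  rw [intervalIntegral.integral_sub (K.lipschitz.choose_spec.continuous.intervalIntegrable _ _)
    (by simp)]
  simp only [intervalIntegral.integral_const, smul_eq_mul]
  have := pi_pos.ne'
  field_simp
  ring

lemma gammaFun_lipschitz (K : Kernel) (V : H) : ∃ C : ℝ≥0, LipschitzWith C (gammaFun K V) := by
  obtain ⟨C, hC⟩ := K.lipschitz
  obtain ⟨B, hB⟩ := K.tilde_bounded
  refine ⟨C, LipschitzWith.of_dist_le_mul fun x y => ?_⟩
  unfold gammaFun
  rw [interval_eq, interval_eq, interval_eq]
  by_cases hi : Integrable (fun s => exp (-fn V s)) angleMeasure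
  swap
  · rw [integral_undef hi]
    simp only [div_zero, dist_self]
    positivity
  have hm (x : ℝ) : Integrable (fun s => K.tilde (x - s) * exp (-fn V s)) angleMeasure :=
    hi.bdd_mul (c := B)
      (K.tilde_continuous.comp (by fun_prop)).aestronglyMeasurable (.of_forall fun _ => hB _)
  have h0 : 0 ≤ ∫ s, exp (-fn V s) ∂angleMeasure := integral_nonneg fun _ => (exp_pos _).le
  rw [Real.dist_eq, ← sub_div, ← integral_sub (hm x) (hm y), abs_div, abs_of_nonneg h0]
  refine div_le_of_le_mul₀ h0 (by positivity) ?_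
  rw [← integral_const_mul]
  refine abs_integral_le_integral_abs.trans ?_
  refine integral_mono ((hm x).sub (hm y)).abs (hi.const_mul _) fun s => ?_
  show |_| ≤ _
  rw [← sub_mul, abs_mul, abs_of_nonneg (exp_pos _).le]
  refine mul_le_mul_of_nonneg_right ?_ (exp_pos _).le
  have := hC.dist_le_mul (x - s) (y - s)
  rw [dist_sub_right, Real.dist_eq] at this
  simpa [Kernel.tilde] using this

lemma gammaFun_periodic (K : Kernel) (V : H) (θ : ℝ) :
    gammaFun K V (θ + π) = gammaFun K V θ := by
  unfold gammaFun
  simp only [show ∀ s, θ + π - s = θ - s + π from fun s => by ring, K.tilde_periodic]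

lemma gammaFun_mean (K : Kernel) (V : H) : ∫ θ in (0)..(2 * π), gammaFun K V θ = 0 := by
  obtain ⟨B, hB⟩ := K.tilde_bounded
  unfold gammaFun
  rw [intervalIntegral.integral_div]
  by_cases hi : Integrable (fun s => exp (-fn V s)) angleMeasure
  swap
  · rw [interval_eq (fun s => exp (-fn V s)), integral_undef hi, div_zero]
  have hj : Integrable (fun p : ℝ × ℝ => K.tilde (p.1 - p.2) * exp (-fn V p.2))
      (angleMeasure.prod angleMeasure) :=
    (hi.comp_snd angleMeasure).bdd_mul (c := B)
      (K.tilde_continuous.comp (by fun_prop)).aestronglyMeasurable (.of_forall fun _ => hB _)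
  simp only [interval_eq]
  rw [integral_integral_swap hj]
  simp_rw [integral_mul_const, ← interval_eq, K.tilde_mean]
  simp

lemma gammaFun_even (K : Kernel) (V : H) (θ : ℝ) :
    gammaFun K V (2 * π - θ) = gammaFun K V θ := by
  unfold gammaFun
  congr 1
  have h := intervalIntegral.integral_comp_sub_left (a := 0) (b := 2 * π)
    (fun s => K.tilde (2 * π - θ - s) * exp (-fn V s)) (2 * π)
  rw [sub_self, sub_zero] at h
  rw [← h, intervalIntegral.integral_of_le (by positivity),
    intervalIntegral.integral_of_le (by positivity), integral_Ioc_eq_integral_Ioo,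
    integral_Ioc_eq_integral_Ioo]
  refine setIntegral_congr_ae measurableSet_Ioo ?_
  filter_upwards [V.2.2.2.2] with s hs hs'
  have e : fn V (2 * π - s) = fn V s := hs hs'
  rw [e, show 2 * π - θ - (2 * π - s) = -(θ - s) by ring, K.tilde_even]

/-- The operator `Γ : H → H`. -/
def Gamma (K : Kernel) (V : H) : H :=
  ofLipschitz (gammaFun K V) (gammaFun_lipschitz K V) (gammaFun_periodic K V)
    (gammaFun_mean K V) (gammaFun_even K V)

/-- `V ∈ H` solves the fixed-point problem `V = λ Γ(V)`. -/
def IsSolution (K : Kernel) (lam : ℝ) (V : H) : Prop := V = lam • Gamma K V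

lemma cosMode_lipschitz (m : ℕ) : ∃ C : ℝ≥0, LipschitzWith C fun θ : ℝ => cos (2 * m * θ) := by
  refine ⟨2 * m, LipschitzWith.of_dist_le_mul fun x y => ?_⟩
  have h := Real.lipschitzWith_cos.dist_le_mul (2 * m * x) (2 * m * y)
  refine h.trans_eq ?_
  simp [Real.dist_eq, ← mul_sub, abs_mul]

lemma cosMode_mean (m : ℕ) (hm : 1 ≤ m) : ∫ θ in (0)..(2 * π), cos (2 * m * θ) = 0 := by
  have hm' : (2 * m : ℝ) ≠ 0 := by positivity
  rw [intervalIntegral.integral_comp_mul_left (fun x => cos x) hm', integral_cos,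
    show 2 * (m : ℝ) * (2 * π) = ((4 * m : ℕ) : ℝ) * π by push_cast; ring, sin_nat_mul_pi]
  simp

/-- The mode `θ ↦ cos (2mθ)`, `m ≥ 1`, as an element of `H`. -/
def cosMode (m : ℕ) (hm : 1 ≤ m) : H :=
  ofLipschitz (fun θ => cos (2 * m * θ)) (cosMode_lipschitz m)
    (fun θ => by
      rw [show 2 * (m : ℝ) * (θ + π) = 2 * m * θ + m * (2 * π) by ring, cos_add_nat_mul_two_pi])
    (cosMode_mean m hm)
    (fun θ => by
      rw [show 2 * (m : ℝ) * (2 * π - θ) = ((2 * m : ℕ) : ℝ) * (2 * π) - 2 * m * θ by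
        push_cast; ring, cos_nat_mul_two_pi_sub])

/-- A pair of nontrivial solution branches of `V = λ Γ(V)` bifurcating from the trivial solution
`V = 0` at `λ = lam0` in the direction `v ≠ 0`.  The pair is the curve
`t ↦ (Λ t, t • (v + z t))`, `|t| < δ`, the two branches being `0 < t < δ` and `-δ < t < 0`; here
`Λ` and `z` are continuous, `Λ 0 = lam0`, `z 0 = 0` and `z t ⟂ v`.  In a neighbourhood `W` of
`(lam0, 0)` in `ℝ × H` the solutions are exactly the trivial ones and those on the curve. -/
structure IsBifurcatingPair (K : Kernel) (lam0 : ℝ) (v : H) (δ : ℝ) (Λ : ℝ → ℝ) (z : ℝ → H) :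
    Prop where
  pos : 0 < δ
  direction_ne_zero : v ≠ 0
  continuousOn_parameter : ContinuousOn Λ (Ioo (-δ) δ)
  continuousOn_remainder : ContinuousOn z (Ioo (-δ) δ)
  parameter_zero : Λ 0 = lam0
  remainder_zero : z 0 = 0
  remainder_orthogonal : ∀ t ∈ Ioo (-δ) δ, inner ℝ v (z t) = 0
  solutions_eq : ∃ W : Set (ℝ × H), IsOpen W ∧ (lam0, (0 : H)) ∈ W ∧
    {p ∈ W | IsSolution K p.1 p.2} =
      (fun t => (Λ t, t • (v + z t))) '' Ioo (-δ) δ ∪ {p ∈ W | p.2 = 0}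

/-- The spectrum in `ℂ` of (the complexification of) a bounded operator `A` on the real space
`H`: since `(A - z)(A - z̄) = (A - Re z)² + (Im z)²` and `A` is real, `A - z` is invertible on the
complexification of `H` iff this real operator is invertible on `H`. -/
def complexSpectrum (A : H →L[ℝ] H) : Set ℂ :=
  {z | ¬ IsUnit ((A - z.re • (1 : H →L[ℝ] H)) ^ 2 + z.im ^ 2 • (1 : H →L[ℝ] H))}

/-- `V` is (linearly) stable for the parameter `lam`: `Γ` is Fréchet differentiable at `V` and the
spectrum of the linearization `lam • DΓ(V) - I` lies in the open left half-plane. -/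
def IsStable (K : Kernel) (lam : ℝ) (V : H) : Prop :=
  ∃ A : H →L[ℝ] H, HasFDerivAt (Gamma K) A V ∧
    ∀ z ∈ complexSpectrum (lam • A - 1), z.re < 0

/-- `V` is (linearly) unstable for the parameter `lam`: `Γ` is Fréchet differentiable at `V` and
the spectrum of the linearization `lam • DΓ(V) - I` meets the open right half-plane. -/
def IsUnstable (K : Kernel) (lam : ℝ) (V : H) : Prop :=
  ∃ A : H →L[ℝ] H, HasFDerivAt (Gamma K) A V ∧
    ∃ z ∈ complexSpectrum (lam • A - 1), 0 < z.re

/-- The critical parameter `λ_m = -2 / k_m`. -/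
def Kernel.criticalParam (K : Kernel) (m : ℕ) : ℝ := -2 / K.coeff m

end DoiOnsager

end

/-!
The map `Γ` is a composition of the Sobolev embedding of `H` in the Banach algebra `Alg` of
continuous functions (`embed`), the exponential of that algebra, and a bounded operator
`conv K : L² → H`, convolution with `K̃`, which acts on `cos (2nθ)` as multiplication by `π k_n`
(`Gamma_eq`, `cosCoeff_conv`). Hence `Γ` is smooth, and as the normalised cosine modes are a Hilbert
basis of `H` (`modeBasis`), everything at `V = 0` is diagonal. Write `r = k_{2m} / k_m`; the
hypotheses give `0 < r < 1`.

*Bifurcation.* The quotient `Γ(t v) / t` extends smoothly to `t = 0`. Dividing the equation for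
`V = t (φ_m + v)`, `v ⟂ φ_m`, by `t` therefore removes the trivial solution. The pair `(v, λ)` is
encoded in one vector of `H`, with `1 - λ / λ_m` as its coefficient along `φ_m`; the derivative of
the reduced equation with respect to this vector is `1 - λ_m DΓ(0)` plus the projection to `φ_m`,
a diagonal operator whose eigenvalues stay away from `0` because the `k_n` are strictly monotone
(`exists_bifOp_equiv`). The implicit function theorem gives the branches. Conversely, solutions near
the bifurcation point are tangent to `φ_m` (`eventually_norm_offMode_le`) and hence lie in the
domain where the implicit function is unique (`exists_branches`).

*Criticality.* The implicit function has derivative `b φ_{2m}` at `0` with `b = -r / (4 (1 - r))`.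
Testing the equation with `φ_m` then gives `Λ(t) = λ_m (1 + η t² + o(t²))` with
`η = (1 - 2r) / (8 (1 - r))` (`exists_branchExpansion`).

*Stability.* With the Gibbs density `ρ = e^{-V} / ∫ e^{-V}`, the operator `λ DΓ(V)` is a product
`P N` of operators through `L²` such that `N P` is symmetric, and whether the spectrum of `P N - 1`
meets the right half-plane can be read off the quadratic form `‖g‖² - ⟨N P g, g⟩`
(`isUnit_of_coercive`, `exists_not_isUnit_of_lt`). In the variable `f = ρ^{1/2} g`, with `∫ f = 0`,
this form is `∫ f² / ρ - λ ∑ |k_n| c_n(f)²`, where `c_n(f) = ∫ f cos (2nθ)`. For `m ≥ 2` it is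
negative at `f = cos (2θ)` for small `t`. For `m = 1` it is degenerate at `t = 0` in exactly this
direction, and its sign is decided by the terms of order `t²`. In the subcritical case it is
negative at `f = cos (2θ) + γ t cos (4θ)`, with `γ = -1 / (2 (1 - r))`. In the supercritical case
the modes `n ≥ 2` are bounded by Bessel's inequality, which replaces `1 / ρ` by `1 / ρ - λ |k_2| π`, and
the first mode is controlled by the Cauchy-Schwarz inequality with this weight
(`isStable_of_weight`); the resulting scalar condition holds with the margin
`t² (1 - 2r) / (4 (1 - r)²) + o(t²)`.
-/

noncomputable section

namespace DoiOnsager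

open Filter Topology

/-! ### The space `H` -/

lemma ae_Ioo_iff {p : ℝ → Prop} :
    (∀ᵐ θ ∂angleMeasure, p θ) ↔ ∀ᵐ θ, θ ∈ Ioo 0 (2 * π) → p θ := by
  rw [← ae_restrict_iff' measurableSet_Ioo, angleMeasure, Measure.restrict_congr_set Ioo_ae_eq_Ioc]

lemma intervalIntegrable_iff_angle {f : ℝ → ℝ} :
    IntervalIntegrable f volume 0 (2 * π) ↔ Integrable f angleMeasure :=
  intervalIntegrable_iff_integrableOn_Ioc_of_le (by positivity)

/-- A function on the interval of angles that is orthogonal to all test functions vanishes. -/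
lemma ae_eq_zero_of_test {w : ℝ → ℝ} (hw : Integrable w angleMeasure)
    (h : ∀ φ : ℝ → ℝ, ContDiff ℝ ∞ φ → HasCompactSupport φ → tsupport φ ⊆ Ioo 0 (2 * π) →
      ∫ θ in (0)..(2 * π), w θ * φ θ = 0) : w =ᵐ[angleMeasure] 0 := by
  refine ae_Ioo_iff.2 (isOpen_Ioo.ae_eq_zero_of_integral_contDiff_smul_eq_zero ?_ ?_)
  · have : IntegrableOn w (Ioo 0 (2 * π)) := IntegrableOn.mono_set hw Ioo_subset_Ioc_self
    exact this.locallyIntegrableOn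
  · intro φ h1 h2 h3
    have := h φ h1 h2 h3
    rw [interval_eq] at this
    rw [← this, ← setIntegral_eq_integral_of_forall_compl_eq_zero (s := Ioc 0 (2 * π))]
    · exact integral_congr_ae (.of_forall fun θ => mul_comm _ _)
    · intro x hx
      rw [image_eq_zero_of_notMem_tsupport fun hx' => hx (Ioo_subset_Ioc_self (h3 hx')), zero_smul]

/-- The inclusion of `H` in `L²`. -/
def toL2 : H →L[ℝ] L2 := (WithLp.fstL 2 ℝ L2 L2).comp H.subtypeL

/-- The weak derivative, as an operator from `H` to `L²`. -/
def weakDeriv : H →L[ℝ] L2 := (WithLp.sndL 2 ℝ L2 L2).comp H.subtypeL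

@[simp] lemma toL2_apply (u : H) : toL2 u = u.1.fst := rfl
@[simp] lemma weakDeriv_apply (u : H) : weakDeriv u = u.1.snd := rfl

lemma coe_toL2 (u : H) : (toL2 u : ℝ → ℝ) = fn u := rfl

lemma inner_H (u v : H) :
    inner ℝ u v = inner ℝ (toL2 u) (toL2 v) + inner ℝ (weakDeriv u) (weakDeriv v) := by
  rw [Submodule.coe_inner, WithLp.prod_inner_apply]; rfl

lemma norm_sq_H (u : H) : ‖u‖ ^ 2 = ‖toL2 u‖ ^ 2 + ‖weakDeriv u‖ ^ 2 := by
  rw [← real_inner_self_eq_norm_sq, inner_H, real_inner_self_eq_norm_sq, real_inner_self_eq_norm_sq]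

/-- An element of `H` is determined by its function: weak derivatives are unique. -/
lemma toL2_injective : Function.Injective toL2 := by
  refine (injective_iff_map_eq_zero _).2 fun u hu => ?_
  have hw : weakDeriv u = 0 := by
    refine Lp.eq_zero_iff_ae_eq_zero.2 (ae_eq_zero_of_test (integrable_L2 _) fun φ h1 h2 h3 => ?_)
    have := u.2.1 φ h1 h2 h3
    have h0 : (u.1.fst : ℝ → ℝ) =ᵐ[angleMeasure] 0 := Lp.eq_zero_iff_ae_eq_zero.1 hu
    have e : ∫ θ in (0)..(2 * π), u.1.fst θ * deriv φ θ = 0 := by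
      rw [interval_eq]
      refine integral_eq_zero_of_ae ?_
      filter_upwards [h0] with θ h
      simp [h]
    rw [e] at this
    simpa using this.symm
  have := norm_sq_H u
  rw [hu, hw] at this
  simpa using this

lemma inner_L2 (f g : L2) : inner ℝ f g = ∫ θ in (0)..(2 * π), f θ * g θ := by
  rw [interval_eq, L2.inner_def]
  simp [mul_comm]

lemma integrable_mul_L2 (f g : L2) : Integrable (fun θ => f θ * g θ) angleMeasure :=
  (Lp.memLp f).integrable_mul (Lp.memLp g)

instance : CompleteSpace H := by
  refine IsClosed.completeSpace_coe (hs := ?_)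
  refine isClosed_of_closure_subset fun p hp => ?_
  obtain ⟨u, hu, hlim⟩ := mem_closure_iff_seq_limit.1 hp
  have l1 : Tendsto (fun n => (u n).fst) atTop (𝓝 p.fst) :=
    ((WithLp.fstL 2 ℝ L2 L2).continuous.tendsto _).comp hlim
  have l2 : Tendsto (fun n => (u n).snd) atTop (𝓝 p.snd) :=
    ((WithLp.sndL 2 ℝ L2 L2).continuous.tendsto _).comp hlim
  obtain ⟨ns, -, hns⟩ := (tendstoInMeasure_of_tendsto_Lp l1).exists_seq_tendsto_ae
  -- pairing with a bounded continuous function passes to the limit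
  have key (f : ℕ → L2) (g : L2) (hf : Tendsto f atTop (𝓝 g)) (ψ : ℝ → ℝ)
      (hψ : MemLp ψ 2 angleMeasure) :
      Tendsto (fun n => ∫ θ in (0)..(2 * π), f n θ * ψ θ) atTop
        (𝓝 (∫ θ in (0)..(2 * π), g θ * ψ θ)) := by
    have e (f : L2) : ∫ θ in (0)..(2 * π), f θ * ψ θ = inner ℝ f (hψ.toLp ψ) := by
      rw [inner_L2, interval_eq, interval_eq]
      refine integral_congr_ae ?_
      filter_upwards [hψ.coeFn_toLp] with θ h
      rw [h]
    simp only [e]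
    exact hf.inner tendsto_const_nhds
  refine ⟨fun φ h1 h2 h3 => ?_, ?_, ?_, ?_⟩
  · have m1 : MemLp φ 2 angleMeasure :=
      (h1.continuous.memLp_of_hasCompactSupport h2).restrict _
    have m2 : MemLp (deriv φ) 2 angleMeasure :=
      ((h1.continuous_deriv (by simp)).memLp_of_hasCompactSupport h2.deriv).restrict _
    refine tendsto_nhds_unique (key _ _ l1 _ m2) ((key _ _ l2 _ m1).neg.congr fun n => ?_)
    exact ((hu n).1 φ h1 h2 h3).symm
  · have hall : ∀ᵐ θ, ∀ n, θ ∈ Ioo 0 π → (u (ns n)).fst (θ + π) = (u (ns n)).fst θ :=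
      ae_all_iff.2 fun n => (hu _).2.1
    filter_upwards [hall, ae_shift hns] with θ h h' hθ
    refine tendsto_nhds_unique (h' hθ).2 ((h' hθ).1.congr fun n => (h n hθ).symm)
  · have := key _ _ l1 (fun _ => 1) (memLp_const _)
    simp only [mul_one] at this
    refine tendsto_nhds_unique this (tendsto_const_nhds.congr fun n => ?_)
    exact (hu n).2.2.1.symm
  · have hall : ∀ᵐ θ, ∀ n, θ ∈ Ioo 0 (2 * π) → (u (ns n)).fst (2 * π - θ) = (u (ns n)).fst θ :=
      ae_all_iff.2 fun n => (hu _).2.2.2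
    filter_upwards [hall, ae_reflect hns] with θ h h' hθ
    refine tendsto_nhds_unique (h' hθ).2 ((h' hθ).1.congr fun n => (h n hθ).symm)

/-! ### The algebra of continuous functions on the interval of angles -/

lemma two_pi_nonneg : (0 : ℝ) ≤ 2 * π := two_pi_pos.le

/-- The Banach algebra of continuous functions on `[0, 2π]`, in which `H` embeds. -/
abbrev Alg : Type := C(Icc (0 : ℝ) (2 * π), ℝ)

/-- The extension of a continuous function on `[0, 2π]` to the line, constant outside. -/
def ext (a : Alg) : ℝ → ℝ := IccExtend two_pi_nonneg a

lemma continuous_ext (a : Alg) : Continuous (ext a) := a.continuous.Icc_extend'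

lemma norm_ext_le (a : Alg) (θ : ℝ) : ‖ext a θ‖ ≤ ‖a‖ := a.norm_coe_le_norm _

lemma ext_add (a b : Alg) (θ : ℝ) : ext (a + b) θ = ext a θ + ext b θ := rfl
lemma ext_mul (a b : Alg) (θ : ℝ) : ext (a * b) θ = ext a θ * ext b θ := rfl
lemma ext_smul (c : ℝ) (a : Alg) (θ : ℝ) : ext (c • a) θ = c * ext a θ := rfl
lemma ext_one (θ : ℝ) : ext 1 θ = 1 := rfl

lemma ext_of_mem (a : Alg) {θ : ℝ} (h : θ ∈ Icc 0 (2 * π)) : ext a θ = a ⟨θ, h⟩ :=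
  IccExtend_of_mem _ _ h

/-- The restriction to `[0, 2π]` of a continuous function. -/
def restr (f : ℝ → ℝ) (hf : Continuous f) : Alg := ⟨fun θ => f θ, hf.comp continuous_subtype_val⟩

lemma ext_restr {f : ℝ → ℝ} (hf : Continuous f) {θ : ℝ} (h : θ ∈ Icc 0 (2 * π)) :
    ext (restr f hf) θ = f θ := ext_of_mem _ h

lemma memLp_ext (a : Alg) : MemLp (ext a) 2 angleMeasure :=
  bounded_memLp (continuous_ext a).measurable fun θ _ => norm_ext_le a θ

lemma memLp_ext_mul (a : Alg) (g : L2) : MemLp (fun θ => ext a θ * g θ) 2 angleMeasure :=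
  (Lp.memLp g).of_le_mul (c := ‖a‖)
    ((continuous_ext a).aestronglyMeasurable.mul (Lp.aestronglyMeasurable g))
    (.of_forall fun θ => by rw [norm_mul]; gcongr; exact norm_ext_le a θ)

/-- Multiplication by a continuous function, as an operator on `L²`. -/
def mulL (a : Alg) : L2 →L[ℝ] L2 :=
  LinearMap.mkContinuous
    { toFun := fun g => (memLp_ext_mul a g).toLp
      map_add' := fun f g => by
        rw [← MemLp.toLp_add]
        refine MemLp.toLp_congr _ _ ?_
        filter_upwards [Lp.coeFn_add f g] with θ h
        rw [h]; simp [mul_add]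
      map_smul' := fun c g => by
        rw [RingHom.id_apply, ← MemLp.toLp_const_smul]
        refine MemLp.toLp_congr _ _ ?_
        filter_upwards [Lp.coeFn_smul c g] with θ h
        rw [h]; simp [mul_left_comm] }
    ‖a‖ fun g => by
      refine Lp.norm_le_mul_norm_of_ae_le_mul ?_
      filter_upwards [(memLp_ext_mul a g).coeFn_toLp] with θ h
      rw [LinearMap.coe_mk, AddHom.coe_mk, h, norm_mul]
      gcongr
      exact norm_ext_le a θ

lemma coe_mulL (a : Alg) (g : L2) : mulL a g =ᵐ[angleMeasure] fun θ => ext a θ * g θ :=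
  (memLp_ext_mul a g).coeFn_toLp

/-- The class in `L²` of a continuous function. -/
def algToL2 : Alg →L[ℝ] L2 :=
  LinearMap.mkContinuous
    { toFun := fun a => (memLp_ext a).toLp
      map_add' := fun a b => by
        rw [← MemLp.toLp_add]; rfl
      map_smul' := fun c a => by
        rw [RingHom.id_apply, ← MemLp.toLp_const_smul]; rfl }
    (‖(memLp_const (1 : ℝ) : MemLp _ 2 angleMeasure).toLp‖) fun a => by
      refine (Lp.norm_le_mul_norm_of_ae_le_mul ?_).trans_eq (mul_comm ‖a‖ _)
      filter_upwards [(memLp_ext a).coeFn_toLp,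
        (memLp_const (1 : ℝ) : MemLp _ 2 angleMeasure).coeFn_toLp] with θ h h'
      rw [LinearMap.coe_mk, AddHom.coe_mk, h, h']
      simpa using norm_ext_le a θ

lemma coe_algToL2 (a : Alg) : algToL2 a =ᵐ[angleMeasure] ext a := (memLp_ext a).coeFn_toLp

lemma mulL_algToL2 (a b : Alg) : mulL a (algToL2 b) = algToL2 (a * b) := by
  refine Lp.ext ?_
  filter_upwards [coe_mulL a (algToL2 b), coe_algToL2 b, coe_algToL2 (a * b)] with θ h1 h2 h3
  rw [h1, h2, h3, ext_mul]

lemma mulL_mulL (a b : Alg) (g : L2) : mulL a (mulL b g) = mulL (a * b) g := by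
  refine Lp.ext ?_
  filter_upwards [coe_mulL a (mulL b g), coe_mulL b g, coe_mulL (a * b) g] with θ h1 h2 h3
  rw [h1, h2, h3, ext_mul, mul_assoc]

lemma mulL_one (g : L2) : mulL 1 g = g := by
  refine Lp.ext ?_
  filter_upwards [coe_mulL 1 g] with θ h1
  rw [h1, ext_one, one_mul]

lemma mulL_add (a b : Alg) (g : L2) : mulL (a + b) g = mulL a g + mulL b g := by
  refine Lp.ext ?_
  filter_upwards [coe_mulL a g, coe_mulL b g, coe_mulL (a + b) g,
    Lp.coeFn_add (mulL a g) (mulL b g)] with θ h1 h2 h3 h4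
  rw [h4, h3, Pi.add_apply, h1, h2, ext_add, add_mul]

lemma mulL_smul (c : ℝ) (a : Alg) (g : L2) : mulL (c • a) g = c • mulL a g := by
  refine Lp.ext ?_
  filter_upwards [coe_mulL a g, coe_mulL (c • a) g, Lp.coeFn_smul c (mulL a g)] with θ h1 h3 h4
  rw [h4, h3, Pi.smul_apply, h1, ext_smul, smul_eq_mul, mul_assoc]

lemma inner_mulL (a : Alg) (f g : L2) : inner ℝ (mulL a f) g = inner ℝ f (mulL a g) := by
  rw [inner_L2, inner_L2, interval_eq, interval_eq]
  refine integral_congr_ae ?_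
  filter_upwards [coe_mulL a f, coe_mulL a g] with θ h1 h2
  rw [h1, h2]; ring

lemma inner_algToL2 (a : Alg) (g : L2) :
    inner ℝ (algToL2 a) g = ∫ θ in (0)..(2 * π), ext a θ * g θ := by
  rw [inner_L2, interval_eq, interval_eq]
  refine integral_congr_ae ?_
  filter_upwards [coe_algToL2 a] with θ h1
  rw [h1]

/-- The integral over `[0, 2π]`, as a functional on continuous functions. -/
def integ : Alg →L[ℝ] ℝ := (innerSL ℝ (algToL2 1)).comp algToL2

lemma integ_apply (a : Alg) : integ a = ∫ θ in (0)..(2 * π), ext a θ := by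
  have : integ a = inner ℝ (algToL2 1) (algToL2 a) := rfl
  rw [this, real_inner_comm, inner_algToL2, interval_eq, interval_eq]
  refine integral_congr_ae ?_
  filter_upwards [coe_algToL2 1] with θ h1
  rw [h1, ext_one, mul_one]

lemma inner_algToL2_algToL2 (a b : Alg) : inner ℝ (algToL2 a) (algToL2 b) = integ (a * b) := by
  rw [inner_algToL2, integ_apply, interval_eq, interval_eq]
  refine integral_congr_ae ?_
  filter_upwards [coe_algToL2 b] with θ h1
  rw [h1, ext_mul]

lemma integ_one : integ 1 = 2 * π := by simp [integ_apply, ext_one]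

lemma integ_restr {f : ℝ → ℝ} (hf : Continuous f) :
    integ (restr f hf) = ∫ θ in (0)..(2 * π), f θ := by
  rw [integ_apply]
  refine intervalIntegral.integral_congr fun θ h => ?_
  rw [uIcc_of_le two_pi_nonneg] at h
  exact ext_restr hf h

lemma inner_mulL_algToL2 (a b : Alg) (g : L2) :
    inner ℝ (algToL2 (a * b)) g = inner ℝ (algToL2 b) (mulL a g) := by
  rw [← mulL_algToL2, inner_mulL]

/-! ### The Sobolev embedding -/

lemma continuousOn_primitive (w : L2) :
    ContinuousOn (fun θ => ∫ x in (0)..θ, w x) (Icc 0 (2 * π)) := by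
  have := intervalIntegral.continuousOn_primitive_interval
    (f := w) (μ := volume) (a := 0) (b := 2 * π) (by
      rw [uIcc_of_le two_pi_nonneg, integrableOn_Icc_iff_integrableOn_Ioc]
      exact integrable_L2 w)
  rwa [uIcc_of_le two_pi_nonneg] at this

lemma primitive_eq_inner (w : L2) {θ : ℝ} (h : θ ∈ Icc 0 (2 * π)) :
    ∫ x in (0)..θ, w x =
      inner ℝ (indicatorConstLp 2 measurableSet_Ioc (measure_ne_top angleMeasure (Ioc 0 θ))
        (1 : ℝ)) w := by
  rw [L2.inner_indicatorConstLp_one, intervalIntegral.integral_of_le h.1,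
    Measure.restrict_restrict measurableSet_Ioc, inter_eq_left.2 (Ioc_subset_Ioc_right h.2)]

/-- The primitive vanishing at `0` of an `L²` function. -/
def primitive : L2 →L[ℝ] Alg :=
  LinearMap.mkContinuous
    { toFun := fun w => ⟨fun θ => ∫ x in (0)..(θ : ℝ), w x, (continuousOn_primitive w).domRestrict⟩
      map_add' := fun v w => by
        ext θ
        change ∫ x in (0)..(θ : ℝ), (v + w : L2) x =
          (∫ x in (0)..(θ : ℝ), v x) + ∫ x in (0)..(θ : ℝ), w x
        rw [primitive_eq_inner _ θ.2, primitive_eq_inner _ θ.2, primitive_eq_inner _ θ.2,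
          inner_add_right]
      map_smul' := fun c w => by
        ext θ
        change ∫ x in (0)..(θ : ℝ), (c • w : L2) x = c * ∫ x in (0)..(θ : ℝ), w x
        rw [primitive_eq_inner _ θ.2, primitive_eq_inner _ θ.2, inner_smul_right] }
    (√(2 * π)) fun w => by
      refine (ContinuousMap.norm_le _ (by positivity)).2 fun θ => ?_
      change ‖∫ x in (0)..(θ : ℝ), w x‖ ≤ _
      rw [primitive_eq_inner _ θ.2]
      refine (norm_inner_le_norm _ _).trans ?_
      gcongr
      rw [norm_indicatorConstLp (by norm_num) (by norm_num), norm_one, one_mul,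
        ENNReal.toReal_ofNat, ← sqrt_eq_rpow]
      refine sqrt_le_sqrt ?_
      refine (measureReal_mono (subset_univ _)).trans ?_
      simp [measureReal_def, pi_nonneg]

lemma primitive_apply (w : L2) {θ : ℝ} (h : θ ∈ Icc 0 (2 * π)) :
    ext (primitive w) θ = ∫ x in (0)..θ, w x := ext_of_mem _ h

/-- The Lemma of du Bois-Reymond: a function with a weak derivative `w` is, up to a constant, the
primitive of `w`. -/
lemma exists_eq_primitive_add {v w : L2} (h : IsWeakDeriv v w) :
    ∃ c, v =ᵐ[angleMeasure] fun θ => ext (primitive w) θ + c := by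
  set W : ℝ → ℝ := fun θ => ∫ x in (0)..θ, w x with hW
  have hw : IntervalIntegrable w volume 0 (2 * π) :=
    intervalIntegrable_iff_angle.2 (integrable_L2 w)
  have hWac : AbsolutelyContinuousOnInterval W 0 (2 * π) :=
    hw.absolutelyContinuousOnInterval_intervalIntegral left_mem_uIcc
  have hWd : ∀ᵐ θ, θ ∈ uIcc 0 (2 * π) → deriv W θ = w θ := by
    filter_upwards [hw.ae_hasDerivAt_integral] with θ h' hθ
    exact (h' hθ 0 left_mem_uIcc).deriv
  -- integration by parts against test functions
  have parts (φ : ℝ → ℝ) (h1 : ContDiff ℝ ∞ φ) (h3 : tsupport φ ⊆ Ioo 0 (2 * π)) :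
      ∫ θ in (0)..(2 * π), W θ * deriv φ θ = -∫ θ in (0)..(2 * π), w θ * φ θ := by
    have e0 : φ 0 = 0 := image_eq_zero_of_notMem_tsupport fun h => by simpa using (h3 h).1
    have e1 : φ (2 * π) = 0 := image_eq_zero_of_notMem_tsupport fun h => by simpa using (h3 h).2
    rw [hWac.integral_mul_deriv_eq_deriv_mul
      ((h1.of_le (by simp)).contDiffOn (s := _)).absolutelyContinuousOnInterval, e0, e1]
    simp only [mul_zero, sub_zero, zero_sub, neg_inj]
    refine intervalIntegral.integral_congr_ae ?_
    filter_upwards [hWd] with θ h' hθ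
    rw [h' (uIoc_subset_uIcc hθ)]
  set g : ℝ → ℝ := fun θ => v θ - ext (primitive w) θ with hg
  have hgi : Integrable g angleMeasure :=
    (integrable_L2 v).sub ((memLp_ext _).integrable (by norm_num))
  have hgφ (φ : ℝ → ℝ) (h1 : Continuous φ) (h2 : HasCompactSupport φ) :
      Integrable (fun θ => g θ * φ θ) angleMeasure := by
    obtain ⟨C, hC⟩ := h2.exists_bound_of_continuous h1
    exact hgi.mul_bdd (c := C) h1.aestronglyMeasurable (.of_forall hC)
  have hg0 (φ : ℝ → ℝ) (h1 : ContDiff ℝ ∞ φ) (h2 : HasCompactSupport φ)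
      (h3 : tsupport φ ⊆ Ioo 0 (2 * π)) : ∫ θ in (0)..(2 * π), g θ * deriv φ θ = 0 := by
    have c' := h1.continuous_deriv (by simp)
    have i1 := integrable_L2_mul v c' h2.deriv
    have i2 : Integrable (fun θ => ext (primitive w) θ * deriv φ θ) angleMeasure := by
      obtain ⟨C, hC⟩ := h2.deriv.exists_bound_of_continuous c'
      exact ((memLp_ext _).integrable (by norm_num)).mul_bdd (c := C) c'.aestronglyMeasurable
        (.of_forall hC)
    have e2 : ∫ θ in (0)..(2 * π), ext (primitive w) θ * deriv φ θ
        = ∫ θ in (0)..(2 * π), W θ * deriv φ θ := by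
      refine intervalIntegral.integral_congr fun θ hθ => ?_
      rw [uIcc_of_le two_pi_nonneg] at hθ
      simp only [primitive_apply w hθ, hW]
    simp only [hg, sub_mul]
    rw [intervalIntegral.integral_sub (intervalIntegrable_iff_angle.2 i1)
      (intervalIntegrable_iff_angle.2 i2), h φ h1 h2 h3, e2, parts φ h1 h3, sub_self]
  -- a test function of integral one
  let χb : ContDiffBump (π : ℝ) := ⟨1, 2, one_pos, one_lt_two⟩
  let χ : ℝ → ℝ := χb.normed volume
  have χ1 : ContDiff ℝ ∞ χ := χb.contDiff_normed
  have χ2 : HasCompactSupport χ := χb.hasCompactSupport_normed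
  have χ3 : tsupport χ ⊆ Ioo 0 (2 * π) := by
    rw [χb.tsupport_normed_eq, Real.closedBall_eq_Icc]
    have := pi_gt_three
    exact fun x hx => ⟨by have := hx.1; simp only [χb] at this; linarith,
      by have := hx.2; simp only [χb] at this; linarith⟩
  have tot (φ : ℝ → ℝ) (h3 : tsupport φ ⊆ Ioo 0 (2 * π)) :
      ∫ θ in (0)..(2 * π), φ θ = ∫ θ, φ θ := by
    rw [interval_eq]
    exact setIntegral_eq_integral_of_forall_compl_eq_zero fun x hx =>
      image_eq_zero_of_notMem_tsupport fun hx' => hx (Ioo_subset_Ioc_self (h3 hx'))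
  refine ⟨∫ θ in (0)..(2 * π), g θ * χ θ, ?_⟩
  set c := ∫ θ in (0)..(2 * π), g θ * χ θ with hc
  have main : (fun θ => g θ - c) =ᵐ[angleMeasure] 0 := by
    refine ae_eq_zero_of_test (hgi.sub (integrable_const c)) fun ψ h1 h2 h3 => ?_
    set I := ∫ θ in (0)..(2 * π), ψ θ with hI
    -- `ψ - I χ` has integral zero, so it is the derivative of a test function
    let η : ℝ → ℝ := fun θ => ψ θ - I * χ θ
    have η1 : ContDiff ℝ ∞ η := h1.sub (contDiff_const.mul χ1)
    let φ : ℝ → ℝ := fun θ => ∫ x in (0)..θ, η x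
    have φd (θ : ℝ) : HasDerivAt φ (η θ) θ :=
      intervalIntegral.integral_hasDerivAt_right (η1.continuous.intervalIntegrable _ _)
        η1.continuous.stronglyMeasurable.stronglyMeasurableAtFilter η1.continuous.continuousAt
    have φd' : deriv φ = η := funext fun θ => (φd θ).deriv
    have φ1 : ContDiff ℝ ∞ φ :=
      contDiff_infty_iff_deriv.2 ⟨fun θ => (φd θ).differentiableAt, φd'.symm ▸ η1⟩
    obtain ⟨K, hK, hKsub, hψK, hχK⟩ : ∃ K : Set ℝ, IsCompact K ∧ K ⊆ Ioo 0 (2 * π) ∧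
        tsupport ψ ⊆ K ∧ tsupport χ ⊆ K :=
      ⟨_, h2.isCompact.union χ2.isCompact, union_subset h3 χ3, subset_union_left,
        subset_union_right⟩
    have hKne : K.Nonempty := ⟨π, hχK (by
      rw [χb.tsupport_normed_eq]; exact Metric.mem_closedBall_self χb.rOut_pos.le)⟩
    obtain ⟨a, haK, ha⟩ := hK.exists_isLeast hKne
    obtain ⟨b, hbK, hb⟩ := hK.exists_isGreatest hKne
    have η0 {x : ℝ} (hx : x ∉ K) : η x = 0 := by
      simp [η, image_eq_zero_of_notMem_tsupport (fun h => hx (hψK h)),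
        image_eq_zero_of_notMem_tsupport (fun h => hx (hχK h))]
    have hηtot : ∫ x in (0)..(2 * π), η x = 0 := by
      simp only [η]
      rw [intervalIntegral.integral_sub (h1.continuous.intervalIntegrable _ _)
        (Continuous.intervalIntegrable (u := fun θ => I * χ θ)
          (continuous_const.mul χ1.continuous) _ _),
        intervalIntegral.integral_const_mul, tot χ χ3, χb.integral_normed, mul_one, sub_self]
    have φsupp : Function.support φ ⊆ Icc a b := by
      intro θ hθ
      by_contra hn
      refine hθ ?_
      rcases lt_or_ge θ a with hlt | hge
      · refine (intervalIntegral.integral_congr (g := fun _ => 0) fun x hx => ?_).trans (by simp)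
        refine η0 fun hxK => ?_
        have h0 := hKsub haK
        have := ha hxK
        have : x ≤ max 0 θ := by simpa using hx.2
        rcases max_cases 0 θ with ⟨h5, _⟩ | ⟨h5, _⟩ <;> rw [h5] at this <;> linarith [h0.1]
      · have hgt : b < θ := by
          by_contra h'
          exact hn ⟨hge, not_lt.1 h'⟩
        have hsplit : φ θ = (∫ x in (0)..(2 * π), η x) + ∫ x in (2 * π)..θ, η x :=
          (intervalIntegral.integral_add_adjacent_intervals
            (η1.continuous.intervalIntegrable _ _) (η1.continuous.intervalIntegrable _ _)).symm
        rw [hsplit, hηtot, zero_add]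
        refine (intervalIntegral.integral_congr (g := fun _ => 0) fun x hx => ?_).trans (by simp)
        refine η0 fun hxK => ?_
        have h0 := hKsub hbK
        have := hb hxK
        have : min (2 * π) θ ≤ x := hx.1
        rcases min_cases (2 * π) θ with ⟨h5, _⟩ | ⟨h5, _⟩ <;> rw [h5] at this <;> linarith [h0.2]
    have φsupp' : tsupport φ ⊆ Icc a b := closure_minimal φsupp isClosed_Icc
    have φ2 : HasCompactSupport φ := isCompact_Icc.of_isClosed_subset (isClosed_tsupport φ) φsupp'
    have φ3 : tsupport φ ⊆ Ioo 0 (2 * π) :=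
      φsupp'.trans fun x hx => ⟨(hKsub haK).1.trans_le hx.1, hx.2.trans_lt (hKsub hbK).2⟩
    have h0 := hg0 φ φ1 φ2 φ3
    rw [φd'] at h0
    have e1 : ∫ θ in (0)..(2 * π), g θ * η θ
        = (∫ θ in (0)..(2 * π), g θ * ψ θ) - I * c := by
      rw [hc, ← intervalIntegral.integral_const_mul, ← intervalIntegral.integral_sub
        (intervalIntegrable_iff_angle.2 (hgφ ψ h1.continuous h2))
        (intervalIntegrable_iff_angle.2 ((hgφ χ χ1.continuous χ2).const_mul I))]
      refine intervalIntegral.integral_congr fun θ _ => ?_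
      simp only [η]; ring
    have e2 : ∫ θ in (0)..(2 * π), (g θ - c) * ψ θ
        = (∫ θ in (0)..(2 * π), g θ * ψ θ) - c * I := by
      rw [hI, ← intervalIntegral.integral_const_mul, ← intervalIntegral.integral_sub
        (intervalIntegrable_iff_angle.2 (hgφ ψ h1.continuous h2))
        (Continuous.intervalIntegrable (u := fun θ => c * ψ θ)
          (continuous_const.mul h1.continuous) _ _)]
      refine intervalIntegral.integral_congr fun θ _ => ?_
      ring
    rw [e2, mul_comm c I, ← e1, h0]
  filter_upwards [main] with θ hθ
  have : v θ - ext (primitive w) θ - c = 0 := hθ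
  linarith

/-- The Sobolev embedding of `H` in the continuous functions: as elements of `H` have mean zero,
they are the primitives of their weak derivatives normalised by mean zero. -/
def embed : H →L[ℝ] Alg :=
  (primitive - ((2 * π)⁻¹ • integ.comp primitive).smulRight (1 : Alg)).comp weakDeriv

lemma ext_embed (u : H) : ext (embed u) =ᵐ[angleMeasure] fn u := by
  obtain ⟨c, hc⟩ := exists_eq_primitive_add u.2.1
  have h0 := u.2.2.2.1
  rw [interval_eq, integral_congr_ae hc, integral_add ((memLp_ext _).integrable (by norm_num))
    (integrable_const c), ← interval_eq, ← integ_apply] at h0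
  have h0' : integ (primitive (weakDeriv u)) + 2 * π * c = 0 := by
    simpa [max_eq_left two_pi_nonneg] using h0
  filter_upwards [hc] with θ h
  have e : ext (embed u) θ = ext (primitive (weakDeriv u)) θ
      - (2 * π)⁻¹ * integ (primitive (weakDeriv u)) * 1 := rfl
  rw [e, show fn u θ = _ from h, weakDeriv_apply]
  rw [weakDeriv_apply] at h0'
  have := pi_pos.ne'
  field_simp
  linarith

lemma algToL2_embed (u : H) : algToL2 (embed u) = toL2 u :=
  Lp.ext ((coe_algToL2 _).trans (ext_embed u))

section

/-! ### The integral operator of the kernel -/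

variable (K : Kernel)

lemma Kernel.lipschitz_tilde : ∃ C : ℝ≥0, LipschitzWith C K.tilde := by
  obtain ⟨C, hC⟩ := K.lipschitz
  refine ⟨C, LipschitzWith.of_dist_le_mul fun x y => ?_⟩
  have := hC.dist_le_mul x y
  rwa [Kernel.tilde, Kernel.tilde, dist_sub_right]

/-- The kernel symmetrised under the reflection `s ↦ -s`, as a function of `s`. Integration
against it maps all of `L²` into the functions with the symmetries of `H`. -/
def symKernel (θ : ℝ) : Alg :=
  restr (fun s => (K.tilde (θ - s) + K.tilde (θ + s)) / 2)
    (((K.tilde_continuous.comp (by fun_prop)).add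
      (K.tilde_continuous.comp (by fun_prop))).div_const _)

lemma symKernel_apply (θ : ℝ) (s : Icc (0 : ℝ) (2 * π)) :
    symKernel K θ s = (K.tilde (θ - s) + K.tilde (θ + s)) / 2 := rfl

lemma symKernel_lipschitz : ∃ C : ℝ≥0, LipschitzWith C (symKernel K) := by
  obtain ⟨C, hC⟩ := K.lipschitz_tilde
  refine ⟨C, LipschitzWith.of_dist_le_mul fun x y => ?_⟩
  refine (ContinuousMap.dist_le (by positivity)).2 fun s => ?_
  have h1 := hC.dist_le_mul (x - s) (y - s)
  have h2 := hC.dist_le_mul (x + s) (y + s)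
  rw [dist_sub_right] at h1
  rw [dist_add_right] at h2
  rw [symKernel_apply, symKernel_apply]
  rw [Real.dist_eq] at h1 h2 ⊢
  rw [← sub_div, abs_div, abs_of_pos (by norm_num : (0 : ℝ) < 2), div_le_iff₀ (by norm_num)]
  calc _ = |(K.tilde (x - s) - K.tilde (y - s)) + (K.tilde (x + s) - K.tilde (y + s))| := by ring_nf
    _ ≤ _ := abs_add_le _ _
    _ ≤ _ := by linarith

lemma symKernel_bounded : ∃ B, 0 ≤ B ∧ ∀ θ, ‖symKernel K θ‖ ≤ B := by
  obtain ⟨B, hB⟩ := K.tilde_bounded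
  have hB0 : 0 ≤ B := (norm_nonneg _).trans (hB 0)
  refine ⟨B, hB0, fun θ => (ContinuousMap.norm_le _ hB0).2 fun s => ?_⟩
  rw [symKernel_apply, norm_div, Real.norm_ofNat, div_le_iff₀ (by norm_num)]
  exact (norm_add_le _ _).trans (by linarith [hB (θ - s), hB (θ + s)])

lemma symKernel_periodic (θ : ℝ) : symKernel K (θ + π) = symKernel K θ := by
  ext s
  rw [symKernel_apply, symKernel_apply, show θ + π - s = θ - s + π by ring, K.tilde_periodic,
    show θ + π + s = θ + s + π by ring, K.tilde_periodic]

lemma symKernel_even (θ : ℝ) : symKernel K (2 * π - θ) = symKernel K θ := by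
  ext s
  rw [symKernel_apply, symKernel_apply, show 2 * π - θ - s = -(θ + s) + 2 * π by ring,
    K.tilde_periodic_two_pi, K.tilde_even, show 2 * π - θ + s = -(θ - s) + 2 * π by ring,
    K.tilde_periodic_two_pi, K.tilde_even, add_comm]

/-- The integral of `g` against the symmetrised kernel. -/
def convFun (g : L2) (θ : ℝ) : ℝ := inner ℝ (algToL2 (symKernel K θ)) g

lemma convFun_eq (g : L2) (θ : ℝ) : convFun K g θ =
    ∫ s in (0)..(2 * π), (K.tilde (θ - s) + K.tilde (θ + s)) / 2 * g s := by
  rw [convFun, inner_algToL2]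
  refine intervalIntegral.integral_congr fun s hs => ?_
  rw [uIcc_of_le two_pi_nonneg] at hs
  simp only [ext_of_mem _ hs, symKernel_apply]

lemma convFun_lipschitz_bound : ∃ C : ℝ≥0, ∀ g : L2, LipschitzWith (C * ‖g‖₊) (convFun K g) := by
  obtain ⟨C, hC⟩ := symKernel_lipschitz K
  refine ⟨‖algToL2‖₊ * C, fun g => LipschitzWith.of_dist_le_mul fun x y => ?_⟩
  rw [convFun, convFun, Real.dist_eq, ← inner_sub_left, ← map_sub]
  refine (abs_real_inner_le_norm _ _).trans ?_
  have := hC.dist_le_mul x y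
  rw [dist_eq_norm] at this
  calc _ ≤ ‖algToL2‖ * ‖symKernel K x - symKernel K y‖ * ‖g‖ := by
        gcongr; exact algToL2.le_opNorm _
    _ ≤ ‖algToL2‖ * (C * dist x y) * ‖g‖ := by gcongr
    _ = _ := by push_cast; ring

lemma convFun_bound : ∃ B, 0 ≤ B ∧ ∀ g : L2, ∀ θ, ‖convFun K g θ‖ ≤ B * ‖g‖ := by
  obtain ⟨B, hB0, hB⟩ := symKernel_bounded K
  refine ⟨‖algToL2‖ * B, by positivity, fun g θ => ?_⟩
  refine (norm_inner_le_norm _ _).trans ?_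
  gcongr
  exact (algToL2.le_opNorm _).trans (by gcongr; exact hB θ)

lemma convFun_lipschitz (g : L2) : ∃ C : ℝ≥0, LipschitzWith C (convFun K g) :=
  let ⟨_, hC⟩ := convFun_lipschitz_bound K
  ⟨_, hC g⟩

lemma Kernel.intervalIntegrable_tilde_comp {f : ℝ → ℝ} (hf : Continuous f) (a b : ℝ) :
    IntervalIntegrable (fun θ => K.tilde (f θ)) volume a b :=
  (K.tilde_continuous.comp hf).intervalIntegrable _ _

/-- A weighted integral of `convFun K g` may be computed by integrating the kernel first. -/
lemma integral_mul_convFun (g : L2) {p : ℝ → ℝ} (hp : Continuous p) (a : Alg)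
    (h : ∀ s ∈ Icc 0 (2 * π), ∫ θ in (0)..(2 * π), p θ * ((K.tilde (θ - s) + K.tilde (θ + s)) / 2)
      = ext a s) :
    ∫ θ in (0)..(2 * π), p θ * convFun K g θ = inner ℝ (algToL2 a) g := by
  have hcont : Continuous fun θ => p θ • symKernel K θ :=
    hp.smul (symKernel_lipschitz K).choose_spec.continuous
  let ℓ : Alg →L[ℝ] ℝ := (innerSL ℝ g).comp algToL2
  have hℓ (b : Alg) : ℓ b = inner ℝ (algToL2 b) g := real_inner_comm (algToL2 b) g
  have e (θ : ℝ) : p θ * convFun K g θ = ℓ (p θ • symKernel K θ) := by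
    rw [map_smul, hℓ]; rfl
  simp only [e]
  rw [ℓ.intervalIntegral_comp_comm (hcont.intervalIntegrable _ _), hℓ]
  congr 2
  ext s
  let ev : Alg →L[ℝ] ℝ := ContinuousMap.evalCLM ℝ s
  have e' : (∫ θ in (0)..(2 * π), p θ • symKernel K θ) s
      = ev (∫ θ in (0)..(2 * π), p θ • symKernel K θ) := rfl
  rw [e', ← ev.intervalIntegral_comp_comm (hcont.intervalIntegrable _ _)]
  have := h s s.2
  rw [ext_of_mem _ s.2] at this
  rw [← this]
  rfl

lemma integral_shift_periodic {f : ℝ → ℝ} (hf : Function.Periodic f (2 * π)) (s : ℝ) :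
    ∫ θ in (0)..(2 * π), f (θ + s) = ∫ θ in (0)..(2 * π), f θ := by
  rw [intervalIntegral.integral_comp_add_right, add_comm (2 * π), zero_add]
  have := hf.intervalIntegral_add_eq s 0
  rwa [zero_add] at this

lemma convFun_mean (g : L2) : ∫ θ in (0)..(2 * π), convFun K g θ = 0 := by
  have := integral_mul_convFun K g (continuous_const (y := (1 : ℝ))) 0 fun s _ => by
    have h1 := K.tilde_mean s
    have h2 := K.tilde_mean (-s)
    simp only [sub_neg_eq_add] at h2
    simp only [one_mul]
    rw [intervalIntegral.integral_div, intervalIntegral.integral_add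
      (K.intervalIntegrable_tilde_comp (f := fun θ => θ - s) (by fun_prop) _ _)
      (K.intervalIntegrable_tilde_comp (f := fun θ => θ + s) (by fun_prop) _ _), h1, h2,
      add_zero, zero_div]
    rfl
  simpa using this

/-- The function `convFun K g` as an element of `H`. -/
def convElem (g : L2) : H :=
  ofLipschitz (convFun K g) (convFun_lipschitz K g)
    (fun θ => by rw [convFun, symKernel_periodic, convFun]) (convFun_mean K g)
    (fun θ => by rw [convFun, symKernel_even, convFun])

lemma fn_convElem (g : L2) : fn (convElem K g) =ᵐ[angleMeasure] convFun K g :=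
  ofLipschitz_ae _ _ _ _ _

lemma convElem_bound : ∃ C, ∀ g : L2, ‖convElem K g‖ ≤ C * ‖g‖ := by
  obtain ⟨C, hC⟩ := convFun_lipschitz_bound K
  obtain ⟨B, hB0, hB⟩ := convFun_bound K
  refine ⟨measureUnivNNReal angleMeasure ^ (2 : ENNReal).toReal⁻¹ * B
    + measureUnivNNReal angleMeasure ^ (2 : ENNReal).toReal⁻¹ * C, fun g => ?_⟩
  have h1 : ‖toL2 (convElem K g)‖ ≤
      measureUnivNNReal angleMeasure ^ (2 : ENNReal).toReal⁻¹ * (B * ‖g‖) := by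
    refine Lp.norm_le_of_ae_bound (by positivity) ?_
    filter_upwards [fn_convElem K g] with θ h
    rw [coe_toL2, h]
    exact hB g θ
  have h2 : ‖weakDeriv (convElem K g)‖ ≤
      measureUnivNNReal angleMeasure ^ (2 : ENNReal).toReal⁻¹ * (C * ‖g‖) := by
    refine Lp.norm_le_of_ae_bound (by positivity) ?_
    filter_upwards [(memLp_deriv_lipschitz (convFun_lipschitz K g).choose_spec).coeFn_toLp]
      with θ h
    rw [show (weakDeriv (convElem K g) : ℝ → ℝ) θ = deriv (convFun K g) θ from h]
    exact norm_deriv_le_of_lipschitz (hC g)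
  have h3 : ‖convElem K g‖ ≤ ‖toL2 (convElem K g)‖ + ‖weakDeriv (convElem K g)‖ := by
    refine abs_le_of_sq_le_sq' ?_ (by positivity) |>.2
    rw [norm_sq_H]
    nlinarith [norm_nonneg (toL2 (convElem K g)), norm_nonneg (weakDeriv (convElem K g))]
  refine h3.trans ((add_le_add h1 h2).trans_eq ?_)
  ring

/-- Convolution with `K̃`, preceded by symmetrisation, as an operator from `L²` to `H`. -/
def conv : L2 →L[ℝ] H :=
  LinearMap.mkContinuousOfExistsBound
    { toFun := convElem K
      map_add' := fun f g => by
        refine toL2_injective ?_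
        rw [map_add]
        refine Lp.ext ((fn_convElem K _).trans ?_)
        filter_upwards [fn_convElem K f, fn_convElem K g,
          Lp.coeFn_add (toL2 (convElem K f)) (toL2 (convElem K g))] with θ h1 h2 h3
        rw [h3, Pi.add_apply, coe_toL2, coe_toL2, h1, h2]
        exact inner_add_right _ _ _
      map_smul' := fun c g => by
        refine toL2_injective ?_
        rw [map_smul, RingHom.id_apply]
        refine Lp.ext ((fn_convElem K _).trans ?_)
        filter_upwards [fn_convElem K g, Lp.coeFn_smul c (toL2 (convElem K g))] with θ h1 h3
        rw [h3, Pi.smul_apply, coe_toL2, h1]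
        exact inner_smul_right _ _ _ } (convElem_bound K)

lemma fn_conv (g : L2) : fn (conv K g) =ᵐ[angleMeasure] convFun K g := fn_convElem K g

lemma ext_exp (a : Alg) (θ : ℝ) : ext (NormedSpace.exp a) θ = exp (ext a θ) := by
  let ev : Alg →+* ℝ := (Pi.evalRingHom _ (projIcc 0 (2 * π) two_pi_nonneg θ)).comp
    (ContinuousMap.coeFnRingHom)
  have hev : Continuous ev := continuous_eval_const (projIcc 0 (2 * π) two_pi_nonneg θ)
  rw [Real.exp_eq_exp_ℝ]
  exact NormedSpace.map_exp ev hev a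

lemma integral_reflect_even {f : ℝ → ℝ} {V : H} (p : ℝ → ℝ) :
    ∫ s in (0)..(2 * π), p (2 * π - s) * f (fn V s) = ∫ s in (0)..(2 * π), p s * f (fn V s) := by
  have h := intervalIntegral.integral_comp_sub_left (a := 0) (b := 2 * π)
    (fun s => p s * f (fn V s)) (2 * π)
  rw [sub_self, sub_zero] at h
  rw [← h, intervalIntegral.integral_of_le two_pi_nonneg,
    intervalIntegral.integral_of_le two_pi_nonneg, integral_Ioc_eq_integral_Ioo,
    integral_Ioc_eq_integral_Ioo]
  refine setIntegral_congr_ae measurableSet_Ioo ?_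
  filter_upwards [V.2.2.2.2] with s hs hs'
  have e : fn V (2 * π - s) = fn V s := hs hs'
  rw [e]

/-- `Γ` as a composition of bounded linear maps with the exponential of the algebra of continuous
functions. -/
lemma Gamma_eq (V : H) : Gamma K V =
    (integ (NormedSpace.exp (-embed V)))⁻¹ • conv K (algToL2 (NormedSpace.exp (-embed V))) := by
  set e := NormedSpace.exp (-embed V) with he
  have hE : ext e =ᵐ[angleMeasure] fun s => exp (-fn V s) := by
    filter_upwards [ext_embed V] with s h
    rw [he, ext_exp, ← h]; rfl
  have hE2 : (algToL2 e : ℝ → ℝ) =ᵐ[angleMeasure] fun s => exp (-fn V s) := (coe_algToL2 e).trans hE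
  have hi : Integrable (fun s => exp (-fn V s)) angleMeasure := (integrable_L2 _).congr hE2
  obtain ⟨B, hB⟩ := K.tilde_bounded
  have hint (f : ℝ → ℝ) (hf : Continuous f) :
      IntervalIntegrable (fun s => K.tilde (f s) * exp (-fn V s)) volume 0 (2 * π) :=
    intervalIntegrable_iff_angle.2 <| hi.bdd_mul (c := B)
      (K.tilde_continuous.comp hf).aestronglyMeasurable (.of_forall fun _ => hB _)
  have hconv (θ : ℝ) : convFun K (algToL2 e) θ
      = ∫ s in (0)..(2 * π), K.tilde (θ - s) * exp (-fn V s) := by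
    have hr := integral_reflect_even (f := fun x => exp (-x)) (V := V) (fun s => K.tilde (θ - s))
    have hr' : ∫ s in (0)..(2 * π), K.tilde (θ + s) * exp (-fn V s)
        = ∫ s in (0)..(2 * π), K.tilde (θ - s) * exp (-fn V s) := by
      rw [← hr]
      refine intervalIntegral.integral_congr fun s _ => ?_
      rw [show θ - (2 * π - s) = θ + s - 2 * π by ring, K.tilde_periodic_two_pi.sub_eq]
    rw [convFun_eq]
    calc _ = ∫ s in (0)..(2 * π), (K.tilde (θ - s) * exp (-fn V s)
            + K.tilde (θ + s) * exp (-fn V s)) / 2 := by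
          rw [interval_eq, interval_eq]
          refine integral_congr_ae ?_
          filter_upwards [hE2] with s h
          rw [h]; ring
      _ = _ := by
          rw [intervalIntegral.integral_div, intervalIntegral.integral_add
            (hint _ (by fun_prop)) (hint _ (by fun_prop)), hr']
          ring
  have hZ : integ e = ∫ s in (0)..(2 * π), exp (-fn V s) := by
    rw [integ_apply, interval_eq, interval_eq]
    exact integral_congr_ae hE
  refine toL2_injective ?_
  rw [map_smul]
  refine Lp.ext ((ofLipschitz_ae (gammaFun K V) (gammaFun_lipschitz K V) (gammaFun_periodic K V)
    (gammaFun_mean K V) (gammaFun_even K V)).trans ?_)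
  filter_upwards [fn_conv K (algToL2 e), Lp.coeFn_smul (integ e)⁻¹ (toL2 (conv K (algToL2 e)))]
    with θ h1 h2
  rw [h2, Pi.smul_apply, coe_toL2, h1, hconv, hZ, gammaFun, smul_eq_mul]
  exact div_eq_inv_mul _ _

end

section

/-! ### Fourier expansion in `H` -/

/-- The function `cos (2nθ)` as a continuous function on `[0, 2π]`. -/
def cosA (n : ℕ) : Alg := restr (fun θ => cos (2 * n * θ)) (by fun_prop)

lemma ext_cosA (n : ℕ) {θ : ℝ} (h : θ ∈ Icc 0 (2 * π)) : ext (cosA n) θ = cos (2 * n * θ) :=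
  ext_restr (f := fun θ => cos (2 * n * θ)) _ h

lemma cosA_apply (n : ℕ) (θ : Icc (0 : ℝ) (2 * π)) : cosA n θ = cos (2 * n * θ) := rfl

lemma cosA_zero : cosA 0 = 1 := by ext θ; simp [cosA_apply]

lemma cosA_mul (n k : ℕ) :
    cosA (n + k) * cosA n = (2⁻¹ : ℝ) • cosA (2 * n + k) + (2⁻¹ : ℝ) • cosA k := by
  ext θ
  simp only [ContinuousMap.mul_apply, ContinuousMap.add_apply, ContinuousMap.smul_apply, cosA_apply,
    smul_eq_mul]
  have h1 : 2 * ((2 * n + k : ℕ) : ℝ) * θ = 2 * (n + k : ℕ) * θ + 2 * n * θ := by push_cast; ring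
  have h2 : 2 * (k : ℝ) * θ = 2 * (n + k : ℕ) * θ - 2 * n * θ := by push_cast; ring
  rw [h1, h2, cos_add, cos_sub]
  ring

lemma integ_cosA {n : ℕ} (hn : 1 ≤ n) : integ (cosA n) = 0 := by
  rw [cosA, integ_restr]
  exact cosMode_mean n hn

lemma integ_cosA_mul_self {n : ℕ} (hn : 1 ≤ n) : integ (cosA n * cosA n) = π := by
  have := cosA_mul n 0
  rw [add_zero] at this
  rw [this, map_add, map_smul, map_smul, integ_cosA (by lia), cosA_zero, integ_one]
  simp

lemma integ_cosA_mul {n m : ℕ} (h : n ≠ m) : integ (cosA n * cosA m) = 0 := by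
  wlog hlt : m < n generalizing n m
  · rw [mul_comm (cosA n)]
    exact this h.symm (by lia)
  obtain ⟨k, rfl⟩ := Nat.exists_eq_add_of_lt hlt
  rw [show m + k + 1 = m + (k + 1) by ring, cosA_mul, map_add, map_smul, map_smul,
    integ_cosA (by lia), integ_cosA (by lia)]
  simp

lemma Alg_ext {a b : Alg} (h : ext a =ᵐ[angleMeasure] ext b) : a = b := by
  have := Measure.eqOn_Icc_of_ae_eq volume two_pi_pos.ne
    (by rwa [Measure.restrict_congr_set Ioc_ae_eq_Icc.symm])
    (continuous_ext a).continuousOn (continuous_ext b).continuousOn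
  ext θ
  have e := this θ.2
  rwa [ext_of_mem _ θ.2, ext_of_mem _ θ.2] at e

/-- The mode `cos (2nθ)` as an element of `H`. -/
def mode (n : ℕ+) : H := cosMode n n.pos

lemma fn_mode (n : ℕ+) : fn (mode n) =ᵐ[angleMeasure] fun θ => cos (2 * n * θ) :=
  (memLp_lipschitz (cosMode_lipschitz n).choose_spec).coeFn_toLp

lemma embed_mode (n : ℕ+) : embed (mode n) = cosA n := by
  refine Alg_ext ((ext_embed _).trans ((fn_mode n).trans ?_))
  rw [Filter.EventuallyEq, ae_angle_iff]
  exact .of_forall fun θ hθ => (ext_cosA n ⟨hθ.1.le, hθ.2⟩).symm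

lemma toL2_mode (n : ℕ+) : toL2 (mode n) = algToL2 (cosA n) := by
  rw [← algToL2_embed, embed_mode]

/-- The (unnormalised) cosine coefficient `∫ cos (2nθ) g(θ) dθ`. -/
def cosCoeff (n : ℕ) : L2 →L[ℝ] ℝ := innerSL ℝ (algToL2 (cosA n))

lemma cosCoeff_apply (n : ℕ) (g : L2) : cosCoeff n g = inner ℝ (algToL2 (cosA n)) g := rfl

lemma cosCoeff_algToL2 (n : ℕ) (a : Alg) : cosCoeff n (algToL2 a) = integ (cosA n * a) :=
  inner_algToL2_algToL2 _ _

lemma cosCoeff_eq (n : ℕ) (g : L2) : cosCoeff n g = ∫ θ in (0)..(2 * π), cos (2 * n * θ) * g θ := by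
  rw [cosCoeff_apply, inner_algToL2]
  refine intervalIntegral.integral_congr fun θ hθ => ?_
  rw [uIcc_of_le two_pi_nonneg] at hθ
  simp only [ext_cosA n hθ]

lemma cosCoeff_mode (n : ℕ+) : cosCoeff n (toL2 (mode n)) = π := by
  rw [toL2_mode, cosCoeff_algToL2, integ_cosA_mul_self n.pos]

lemma cosCoeff_mode_ne {n : ℕ} {m : ℕ+} (h : n ≠ m) : cosCoeff n (toL2 (mode m)) = 0 := by
  rw [toL2_mode, cosCoeff_algToL2, integ_cosA_mul h]

variable (K : Kernel)

lemma integral_kernel_cos (n : ℕ+) (s : ℝ) :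
    ∫ θ in (0)..(2 * π), cos (2 * n * θ) * ((K.tilde (θ - s) + K.tilde (θ + s)) / 2)
      = π * K.coeff n * cos (2 * n * s) := by
  have hper (s : ℝ) : Function.Periodic (fun θ => cos (2 * n * (θ - s)) * K.tilde θ) (2 * π) := by
    intro θ
    simp only
    rw [K.tilde_periodic_two_pi, show 2 * (n : ℝ) * (θ + 2 * π - s)
      = 2 * n * (θ - s) + (2 * n : ℕ) * (2 * π) by push_cast; ring, cos_add_nat_mul_two_pi]
  have hint (a s : ℝ) : IntervalIntegrable (fun θ => cos (2 * n * (θ + a)) * K.tilde (θ + s))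
      volume 0 (2 * π) :=
    Continuous.intervalIntegrable (Continuous.mul (by fun_prop)
      (K.tilde_continuous.comp (by fun_prop))) _ _
  have h1 (s : ℝ) : ∫ θ in (0)..(2 * π), cos (2 * n * θ) * K.tilde (θ + s)
      = ∫ θ in (0)..(2 * π), cos (2 * n * (θ - s)) * K.tilde θ := by
    rw [← integral_shift_periodic (hper s) s]
    simp only [add_sub_cancel_right]
  have h2 : ∫ θ in (0)..(2 * π), cos (2 * n * θ) * K.tilde θ = π * K.coeff n := by
    simp only [Kernel.tilde, mul_sub]
    rw [intervalIntegral.integral_sub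
      (Continuous.intervalIntegrable (u := fun θ => cos (2 * n * θ) * K.toFun θ)
        (Continuous.mul (by fun_prop) K.lipschitz.choose_spec.continuous) _ _)
      (Continuous.intervalIntegrable (u := fun θ => cos (2 * n * θ) * _) (by fun_prop) _ _),
      intervalIntegral.integral_mul_const, cosMode_mean n n.pos, zero_mul, sub_zero, Kernel.coeff]
    have := pi_pos.ne'
    field_simp
    simp only [mul_comm]
  calc _ = ((∫ θ in (0)..(2 * π), cos (2 * n * θ) * K.tilde (θ + -s))
        + ∫ θ in (0)..(2 * π), cos (2 * n * θ) * K.tilde (θ + s)) / 2 := by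
        have i1 := hint 0 (-s)
        have i2 := hint 0 s
        simp only [add_zero] at i1 i2
        rw [← intervalIntegral.integral_add i1 i2, ← intervalIntegral.integral_div]
        refine intervalIntegral.integral_congr fun θ _ => ?_
        simp only [sub_eq_add_neg]
        ring
    _ = ((∫ θ in (0)..(2 * π), cos (2 * n * (θ - -s)) * K.tilde θ)
        + ∫ θ in (0)..(2 * π), cos (2 * n * (θ - s)) * K.tilde θ) / 2 := by rw [h1, h1]
    _ = (∫ θ in (0)..(2 * π), cos (2 * n * θ) * K.tilde θ) * cos (2 * n * s) := by
        have i1 := hint s 0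
        have i2 := hint (-s) 0
        simp only [add_zero, ← sub_eq_add_neg] at i1 i2
        simp only [sub_neg_eq_add]
        rw [← intervalIntegral.integral_add i1 i2, ← intervalIntegral.integral_div,
          ← intervalIntegral.integral_mul_const]
        refine intervalIntegral.integral_congr fun θ _ => ?_
        simp only [mul_add, mul_sub, cos_add, cos_sub]
        ring
    _ = _ := by rw [h2]

/-- The modes diagonalise the convolution: the coefficients are multiplied by `π k_n`. -/
lemma cosCoeff_conv (n : ℕ+) (g : L2) :
    cosCoeff n (toL2 (conv K g)) = π * K.coeff n * cosCoeff n g := by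
  have := integral_mul_convFun K g (p := fun θ => cos (2 * n * θ)) (by fun_prop)
    ((π * K.coeff n) • cosA n) fun s hs => by
      rw [integral_kernel_cos, ext_smul, ext_cosA _ hs]
  rw [map_smul, real_inner_smul_left] at this
  rw [cosCoeff_apply n g, ← this, cosCoeff_eq, interval_eq, interval_eq]
  refine integral_congr_ae ?_
  filter_upwards [fn_conv K g] with θ h
  rw [coe_toL2, h]

lemma conv_cosA (n : ℕ+) : conv K (algToL2 (cosA n)) = (π * K.coeff n) • mode n := by
  refine toL2_injective (Lp.ext ?_)
  rw [map_smul]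
  filter_upwards [fn_conv K (algToL2 (cosA n)), fn_mode n,
    Lp.coeFn_smul (π * K.coeff n) (toL2 (mode n))] with θ h1 h2 h3
  rw [h3, Pi.smul_apply, coe_toL2, coe_toL2, h1, h2, convFun_eq, smul_eq_mul,
    ← integral_kernel_cos, interval_eq, interval_eq]
  refine integral_congr_ae ?_
  have hcos : ∀ᵐ s ∂angleMeasure, ext (cosA n) s = cos (2 * n * s) :=
    ae_angle_iff.2 (.of_forall fun s hs => ext_cosA n ⟨hs.1.le, hs.2⟩)
  filter_upwards [coe_algToL2 (cosA n), hcos] with s h h'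
  rw [h, h', ← K.tilde_even (θ - s), neg_sub, add_comm θ s, mul_comm]

lemma conv_algToL2_one : conv K (algToL2 1) = 0 := by
  refine toL2_injective (Lp.ext ?_)
  rw [map_zero]
  filter_upwards [fn_conv K (algToL2 1), Lp.coeFn_zero (E := ℝ) (p := 2) (μ := angleMeasure)]
    with θ h1 h2
  rw [h2, coe_toL2, h1, convFun, inner_algToL2_algToL2, mul_one, symKernel, integ_restr]
  have e1 := K.tilde_mean (-θ)
  have e2 : ∫ s in (0)..(2 * π), K.tilde (θ - s) = 0 := by
    refine Eq.trans (intervalIntegral.integral_congr fun s _ => ?_) (K.tilde_mean θ)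
    rw [← K.tilde_even, neg_sub]
  simp only [sub_neg_eq_add, add_comm _ θ] at e1
  rw [intervalIntegral.integral_div, intervalIntegral.integral_add
    (K.intervalIntegrable_tilde_comp (f := fun s => θ - s) (by fun_prop) _ _)
    (K.intervalIntegrable_tilde_comp (f := fun s => θ + s) (by fun_prop) _ _), e1, e2]
  simp

/-- In `H`, pairing with a mode is a multiple of the cosine coefficient. -/
lemma inner_mode (n : ℕ+) (u : H) :
    inner ℝ (mode n) u = (1 + 4 * (n : ℝ) ^ 2) * cosCoeff n (toL2 u) := by
  rw [inner_H, toL2_mode, ← cosCoeff_apply]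
  suffices h : inner ℝ (weakDeriv (mode n)) (weakDeriv u) = 4 * (n : ℝ) ^ 2 * cosCoeff n (toL2 u) by
    rw [h]; ring
  set w := weakDeriv u with hw_def
  set W : ℝ → ℝ := fun θ => ∫ x in (0)..θ, w x with hW
  have hw : IntervalIntegrable w volume 0 (2 * π) :=
    intervalIntegrable_iff_angle.2 (integrable_L2 w)
  have hWac : AbsolutelyContinuousOnInterval W 0 (2 * π) :=
    hw.absolutelyContinuousOnInterval_intervalIntegral left_mem_uIcc
  have hWd : ∀ᵐ θ, θ ∈ uIcc 0 (2 * π) → deriv W θ = w θ := by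
    filter_upwards [hw.ae_hasDerivAt_integral] with θ h' hθ
    exact (h' hθ 0 left_mem_uIcc).deriv
  let p : ℝ → ℝ := fun θ => -(2 * (n : ℝ)) * sin (2 * (n : ℝ) * θ)
  have hp : ContDiff ℝ 1 p := by
    unfold p
    exact contDiff_const.mul (Real.contDiff_sin.comp (contDiff_const.mul (contDiff_id (E := ℝ))))
  have hp' (θ : ℝ) : HasDerivAt p (-(4 * (n : ℝ) ^ 2) * cos (2 * n * θ)) θ := by
    have := (((hasDerivAt_id θ).const_mul (2 * (n : ℝ))).sin).const_mul (-(2 * (n : ℝ)))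
    refine this.congr_deriv ?_
    simp only [id]; ring
  have hmode : (weakDeriv (mode n) : ℝ → ℝ) =ᵐ[angleMeasure] p := by
    filter_upwards [(memLp_deriv_lipschitz (cosMode_lipschitz n).choose_spec).coeFn_toLp] with θ h
    refine Eq.trans h ?_
    have := (((hasDerivAt_id θ).const_mul (2 * (n : ℝ))).cos).deriv
    refine this.trans ?_
    simp only [p, id]; ring
  have hends : p 0 = 0 ∧ p (2 * π) = 0 := by
    refine ⟨by simp [p], ?_⟩
    have : sin (2 * n * (2 * π)) = 0 := by
      rw [show 2 * (n : ℝ) * (2 * π) = ((4 * n : ℕ) : ℝ) * π by push_cast; ring, sin_nat_mul_pi]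
    simp [p, this]
  have hparts := hWac.integral_mul_deriv_eq_deriv_mul
    (hp.contDiffOn (s := uIcc 0 (2 * π))).absolutelyContinuousOnInterval
  rw [hends.1, hends.2, mul_zero, mul_zero, sub_self, zero_sub] at hparts
  have e1 : inner ℝ (weakDeriv (mode n)) w = ∫ θ in (0)..(2 * π), deriv W θ * p θ := by
    rw [inner_L2]
    refine intervalIntegral.integral_congr_ae ?_
    filter_upwards [hWd, ae_angle_iff.1 hmode] with θ h1 h2 hθ
    rw [h1 (uIoc_subset_uIcc hθ), h2 (by rwa [uIoc_of_le two_pi_nonneg] at hθ), mul_comm]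
  obtain ⟨c, hc⟩ := exists_eq_primitive_add u.2.1
  have e2 : ∫ θ in (0)..(2 * π), W θ * deriv p θ
      = -(4 * (n : ℝ) ^ 2) * ∫ θ in (0)..(2 * π), cos (2 * n * θ) * W θ := by
    rw [← intervalIntegral.integral_const_mul]
    refine intervalIntegral.integral_congr fun θ _ => ?_
    simp only [(hp' θ).deriv]; ring
  have hWi : IntervalIntegrable (fun θ => cos (2 * n * θ) * W θ) volume 0 (2 * π) :=
    ContinuousOn.intervalIntegrable (ContinuousOn.mul (by fun_prop) hWac.continuousOn)
  have e3 : cosCoeff n (toL2 u) = ∫ θ in (0)..(2 * π), cos (2 * n * θ) * W θ := by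
    have : cosCoeff n (toL2 u) = ∫ θ in (0)..(2 * π), (cos (2 * n * θ) * W θ
        + cos (2 * n * θ) * c) := by
      rw [cosCoeff_eq]
      refine intervalIntegral.integral_congr_ae ?_
      filter_upwards [ae_angle_iff.1 hc] with θ h hθ
      rw [uIoc_of_le two_pi_nonneg] at hθ
      rw [toL2_apply, h hθ, primitive_apply _ ⟨hθ.1.le, hθ.2⟩]
      simp only [hW, hw_def, weakDeriv_apply]; ring
    rw [this, intervalIntegral.integral_add hWi
      (Continuous.intervalIntegrable (by fun_prop) _ _), intervalIntegral.integral_mul_const,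
      cosMode_mean n n.pos]
    simp
  rw [e1, e3]
  linarith

/-- The cosine coefficients determine an element of `H`: the symmetries make all other Fourier
coefficients vanish. -/
lemma eq_zero_of_cosCoeff {u : H} (h : ∀ n : ℕ+, cosCoeff n (toL2 u) = 0) : u = 0 := by
  have hui : IntervalIntegrable (fn u) volume 0 (2 * π) :=
    intervalIntegrable_iff_angle.2 (integrable_L2 _)
  have hint (p : ℝ → ℝ) (hp : Continuous p) (a b : ℝ) (ha : a ∈ Icc 0 (2 * π))
      (hb : b ∈ Icc 0 (2 * π)) : IntervalIntegrable (fun θ => p θ * fn u θ) volume a b :=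
    (hui.mono_set (by
      rw [uIcc_of_le two_pi_nonneg]; exact uIcc_subset_Icc ha hb)).continuousOn_mul hp.continuousOn
  have h0 : (0 : ℝ) ∈ Icc 0 (2 * π) := ⟨le_rfl, two_pi_nonneg⟩
  have h2 : 2 * π ∈ Icc 0 (2 * π) := ⟨two_pi_nonneg, le_rfl⟩
  have h1 : π ∈ Icc 0 (2 * π) := ⟨pi_pos.le, by linarith [pi_pos]⟩
  have hsin (i : ℤ) : ∫ θ in (0)..(2 * π), sin (i * θ) * fn u θ = 0 := by
    have := integral_reflect_even (f := id) (V := u) (fun θ => sin (i * θ))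
    have e (θ : ℝ) : sin (i * (2 * π - θ)) = -sin (i * θ) := by
      rw [show (i : ℝ) * (2 * π - θ) = -(i * θ) + i * (2 * π) by ring, sin_add_int_mul_two_pi,
        sin_neg]
    simp only [e, id, neg_mul, intervalIntegral.integral_neg] at this
    linarith
  have hcos_even (n : ℕ) : ∫ θ in (0)..(2 * π), cos (2 * n * θ) * fn u θ = 0 := by
    rcases Nat.eq_zero_or_pos n with rfl | hn
    · simpa using! u.2.2.2.1
    · have := h ⟨n, hn⟩
      rwa [cosCoeff_eq] at this
  have hcos (i : ℤ) : ∫ θ in (0)..(2 * π), cos (i * θ) * fn u θ = 0 := by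
    rcases Int.even_or_odd' i with ⟨k, rfl | rfl⟩
    · refine Eq.trans (intervalIntegral.integral_congr fun θ _ => ?_) (hcos_even k.natAbs)
      congr 1
      rcases Int.natAbs_eq k with hk | hk
      · rw [hk]; simp
      · rw [hk, ← cos_neg]; push_cast; simp
    · have hcont : Continuous fun θ : ℝ => cos ((2 * k + 1 : ℤ) * θ) := by fun_prop
      rw [← intervalIntegral.integral_add_adjacent_intervals (hint _ hcont 0 π h0 h1)
        (hint _ hcont π (2 * π) h1 h2)]
      have := intervalIntegral.integral_comp_add_right (a := 0) (b := π)
        (fun θ => cos ((2 * k + 1 : ℤ) * θ) * fn u θ) π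
      rw [zero_add, ← two_mul] at this
      rw [← this, intervalIntegral.integral_of_le pi_pos.le,
        intervalIntegral.integral_of_le pi_pos.le, integral_Ioc_eq_integral_Ioo,
        integral_Ioc_eq_integral_Ioo, add_eq_zero_iff_eq_neg, ← integral_neg]
      refine setIntegral_congr_ae measurableSet_Ioo ?_
      filter_upwards [u.2.2.1] with θ hθ hθ'
      have e : fn u (θ + π) = fn u θ := hθ hθ'
      rw [e, show ((2 * k + 1 : ℤ) : ℝ) * (θ + π) = (2 * k + 1 : ℤ) * θ + π + k * (2 * π) by
        push_cast; ring, cos_add_int_mul_two_pi, cos_add_pi]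
      ring
  have hm : MemLp (fun θ => (fn u θ : ℂ)) 2 (volume.restrict (Ioc 0 (2 * π))) :=
    (Lp.memLp u.1.fst).ofReal
  have hintC (p : ℝ → ℝ) (hp : Continuous p) :
      IntervalIntegrable (fun θ => ((p θ * fn u θ : ℝ) : ℂ)) volume 0 (2 * π) :=
    ⟨(hint p hp _ _ h0 h2).1.ofReal, (hint p hp _ _ h0 h2).2.ofReal⟩
  have hcoef (i : ℤ) : fourierCoeffOn two_pi_pos (fun θ => (fn u θ : ℂ)) i = 0 := by
    rw [fourierCoeffOn_eq_integral]
    have e (θ : ℝ) : fourier (-i) (θ : AddCircle (2 * π - 0)) • (fn u θ : ℂ)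
        = ((cos (i * θ) * fn u θ : ℝ) : ℂ) - ((sin (i * θ) * fn u θ : ℝ) : ℂ) * Complex.I := by
      have : fourier (-i) (θ : AddCircle (2 * π - 0))
          = (cos (i * θ) : ℂ) - (sin (i * θ) : ℂ) * Complex.I := by
        rw [fourier_coe_apply]
        have hπ : (π : ℂ) ≠ 0 := by exact_mod_cast pi_pos.ne'
        rw [show 2 * (π : ℂ) * Complex.I * ((-i : ℤ) : ℂ) * (θ : ℂ) / ((2 * π - 0 : ℝ) : ℂ)
          = ((-(i * θ) : ℝ) : ℂ) * Complex.I by push_cast; field_simp; ring, Complex.exp_mul_I]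
        push_cast
        simp [sub_eq_add_neg]
      rw [this, smul_eq_mul]
      push_cast
      ring
    simp only [e]
    rw [intervalIntegral.integral_sub (hintC _ (by fun_prop))
      ((hintC _ (by fun_prop)).mul_const _),
      intervalIntegral.integral_mul_const, intervalIntegral.integral_ofReal,
      intervalIntegral.integral_ofReal, hcos, hsin]
    simp
  have hsum := tsum_sq_fourierCoeffOn two_pi_pos hm
  simp only [hcoef, norm_zero] at hsum
  have hzero : ∫ θ in (0)..(2 * π), fn u θ * fn u θ = 0 := by
    have : (2 * π - 0)⁻¹ * ∫ θ in (0)..(2 * π), ‖(fn u θ : ℂ)‖ ^ 2 = 0 := by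
      rw [← smul_eq_mul, ← hsum]; simp
    rcases mul_eq_zero.1 this with h' | h'
    · exact absurd h' (by simp [pi_pos.ne'])
    · refine Eq.trans (intervalIntegral.integral_congr fun θ _ => ?_) h'
      simp [sq]
  refine toL2_injective ?_
  rw [map_zero, ← inner_self_eq_zero (𝕜 := ℝ), inner_L2]
  exact hzero

end

section

/-! ### Two facts about operators on Hilbert spaces -/

section Abstract

variable {E L : Type*} [NormedAddCommGroup E] [NormedSpace ℝ E] [CompleteSpace E]
  [NormedAddCommGroup L] [InnerProductSpace ℝ L]

lemma le_norm_diagonal {ι : Type*} (b : HilbertBasis ι ℝ L) (D : L →L[ℝ] L) (d : ι → ℝ) {c : ℝ}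
    (hD : ∀ i, D (b i) = d i • b i) (hc0 : 0 ≤ c) (hc : ∀ i, c ≤ |d i|) (u : L) :
    c * ‖u‖ ≤ ‖D u‖ := by
  have hco (i : ι) : inner ℝ (b i) (D u) = d i * inner ℝ (b i) u := by
    have h := (b.hasSum_repr u).mapL ((innerSL ℝ (b i)).comp D)
    refine (h.unique ?_)
    have e (j : ι) : ((innerSL ℝ (b i)).comp D) (b.repr u j • b j)
        = b.repr u j * (d j * inner ℝ (b i) (b j)) := by
      simp [hD]
    simp only [e]
    convert hasSum_single i fun j hj => ?_ using 1
    · rw [b.repr_apply_apply, real_inner_self_eq_norm_sq, b.orthonormal.1]; ring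
    · rw [b.orthonormal.2 (Ne.symm hj)]; simp
  refine abs_le_of_sq_le_sq' ?_ (norm_nonneg _) |>.2
  rw [mul_pow, ← real_inner_self_eq_norm_sq, ← real_inner_self_eq_norm_sq]
  refine hasSum_le (fun i => ?_) ((b.hasSum_inner_mul_inner u u).mul_left (c ^ 2))
    (b.hasSum_inner_mul_inner (D u) (D u))
  rw [real_inner_comm, real_inner_comm (b i) (D u), hco]
  have := sq_le_sq' (by linarith [hc i, abs_nonneg (d i)]) (hc i)
  rw [sq_abs] at this
  nlinarith [sq_nonneg (inner ℝ (b i) u)]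

/-- An operator that is diagonal in a Hilbert basis, with diagonal bounded away from zero, is
invertible: its range is closed and contains the basis. -/
lemma exists_equiv_of_diagonal [CompleteSpace L] {ι : Type*} (b : HilbertBasis ι ℝ L)
    (D : L →L[ℝ] L) (d : ι → ℝ) {c : ℝ} (hD : ∀ i, D (b i) = d i • b i) (hc0 : 0 < c) (hc : ∀ i, c ≤ |d i|) :
    ∃ e : L ≃L[ℝ] L, (e : L →L[ℝ] L) = D := by
  have hbound := le_norm_diagonal b D d hD hc0.le hc
  have hanti : AntilipschitzWith ⟨c⁻¹, by positivity⟩ D :=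
    D.antilipschitz_of_bound fun u => by
      change ‖u‖ ≤ c⁻¹ * ‖D u‖
      rw [inv_mul_eq_div, le_div_iff₀ hc0, mul_comm]
      exact hbound u
  have hclosed : IsClosed (D.range : Set L) := by
    simpa using! hanti.isClosed_range D.uniformContinuous
  have hrange : D.range = ⊤ := by
    rw [eq_top_iff, ← b.dense_span]
    refine Submodule.topologicalClosure_minimal _ (Submodule.span_le.2 ?_) hclosed
    rintro _ ⟨i, rfl⟩
    have hdi : d i ≠ 0 := fun h => by have := hc i; rw [h, abs_zero] at this; linarith
    exact ⟨(d i)⁻¹ • b i, by simp [hD, smul_smul, hdi]⟩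
  exact ⟨ContinuousLinearEquiv.ofBijective D (LinearMap.ker_eq_bot.2 hanti.injective) hrange,
    by ext; simp⟩

/-- If `N P` is symmetric on a Hilbert space and `1 - N P` is coercive, then the complex spectrum
of `P N - 1` lies in the open left half-plane. -/
lemma isUnit_of_coercive [CompleteSpace L] (P : L →L[ℝ] E) (N : E →L[ℝ] L)
    (hsymm : ∀ f g, inner ℝ (N (P f)) g = inner ℝ f (N (P g))) {ε : ℝ} (hε : 0 < ε)
    (hco : ∀ g, ε * ‖g‖ ^ 2 ≤ ‖g‖ ^ 2 - inner ℝ (N (P g)) g) {x y : ℝ} (hx : 0 ≤ x) :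
    IsUnit ((P.comp N - 1 - x • (1 : E →L[ℝ] E)) ^ 2 + y ^ 2 • (1 : E →L[ℝ] E)) := by
  set c := 1 + x with hc
  set Q := N.comp P with hQ
  set A := Q - c • (1 : L →L[ℝ] L) with hA
  set p := A ^ 2 + y ^ 2 • (1 : L →L[ℝ] L) with hp
  have hAs (f g : L) : inner ℝ (A f) g = inner ℝ f (A g) := by
    simp only [hA, hQ, sub_apply, ContinuousLinearMap.comp_apply,
      smul_apply, one_apply_eq_self, inner_sub_left,
      inner_sub_right, hsymm, real_inner_smul_left, inner_smul_right]
  have hpunit : IsUnit p := by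
    refine ContinuousLinearMap.isUnit_of_forall_le_norm_inner_map p (c := ⟨ε ^ 2, by positivity⟩)
      (by change 0 < ε ^ 2; positivity) fun g => ?_
    change ‖g‖ ^ 2 * ε ^ 2 ≤ _
    have e : inner ℝ (p g) g = ‖A g‖ ^ 2 + y ^ 2 * ‖g‖ ^ 2 := by
      simp only [hp, sq A, add_apply, mul_apply_eq_comp,
        smul_apply, one_apply_eq_self, inner_add_left, hAs,
        real_inner_smul_left, real_inner_self_eq_norm_sq]
      rw [← hAs, real_inner_self_eq_norm_sq]
    have h1 : ε * ‖g‖ ^ 2 ≤ ‖A g‖ * ‖g‖ := by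
      have h2 : -inner ℝ (A g) g ≤ ‖A g‖ * ‖g‖ :=
        (neg_le_abs _).trans (abs_real_inner_le_norm _ _)
      have h3 : inner ℝ (A g) g = inner ℝ (N (P g)) g - c * ‖g‖ ^ 2 := by
        simp [hA, hQ, inner_sub_left, real_inner_smul_left]
      nlinarith [hco g, sq_nonneg ‖g‖]
    have h4 : ε * ‖g‖ ≤ ‖A g‖ := by
      rcases (norm_nonneg g).eq_or_lt with h | h
      · rw [← h]; simp
      · exact le_of_mul_le_mul_right (by nlinarith) h
    rw [e, Real.norm_eq_abs]
    refine le_trans ?_ (le_abs_self _)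
    have : (ε * ‖g‖) ^ 2 ≤ ‖A g‖ ^ 2 := by gcongr
    nlinarith [mul_nonneg (sq_nonneg y) (sq_nonneg ‖g‖)]
  obtain ⟨hinj, hsurj⟩ := ContinuousLinearMap.isUnit_iff_bijective.1 hpunit
  set p0 := c ^ 2 + y ^ 2 with hp0
  have hp0pos : p0 ≠ 0 := by positivity
  have hpe (f : L) : p f = N (P (N (P f))) - (2 * c) • N (P f) + p0 • f := by
    simp only [hp, hA, hQ, sq, add_apply, mul_apply_eq_comp,
      sub_apply, ContinuousLinearMap.comp_apply, smul_apply,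
      one_apply_eq_self, map_sub, map_smul, hp0]
    module
  set pB := (P.comp N - 1 - x • (1 : E →L[ℝ] E)) ^ 2 + y ^ 2 • (1 : E →L[ℝ] E) with hpB
  have hBe (v : E) : pB v = P (N (P (N v))) - (2 * c) • P (N v) + p0 • v := by
    simp only [hpB, sq, add_apply, mul_apply_eq_comp,
      sub_apply, ContinuousLinearMap.comp_apply, smul_apply,
      one_apply_eq_self, map_sub, map_smul, hp0, hc]
    module
  refine ContinuousLinearMap.isUnit_iff_bijective.2
    ⟨(injective_iff_map_eq_zero _).2 fun v hv => ?_, fun v => ?_⟩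
  · have h1 : p (N v) = N (pB v) := by
      rw [hpe, hBe]; simp only [map_add, map_sub, map_smul]
    have h2 : N v = 0 := hinj (by rw [h1, hv, map_zero, map_zero])
    have h3 := hBe v
    rw [hv, h2] at h3
    simpa [hp0pos] using h3.symm
  · obtain ⟨w, hw⟩ := hsurj (N v)
    set u := p0⁻¹ • (v - P (N (P w)) + (2 * c) • P w) with hu
    have hNu : N u = w := by
      rw [hu, map_smul, map_add, map_sub, map_smul, ← hw, hpe, inv_smul_eq_iff₀ hp0pos]
      module
    refine ⟨u, ?_⟩
    rw [hBe, hNu, hu, smul_inv_smul₀ hp0pos]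
    module

/-- A nonnegative symmetric invertible operator is bounded below as a quadratic form. -/
lemma exists_le_inner_of_isUnit (A : L →L[ℝ] L)
    (hsymm : ∀ f g, inner ℝ (A f) g = inner ℝ f (A g)) (hpos : ∀ g, 0 ≤ inner ℝ (A g) g)
    (hA : IsUnit A) : ∃ η > 0, ∀ g, η * ‖g‖ ^ 2 ≤ inner ℝ (A g) g := by
  obtain ⟨R, -, hR⟩ := isUnit_iff_exists.1 hA
  set M := ‖A‖ + 1 with hM
  have hM0 : 0 < M := by positivity
  refine ⟨M⁻¹ * ((‖R‖ + 1) ^ 2)⁻¹, by positivity, fun g => ?_⟩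
  have h1 : ‖A g‖ ^ 2 ≤ M * inner ℝ (A g) g := by
    have h := hpos (g - M⁻¹ • A g)
    have e : inner ℝ (A (g - M⁻¹ • A g)) (g - M⁻¹ • A g)
        = inner ℝ (A g) g - 2 * M⁻¹ * ‖A g‖ ^ 2 + M⁻¹ ^ 2 * inner ℝ (A (A g)) (A g) := by
      simp only [map_sub, map_smul, inner_sub_left, inner_sub_right, real_inner_smul_left,
        inner_smul_right, hsymm (A g) g, real_inner_self_eq_norm_sq]
      ring
    have h2 : inner ℝ (A (A g)) (A g) ≤ M * ‖A g‖ ^ 2 := by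
      calc _ ≤ ‖A (A g)‖ * ‖A g‖ := real_inner_le_norm _ _
        _ ≤ ‖A‖ * ‖A g‖ * ‖A g‖ := by gcongr; exact A.le_opNorm _
        _ ≤ M * ‖A g‖ ^ 2 := by nlinarith [sq_nonneg ‖A g‖]
    rw [e] at h
    have h3 : M⁻¹ ^ 2 * inner ℝ (A (A g)) (A g) ≤ M⁻¹ * ‖A g‖ ^ 2 := by
      calc _ ≤ M⁻¹ ^ 2 * (M * ‖A g‖ ^ 2) := by gcongr
        _ = _ := by field_simp
    have h4 : M⁻¹ * ‖A g‖ ^ 2 ≤ inner ℝ (A g) g := by linarith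
    rwa [inv_mul_le_iff₀ hM0] at h4
  have h2 : ‖g‖ ≤ (‖R‖ + 1) * ‖A g‖ := by
    have : R (A g) = g := by rw [← mul_apply_eq_comp, hR]; rfl
    calc ‖g‖ = ‖R (A g)‖ := by rw [this]
      _ ≤ ‖R‖ * ‖A g‖ := R.le_opNorm _
      _ ≤ _ := by gcongr; linarith
  have h3 : ‖g‖ ^ 2 ≤ (‖R‖ + 1) ^ 2 * ‖A g‖ ^ 2 := by
    rw [← mul_pow]; gcongr
  rw [mul_assoc, inv_mul_le_iff₀ hM0, inv_mul_le_iff₀ (by positivity)]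
  calc _ ≤ _ := h3
    _ ≤ _ := by gcongr

/-- If `N P` is symmetric on a Hilbert space and its quadratic form exceeds `‖g‖²` somewhere, then
the spectrum of `P N - 1` meets the open right half-plane: the supremum of the Rayleigh quotient of
`N P` is in the spectrum of `N P`, hence in that of `P N`. -/
lemma exists_not_isUnit_of_lt [CompleteSpace L] (P : L →L[ℝ] E) (N : E →L[ℝ] L)
    (hsymm : ∀ f g, inner ℝ (N (P f)) g = inner ℝ f (N (P g)))
    {g₀ : L} (hg₀ : ‖g₀‖ ^ 2 < inner ℝ (N (P g₀)) g₀) :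
    ∃ x : ℝ, 0 < x ∧ ¬IsUnit (P.comp N - 1 - x • (1 : E →L[ℝ] E)) := by
  by_contra! hunit
  have hg₀0 : 0 < ‖g₀‖ ^ 2 := by
    rcases (sq_nonneg ‖g₀‖).eq_or_lt with h | h
    · have : g₀ = 0 := by simpa using h.symm
      rw [this] at hg₀; simp at hg₀
    · exact h
  set S : Set ℝ := {r | ∀ g, inner ℝ (N (P g)) g ≤ r * ‖g‖ ^ 2} with hS
  have hSlow (r : ℝ) (hr : r ∈ S) : 1 < r := by
    have := hr g₀
    by_contra! h
    nlinarith
  have hSne : S.Nonempty := by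
    refine ⟨‖N.comp P‖, fun g => ?_⟩
    calc _ ≤ ‖N (P g)‖ * ‖g‖ := real_inner_le_norm _ _
      _ ≤ ‖N.comp P‖ * ‖g‖ * ‖g‖ := by gcongr; exact (N.comp P).le_opNorm g
      _ = _ := by ring
  have hSbdd : BddBelow S := ⟨1, fun r hr => (hSlow r hr).le⟩
  have hSclosed : IsClosed S := by
    simp only [hS, ofPred_forall]
    exact isClosed_iInter fun g => isClosed_le continuous_const (by fun_prop)
  have hμ := hSclosed.csInf_mem hSne hSbdd
  set μ := sInf S with hμ_def
  have hμ1 := hSlow μ hμ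
  obtain ⟨hinj, hsurj⟩ := ContinuousLinearMap.isUnit_iff_bijective.1 (hunit (μ - 1) (by linarith))
  set B := P.comp N - 1 - (μ - 1) • (1 : E →L[ℝ] E) with hB
  have hBe (v : E) : B v = P (N v) - μ • v := by
    simp only [hB, sub_apply, ContinuousLinearMap.comp_apply,
      smul_apply, one_apply_eq_self]
    module
  have hμ0 : μ ≠ 0 := by linarith
  set A := μ • (1 : L →L[ℝ] L) - N.comp P with hA
  have hAe (f : L) : A f = μ • f - N (P f) := rfl
  have hAunit : IsUnit A := by
    refine ContinuousLinearMap.isUnit_iff_bijective.2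
      ⟨(injective_iff_map_eq_zero _).2 fun f hf => ?_, fun g => ?_⟩
    · have h1 : B (P f) = -P (A f) := by rw [hBe, hAe, map_sub, map_smul]; module
      have h2 : P f = 0 := hinj (by rw [h1, hf]; simp)
      rw [hAe, h2] at hf
      simpa [hμ0] using hf
    · obtain ⟨v, hv⟩ := hsurj (P g)
      have hPv : P (μ⁻¹ • (g - N v)) = -v := by
        rw [map_smul, map_sub, ← hv, hBe, inv_smul_eq_iff₀ hμ0]; module
      refine ⟨μ⁻¹ • (g - N v), ?_⟩
      rw [hAe, hPv, smul_inv_smul₀ hμ0, map_neg]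
      module
  have hAin (f : L) : inner ℝ (A f) f = μ * ‖f‖ ^ 2 - inner ℝ (N (P f)) f := by
    rw [hAe, inner_sub_left, real_inner_smul_left, real_inner_self_eq_norm_sq]
  obtain ⟨η, hη, hle⟩ := exists_le_inner_of_isUnit A
    (fun f g => by
      rw [hAe, hAe, inner_sub_left, inner_sub_right, hsymm, real_inner_smul_left, inner_smul_right])
    (fun g => by rw [hAin]; linarith [hμ g]) hAunit
  have : μ - η ∈ S := fun g => by have := hle g; rw [hAin] at this; linarith
  linarith [csInf_le hSbdd this]

end Abstract

end

section

/-! ### The Hilbert basis of cosine modes -/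

lemma inner_smul_left_H (x y : H) (r : ℝ) : inner ℝ (r • x) y = r * inner ℝ x y :=
  real_inner_smul_left x y r

lemma inner_smul_right_H (x y : H) (r : ℝ) : inner ℝ x (r • y) = r * inner ℝ x y :=
  inner_smul_right x y r

lemma inner_mode_mode (n k : ℕ+) :
    inner ℝ (mode n) (mode k) = if n = k then (1 + 4 * (n : ℝ) ^ 2) * π else 0 := by
  rw [inner_mode]
  split_ifs with h
  · rw [h, cosCoeff_mode]
  · rw [cosCoeff_mode_ne (by exact_mod_cast h), mul_zero]

lemma mode_ne_zero (n : ℕ+) : mode n ≠ 0 := by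
  intro h
  have := inner_mode_mode n n
  rw [h, inner_zero_left, if_pos rfl] at this
  exact (by positivity : (1 + 4 * (n : ℝ) ^ 2) * π ≠ 0) this.symm

/-- The square of the norm of a mode in `H`. -/
def modeNormSq (n : ℕ+) : ℝ := (1 + 4 * (n : ℝ) ^ 2) * π

lemma modeNormSq_pos (n : ℕ+) : 0 < modeNormSq n := by unfold modeNormSq; positivity

lemma orthonormal_mode : Orthonormal ℝ fun n : ℕ+ => (√(modeNormSq n))⁻¹ • mode n := by
  classical
  rw [orthonormal_iff_ite]
  intro n k
  rw [inner_smul_left_H, inner_smul_right_H, inner_mode_mode]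
  split_ifs with h
  · rw [← h, ← modeNormSq]
    have h1 := mul_self_sqrt (modeNormSq_pos n).le
    have h2 := (sqrt_pos.2 (modeNormSq_pos n)).ne'
    field_simp
    linarith
  · simp

/-- The normalised modes form a Hilbert basis of `H`. -/
def modeBasis : HilbertBasis ℕ+ ℝ H :=
  HilbertBasis.mkOfOrthogonalEqBot orthonormal_mode <| by
    rw [Submodule.eq_bot_iff]
    intro u hu
    refine eq_zero_of_cosCoeff fun n => ?_
    have h := (Submodule.mem_orthogonal _ _).1 hu _ (Submodule.subset_span ⟨n, rfl⟩)
    change inner ℝ ((√(modeNormSq n))⁻¹ • mode n) u = 0 at h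
    rw [inner_smul_left_H, inner_mode] at h
    have h1 := (sqrt_pos.2 (modeNormSq_pos n)).ne'
    have h2 : (1 + 4 * (n : ℝ) ^ 2) ≠ 0 := by positivity
    simpa [h1, h2] using h

lemma modeBasis_apply (n : ℕ+) : modeBasis n = (√(modeNormSq n))⁻¹ • mode n := by
  rw [modeBasis, HilbertBasis.coe_mkOfOrthogonalEqBot]

/-- Parseval's identity for the pairing of an arbitrary function with an element of `H`. -/
lemma hasSum_inner_toL2 (f : L2) (u : H) :
    HasSum (fun n : ℕ+ => π⁻¹ * (cosCoeff n f * cosCoeff n (toL2 u))) (inner ℝ f (toL2 u)) := by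
  have h := (modeBasis.hasSum_repr u).mapL ((innerSL ℝ f).comp toL2)
  refine Eq.mp (congrArg (HasSum · _) (funext fun n => ?_)) h
  have e : ((innerSL ℝ f).comp toL2) (modeBasis.repr u n • modeBasis n)
      = modeBasis.repr u n * ((√(modeNormSq n))⁻¹ * inner ℝ f (toL2 (mode n))) := by
    simp [modeBasis_apply]
  rw [e, modeBasis.repr_apply_apply, modeBasis_apply, inner_smul_left_H, inner_mode, toL2_mode,
    real_inner_comm, ← cosCoeff_apply]
  have h1 := mul_self_sqrt (modeNormSq_pos n).le
  have h2 := (sqrt_pos.2 (modeNormSq_pos n)).ne'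
  have h3 : (√(modeNormSq n))⁻¹ * (√(modeNormSq n))⁻¹ * (1 + 4 * (n : ℝ) ^ 2) = π⁻¹ := by
    rw [← mul_inv, h1, modeNormSq]
    have : (1 + 4 * (n : ℝ) ^ 2) ≠ 0 := by positivity
    field_simp
  linear_combination (cosCoeff n f * cosCoeff n (toL2 u)) * h3

variable (K : Kernel)

/-- The interaction form is diagonal in the cosine coefficients. -/
lemma hasSum_inner_conv (f g : L2) :
    HasSum (fun n : ℕ+ => K.coeff n * (cosCoeff n f * cosCoeff n g))
      (inner ℝ f (toL2 (conv K g))) := by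
  convert hasSum_inner_toL2 f (conv K g) using 2 with n
  rw [cosCoeff_conv]
  have := pi_pos.ne'
  field_simp

lemma inner_conv_symm (f g : L2) :
    inner ℝ (toL2 (conv K f)) g = inner ℝ f (toL2 (conv K g)) := by
  rw [real_inner_comm]
  refine (hasSum_inner_conv K g f).unique ?_
  convert hasSum_inner_conv K f g using 3
  ring

/-- Bessel's inequality for the cosine coefficients. -/
lemma sum_cosCoeff_sq_le (f : L2) :
    Summable (fun n : ℕ+ => cosCoeff n f ^ 2) ∧ ∑' n : ℕ+, cosCoeff n f ^ 2 ≤ π * ‖f‖ ^ 2 := by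
  have ho : Orthonormal ℝ fun n : ℕ+ => (√π)⁻¹ • algToL2 (cosA n) := by
    classical
    rw [orthonormal_iff_ite]
    intro n k
    rw [real_inner_smul_left, inner_smul_right, inner_algToL2_algToL2]
    split_ifs with h
    · rw [← h, integ_cosA_mul_self n.pos]
      have h1 := mul_self_sqrt pi_pos.le
      have h2 := (sqrt_pos.2 pi_pos).ne'
      field_simp
      linarith
    · rw [integ_cosA_mul (by exact_mod_cast h)]; simp
  have e (n : ℕ+) : cosCoeff n f ^ 2
      = π * ‖inner ℝ ((√π)⁻¹ • algToL2 (cosA n)) f‖ ^ 2 := by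
    rw [real_inner_smul_left, norm_mul, mul_pow, Real.norm_eq_abs, Real.norm_eq_abs, sq_abs, sq_abs,
      inv_pow, sq_sqrt pi_pos.le, ← cosCoeff_apply]
    have := pi_pos.ne'
    field_simp
  simp only [e]
  refine ⟨(ho.inner_products_summable f).mul_left π, ?_⟩
  rw [tsum_mul_left]
  gcongr
  exact ho.tsum_inner_products_le f

section Signs

variable {K} (hneg : ∀ m : ℕ, 1 ≤ m → K.coeff m < 0)
  (hmono : ∀ m : ℕ, 1 ≤ m → -K.coeff (m + 1) < -K.coeff m)

include hmono in
lemma coeff_strictMono {n k : ℕ} (hn : 1 ≤ n) (h : n < k) : K.coeff n < K.coeff k := by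
  induction k, h using Nat.le_induction with
  | base => linarith [hmono n hn]
  | succ k hk ih => linarith [hmono k (by lia)]

include hneg hmono in
/-- Upper bound of the interaction form: the first mode is separated from the others. -/
lemma neg_inner_conv_le (f : L2) : -inner ℝ f (toL2 (conv K f)) ≤
    (-K.coeff 1) * cosCoeff 1 f ^ 2 + (-K.coeff 2) * (π * ‖f‖ ^ 2 - cosCoeff 1 f ^ 2) := by
  obtain ⟨hs, hle⟩ := sum_cosCoeff_sq_le f
  have h1 := (hasSum_inner_conv K f f).neg
  have h2 := ((hs.hasSum).mul_left (-K.coeff 2)).add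
    (hasSum_ite_eq (1 : ℕ+) ((K.coeff 2 - K.coeff 1) * cosCoeff 1 f ^ 2))
  have := hasSum_le (fun n => ?_) h1 h2
  · nlinarith [hneg 2 (by norm_num)]
  · have hsq := sq_nonneg (cosCoeff n f)
    by_cases hn : n = 1
    · subst hn
      simp only [if_pos, PNat.one_coe]
      linarith
    · have hn2 : 2 ≤ (n : ℕ) := by
        have := n.pos
        have : (n : ℕ) ≠ 1 := fun h => hn (PNat.coe_injective h)
        lia
      have hk : K.coeff 2 ≤ K.coeff n := by
        rcases hn2.eq_or_lt with h | h
        · rw [← h]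
        · exact (coeff_strictMono hmono (by norm_num) h).le
      rw [if_neg hn]
      nlinarith

include hneg in
/-- Lower bound of the interaction form by finitely many modes. -/
lemma le_neg_inner_conv (f : L2) (s : Finset ℕ+) :
    ∑ n ∈ s, (-K.coeff n) * cosCoeff n f ^ 2 ≤ -inner ℝ f (toL2 (conv K f)) := by
  have h1 := (hasSum_inner_conv K f f).neg
  have e (n : ℕ+) : -(K.coeff n * (cosCoeff n f * cosCoeff n f))
      = (-K.coeff n) * cosCoeff n f ^ 2 := by ring
  simp only [e] at h1
  exact sum_le_hasSum s (fun n _ => by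
    have := hneg n n.pos
    nlinarith [sq_nonneg (cosCoeff n f)]) h1

/-! ### The operator at the bifurcation point -/

/-- `1 - λ_m DΓ(0)` plus the orthogonal projection to the mode `m`. -/
def bifOp (K : Kernel) (m : ℕ+) : H →L[ℝ] H :=
  1 + (K.criticalParam m / (2 * π)) • (conv K).comp toL2
    + (modeNormSq m)⁻¹ • (innerSL ℝ (mode m)).smulRight (mode m)

lemma bifOp_apply (m : ℕ+) (u : H) : bifOp K m u =
    u + (K.criticalParam m / (2 * π)) • conv K (toL2 u)
      + (modeNormSq m)⁻¹ • inner ℝ (mode m) u • mode m := rfl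

include hneg in
lemma bifOp_mode (m n : ℕ+) : bifOp K m (mode n)
    = (1 - K.coeff n / K.coeff m + if m = n then 1 else 0) • mode n := by
  have hm := (hneg m m.pos).ne
  have hπ := pi_pos.ne'
  have e : K.criticalParam m / (2 * π) * (π * K.coeff n) = -(K.coeff n / K.coeff m) := by
    rw [Kernel.criticalParam]; field_simp
  rw [bifOp_apply, toL2_mode, conv_cosA, inner_mode_mode, smul_smul, e]
  split_ifs with h
  · rw [← h, ← modeNormSq, smul_smul, inv_mul_cancel₀ (modeNormSq_pos m).ne']
    module
  · module

include hneg hmono in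
lemma exists_bifOp_equiv (m : ℕ+) : ∃ e : H ≃L[ℝ] H, (e : H →L[ℝ] H) = bifOp K m := by
  have hkm := hneg m m.pos
  set c : ℝ := min 1 (min (1 - K.coeff (m + 1) / K.coeff m)
    (if (m : ℕ) = 1 then 1 else K.coeff (m - 1 : ℕ) / K.coeff m - 1)) with hc
  have h1 : 0 < 1 - K.coeff (m + 1) / K.coeff m := by
    rw [sub_pos, div_lt_one_of_neg hkm]
    exact coeff_strictMono hmono m.pos (by lia)
  have h2 : 0 < if (m : ℕ) = 1 then 1 else K.coeff (m - 1 : ℕ) / K.coeff m - 1 := by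
    split_ifs with h
    · exact one_pos
    · rw [sub_pos, one_lt_div_of_neg hkm]
      have := m.pos
      exact coeff_strictMono hmono (by lia) (by lia)
  refine exists_equiv_of_diagonal modeBasis (bifOp K m)
    (fun n => 1 - K.coeff n / K.coeff m + if m = n then 1 else 0) (c := c)
    (fun n => ?_) (lt_min one_pos (lt_min h1 h2)) (fun n => ?_)
  · rw [modeBasis_apply, map_smul, bifOp_mode hneg, smul_comm]
  · have mono {i j : ℕ} (hi : 1 ≤ i) (hij : i ≤ j) :
        K.coeff j / K.coeff m ≤ K.coeff i / K.coeff m := by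
      rw [div_le_div_right_of_neg hkm]
      rcases hij.eq_or_lt with h | h
      · rw [h]
      · exact (coeff_strictMono hmono hi h).le
    rcases lt_trichotomy (m : ℕ) (n : ℕ) with h | h | h
    · have hmn : m ≠ n := fun e => by rw [e] at h; exact lt_irrefl _ h
      rw [if_neg hmn, add_zero]
      refine le_trans ?_ (le_abs_self _)
      have : K.coeff n / K.coeff m ≤ K.coeff (m + 1) / K.coeff m := mono (by lia) (by lia)
      exact (min_le_right _ _).trans ((min_le_left _ _).trans (by linarith))
    · rw [if_pos (PNat.coe_injective h), ← PNat.coe_injective h, div_self hkm.ne]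
      refine le_trans (min_le_left _ _) ?_
      norm_num
    · have hmn : m ≠ n := fun e => by rw [e] at h; exact lt_irrefl _ h
      have hn := n.pos
      rw [if_neg hmn, add_zero]
      refine le_trans ?_ (neg_le_abs _)
      have : K.coeff (m - 1 : ℕ) / K.coeff m ≤ K.coeff n / K.coeff m := mono hn (by lia)
      refine (min_le_right _ _).trans ((min_le_right _ _).trans ?_)
      rw [if_neg (by lia)]
      linarith

end Signs

end

section

/-! ### The exponential of the algebra of continuous functions -/

/-- The entire function `∑ (-x)ⁿ / (n + 3)!`, the third-order remainder of `e^{-x}` divided by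
`-x³`, in the algebra of continuous functions. -/
def expRem : Alg → Alg :=
  FormalMultilinearSeries.ofScalarsSum fun n : ℕ => (-1 : ℝ) ^ n * ((n + 3).factorial : ℝ)⁻¹

lemma expRem_hasFPowerSeries : HasFPowerSeriesOnBall expRem
    (FormalMultilinearSeries.ofScalars Alg fun n : ℕ => (-1 : ℝ) ^ n * ((n + 3).factorial : ℝ)⁻¹)
    0 ⊤ := by
  set c : ℕ → ℝ := fun n => (-1 : ℝ) ^ n * ((n + 3).factorial : ℝ)⁻¹ with hc
  have hc0 (n : ℕ) : c n ≠ 0 := by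
    have := (n + 3).factorial_ne_zero
    simp [hc, this]
  have hr : (FormalMultilinearSeries.ofScalars Alg c).radius = ⊤ := by
    refine FormalMultilinearSeries.ofScalars_radius_eq_top_of_tendsto Alg c (.of_forall hc0) ?_
    have e (n : ℕ) : ‖c n.succ‖ / ‖c n‖ = 1 / ((n + 3 : ℕ) + 1 : ℝ) := by
      have h1 : ((n + 3).factorial : ℝ) ≠ 0 := by exact_mod_cast (n + 3).factorial_ne_zero
      have h2 : (n.succ + 3).factorial = (n + 3 + 1) * (n + 3).factorial := by
        rw [← Nat.factorial_succ]
      simp only [hc, h2, norm_mul, norm_pow, norm_neg, norm_one, one_pow, one_mul, norm_inv,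
        RCLike.norm_natCast]
      push_cast
      field_simp
    simp only [e]
    exact (tendsto_add_atTop_iff_nat (f := fun n : ℕ => 1 / ((n : ℝ) + 1)) 3).2
      tendsto_one_div_add_atTop_nhds_zero_nat
  have := (FormalMultilinearSeries.ofScalars Alg c).hasFPowerSeriesOnBall (by rw [hr]; simp)
  rwa [hr] at this

lemma contDiff_expRem {n : WithTop ℕ∞} : ContDiff ℝ n expRem := by
  have h := expRem_hasFPowerSeries.analyticOnNhd
  rw [Metric.eball_top] at h
  exact h.contDiff

lemma expRem_zero : expRem 0 = (6⁻¹ : ℝ) • (1 : Alg) := by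
  rw [expRem, FormalMultilinearSeries.ofScalarsSum_zero]
  norm_num [Nat.factorial]

/-- The exponential `e^{-a}` of a continuous function. -/
def expNeg (a : Alg) : Alg := NormedSpace.exp (-a)

lemma ext_expNeg (a : Alg) (θ : ℝ) : ext (expNeg a) θ = exp (-ext a θ) := ext_exp _ _

lemma expNeg_apply (a : Alg) (θ : Icc (0 : ℝ) (2 * π)) : expNeg a θ = exp (-a θ) := by
  have := ext_expNeg a θ
  rwa [ext_of_mem _ θ.2, ext_of_mem _ θ.2] at this

lemma expNeg_eq (a : Alg) :
    expNeg a = 1 - a + (2⁻¹ : ℝ) • (a * a) - a * a * a * expRem a := by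
  have h1 := (hasSum_nat_add_iff' 3).2 (NormedSpace.exp_series_hasSum_exp' (𝕂 := ℝ) (-a))
  have h2 : HasSum (fun n : ℕ => ((-1 : ℝ) ^ n * ((n + 3).factorial : ℝ)⁻¹) • a ^ n)
      (expRem a) := by
    have := expRem_hasFPowerSeries.hasSum (y := a) (by simp)
    simpa [FormalMultilinearSeries.ofScalars_apply_eq] using this
  have h3 := (h2.mul_left (a * a * a)).neg
  have e (n : ℕ) : ((n + 3).factorial : ℝ)⁻¹ • (-a) ^ (n + 3)
      = -(a * a * a * (((-1 : ℝ) ^ n * ((n + 3).factorial : ℝ)⁻¹) • a ^ n)) := by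
    ext θ
    simp only [ContinuousMap.smul_apply, ContinuousMap.pow_apply, ContinuousMap.neg_apply,
      ContinuousMap.mul_apply, smul_eq_mul]
    rw [neg_pow, pow_add, pow_add]
    ring
  simp only [e] at h1
  have h4 := h1.unique h3
  rw [sub_eq_iff_eq_add] at h4
  rw [expNeg, h4]
  ext θ
  simp [Finset.sum_range_succ, Nat.factorial]
  ring

lemma expNeg_zero : expNeg 0 = 1 := by simp [expNeg]

lemma expNeg_add (a b : Alg) : expNeg (a + b) = expNeg a * expNeg b := by
  ext θ
  simp [expNeg_apply, ← exp_add, add_comm]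

lemma contDiff_expNeg {n : WithTop ℕ∞} : ContDiff ℝ n expNeg := by
  have : expNeg = fun a => 1 - a + (2⁻¹ : ℝ) • (a * a) - a * a * a * expRem a := funext expNeg_eq
  rw [this]
  have h := contDiff_expRem (n := n)
  fun_prop

lemma hasFDerivAt_expNeg (a : Alg) :
    HasFDerivAt expNeg (-(ContinuousLinearMap.mul ℝ Alg (expNeg a))) a := by
  have h1 : HasFDerivAt (fun b : Alg => -b) (-ContinuousLinearMap.id ℝ Alg) a :=
    (hasFDerivAt_id a).neg
  have h2 : HasFDerivAt (NormedSpace.exp : Alg → Alg)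
      (NormedSpace.exp (-a) • (1 : Alg →L[ℝ] Alg)) (-a) := hasFDerivAt_exp
  refine (h2.comp a h1).congr_fderiv ?_
  ext b θ
  simp [expNeg]

lemma integ_expNeg_pos (a : Alg) : 0 < integ (expNeg a) := by
  rw [integ_apply]
  refine intervalIntegral.intervalIntegral_pos_of_pos
    ((continuous_ext _).intervalIntegrable _ _) (fun θ => ?_) two_pi_pos
  rw [ext_expNeg]
  exact exp_pos _

variable (K : Kernel)

lemma Gamma_eq' (V : H) : Gamma K V =
    (integ (expNeg (embed V)))⁻¹ • conv K (algToL2 (expNeg (embed V))) := Gamma_eq K V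

/-- The derivative of `Γ` at `V`. -/
def GammaDeriv (V : H) : H →L[ℝ] H :=
  -(integ (expNeg (embed V)))⁻¹ • ((conv K).comp algToL2).comp
      ((ContinuousLinearMap.mul ℝ Alg (expNeg (embed V))).comp embed)
    + ((integ (expNeg (embed V)))⁻¹ ^ 2 • integ.comp
      ((ContinuousLinearMap.mul ℝ Alg (expNeg (embed V))).comp embed)).smulRight
        (conv K (algToL2 (expNeg (embed V))))

lemma GammaDeriv_apply (V W : H) : GammaDeriv K V W =
    -(integ (expNeg (embed V)))⁻¹ • conv K (algToL2 (expNeg (embed V) * embed W))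
    + ((integ (expNeg (embed V)))⁻¹ ^ 2 * integ (expNeg (embed V) * embed W)) •
        conv K (algToL2 (expNeg (embed V))) := rfl

lemma hasFDerivAt_Gamma (V : H) : HasFDerivAt (Gamma K) (GammaDeriv K V) V := by
  have h1 : HasFDerivAt (fun V : H => expNeg (embed V))
      ((-(ContinuousLinearMap.mul ℝ Alg (expNeg (embed V)))).comp embed) V :=
    (hasFDerivAt_expNeg (embed V)).comp V embed.hasFDerivAt
  have h2 := (((conv K).comp algToL2).hasFDerivAt (x := expNeg (embed V))).comp V h1
  have h3 := (integ.hasFDerivAt (x := expNeg (embed V))).comp V h1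
  have h4 := (hasDerivAt_inv (integ_expNeg_pos (embed V)).ne').comp_hasFDerivAt V h3
  have h5 := h4.smul h2
  have e : Gamma K = fun V => (integ (expNeg (embed V)))⁻¹ • conv K (algToL2 (expNeg (embed V))) :=
    funext (Gamma_eq' K)
  rw [e]
  refine h5.congr_fderiv ?_
  refine ContinuousLinearMap.ext fun W => ?_
  rw [GammaDeriv_apply]
  simp only [Function.comp_apply, add_apply, smul_apply, ContinuousLinearMap.comp_apply, neg_apply,
    ContinuousLinearMap.smulRight_apply, ContinuousLinearMap.mul_apply', map_neg]
  rw [smul_eq_mul, inv_pow]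
  module

end

section

/-! ### Linear stability as a question about quadratic forms on `L²` -/

/-- The projection of `L²` along `s`, orthogonal if `s` is a unit vector. -/
def projAlong (s : Alg) : L2 →L[ℝ] L2 := 1 - (innerSL ℝ (algToL2 s)).smulRight (algToL2 s)

lemma projAlong_apply (s : Alg) (g : L2) :
    projAlong s g = g - inner ℝ (algToL2 s) g • algToL2 s := rfl

lemma inner_projAlong (s : Alg) (f g : L2) :
    inner ℝ (projAlong s f) g = inner ℝ f (projAlong s g) := by
  rw [projAlong_apply, projAlong_apply, inner_sub_left, inner_sub_right, real_inner_smul_left,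
    inner_smul_right, real_inner_comm f]
  ring

/-- Multiplication by `s` followed by the projection along `s`. If `s²` is a probability density,
this is a square root of the covariance form of that density. -/
def fluct (s : Alg) : L2 →L[ℝ] L2 := (projAlong s).comp (mulL s)

/-- The adjoint of `fluct s`. -/
def fluctAdj (s : Alg) : L2 →L[ℝ] L2 := (mulL s).comp (projAlong s)

lemma inner_fluct (s : Alg) (f g : L2) : inner ℝ (fluct s f) g = inner ℝ f (fluctAdj s g) := by
  rw [fluct, fluctAdj, ContinuousLinearMap.comp_apply, inner_projAlong, inner_mulL]; rfl

lemma fluctAdj_fluct {s : Alg} (hs : integ (s * s) = 1) (a : Alg) :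
    fluctAdj s (fluct s (algToL2 a)) =
      algToL2 (s * s * a) - integ (s * s * a) • algToL2 (s * s) := by
  have h1 : inner ℝ (algToL2 s) (algToL2 (s * a)) = integ (s * s * a) := by
    rw [inner_algToL2_algToL2, mul_assoc]
  have h2 : projAlong s (algToL2 s) = 0 := by
    rw [projAlong_apply, inner_algToL2_algToL2, hs, one_smul, sub_self]
  have h3 : fluct s (algToL2 a) = algToL2 (s * a) - integ (s * s * a) • algToL2 s := by
    rw [fluct, ContinuousLinearMap.comp_apply, mulL_algToL2, projAlong_apply, h1]
  rw [h3, fluctAdj, ContinuousLinearMap.comp_apply, map_sub, map_smul, h2, smul_zero, sub_zero,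
    projAlong_apply, h1, map_sub, map_smul, mulL_algToL2, mulL_algToL2, mul_assoc]

/-- The square root of the Gibbs density `e^{-V} / ∫ e^{-V}`. -/
def sqrtDensity (V : H) : Alg :=
  (√(integ (expNeg (embed V))))⁻¹ • expNeg ((2⁻¹ : ℝ) • embed V)

lemma sqrtDensity_mul_self (V : H) : sqrtDensity V * sqrtDensity V =
    (integ (expNeg (embed V)))⁻¹ • expNeg (embed V) := by
  have h := mul_self_sqrt (integ_expNeg_pos (embed V)).le
  rw [sqrtDensity, smul_mul_smul_comm, ← expNeg_add, ← add_smul, ← mul_inv, h]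
  norm_num

lemma integ_sqrtDensity (V : H) : integ (sqrtDensity V * sqrtDensity V) = 1 := by
  rw [sqrtDensity_mul_self, map_smul, smul_eq_mul, inv_mul_cancel₀ (integ_expNeg_pos _).ne']

variable (K : Kernel)

/-- The linearisation factors through `L²` in a way that makes it symmetric after exchanging the
two factors. -/
lemma smul_GammaDeriv_eq (lam : ℝ) (V : H) : lam • GammaDeriv K V =
    (-lam • (conv K).comp (fluctAdj (sqrtDensity V))).comp ((fluct (sqrtDensity V)).comp toL2) := by
  refine ContinuousLinearMap.ext fun W => ?_
  have h := fluctAdj_fluct (integ_sqrtDensity V) (embed W)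
  rw [algToL2_embed] at h
  set Z := integ (expNeg (embed V)) with hZ
  set e := expNeg (embed V) with he
  have hd : sqrtDensity V * sqrtDensity V = Z⁻¹ • e := sqrtDensity_mul_self V
  rw [hd, smul_mul_assoc, map_smul, map_smul, map_smul] at h
  have h' : ((-lam • (conv K).comp (fluctAdj (sqrtDensity V))).comp
      ((fluct (sqrtDensity V)).comp toL2)) W
      = -lam • conv K (fluctAdj (sqrtDensity V) (fluct (sqrtDensity V) (toL2 W))) := rfl
  rw [h', h, map_sub, map_smul, map_smul, map_smul, smul_apply, GammaDeriv_apply, ← hZ, ← he,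
    smul_eq_mul]
  module

lemma fluct_conv_symm (lam : ℝ) (s : Alg) (f g : L2) :
    inner ℝ (((fluct s).comp toL2) ((-lam • (conv K).comp (fluctAdj s)) f)) g
      = inner ℝ f (((fluct s).comp toL2) ((-lam • (conv K).comp (fluctAdj s)) g)) := by
  have e (f : L2) : ((fluct s).comp toL2) ((-lam • (conv K).comp (fluctAdj s)) f)
      = -lam • fluct s (toL2 (conv K (fluctAdj s f))) := by
    simp only [ContinuousLinearMap.comp_apply, smul_apply, map_smul]
  rw [e, e, real_inner_smul_left, inner_smul_right, inner_fluct, inner_conv_symm,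
    real_inner_comm (fluct s _) f, inner_fluct, real_inner_comm (toL2 _)]

lemma inner_fluct_conv (lam : ℝ) (s : Alg) (g : L2) :
    inner ℝ (((fluct s).comp toL2) ((-lam • (conv K).comp (fluctAdj s)) g)) g
      = -lam * inner ℝ (fluctAdj s g) (toL2 (conv K (fluctAdj s g))) := by
  have e : ((fluct s).comp toL2) ((-lam • (conv K).comp (fluctAdj s)) g)
      = -lam • fluct s (toL2 (conv K (fluctAdj s g))) := by
    simp only [ContinuousLinearMap.comp_apply, smul_apply, map_smul]
  rw [e, real_inner_smul_left, inner_fluct, real_inner_comm]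

lemma isStable_of_coercive {lam : ℝ} {V : H} {ε : ℝ} (hε : 0 < ε)
    (h : ∀ g : L2, ε * ‖g‖ ^ 2 ≤ ‖g‖ ^ 2 + lam * inner ℝ (fluctAdj (sqrtDensity V) g)
      (toL2 (conv K (fluctAdj (sqrtDensity V) g)))) : IsStable K lam V := by
  refine ⟨GammaDeriv K V, hasFDerivAt_Gamma K V, fun z hz => ?_⟩
  by_contra! hre
  refine hz ?_
  rw [smul_GammaDeriv_eq]
  refine isUnit_of_coercive _ _ (fluct_conv_symm K lam _) hε (fun g => ?_) hre
  rw [inner_fluct_conv]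
  linarith [h g]

lemma isUnstable_of_lt {lam : ℝ} {V : H} {g : L2}
    (h : ‖g‖ ^ 2 + lam * inner ℝ (fluctAdj (sqrtDensity V) g)
      (toL2 (conv K (fluctAdj (sqrtDensity V) g))) < 0) : IsUnstable K lam V := by
  obtain ⟨x, hx, hnot⟩ := exists_not_isUnit_of_lt _ _ (fluct_conv_symm K lam (sqrtDensity V))
    (g₀ := g) (by rw [inner_fluct_conv]; linarith)
  refine ⟨GammaDeriv K V, hasFDerivAt_Gamma K V, (x : ℂ), fun hu => hnot ?_, by simpa using hx⟩
  rw [smul_GammaDeriv_eq] at hu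
  rw [Complex.ofReal_re, Complex.ofReal_im, zero_pow two_ne_zero] at hu
  have e (A : H →L[ℝ] H) : A + (0 : ℝ) • (1 : H →L[ℝ] H) = A :=
    (congrArg (A + ·) (zero_smul ℝ (1 : H →L[ℝ] H))).trans (add_zero A)
  exact (isUnit_pow_iff two_ne_zero).1 ((congrArg IsUnit (e _)).mp hu)

section Signs

variable {K} (hneg : ∀ m : ℕ, 1 ≤ m → K.coeff m < 0)
  (hmono : ∀ m : ℕ, 1 ≤ m → -K.coeff (m + 1) < -K.coeff m)

include hneg in
/-- A test function of mean zero for which the interaction exceeds the entropy shows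
instability. -/
lemma isUnstable_of_test {lam : ℝ} (hlam : 0 ≤ lam) {V : H} (a : Alg) (ha : integ a = 0)
    (s : Finset ℕ+)
    (h : integ (expNeg (embed V)) * integ (expNeg (-embed V) * (a * a)) <
      lam * ∑ n ∈ s, (-K.coeff n) * integ (cosA n * a) ^ 2) : IsUnstable K lam V := by
  set Z := integ (expNeg (embed V)) with hZ
  have hZ0 : 0 < Z := integ_expNeg_pos _
  set b : Alg := √Z • (expNeg (-(2⁻¹ : ℝ) • embed V) * a) with hb
  have hsb : sqrtDensity V * b = a := by
    rw [sqrtDensity, hb, ← hZ, smul_mul_smul_comm, ← mul_assoc, ← expNeg_add, ← add_smul,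
      inv_mul_cancel₀ (sqrt_pos.2 hZ0).ne', one_smul]
    norm_num [expNeg_zero]
  have hf : fluctAdj (sqrtDensity V) (algToL2 b) = algToL2 a := by
    rw [fluctAdj, ContinuousLinearMap.comp_apply, projAlong_apply, inner_algToL2_algToL2, hsb, ha,
      zero_smul, sub_zero, mulL_algToL2, hsb]
  have hbb : b * b = Z • (expNeg (-embed V) * (a * a)) := by
    have h1 : expNeg (-(2⁻¹ : ℝ) • embed V) * expNeg (-(2⁻¹ : ℝ) • embed V)
        = expNeg (-embed V) := by
      rw [← expNeg_add, ← add_smul]; norm_num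
    rw [hb, smul_mul_smul_comm, mul_self_sqrt hZ0.le, ← h1]
    congr 1
    ring
  refine isUnstable_of_lt K (g := algToL2 b) ?_
  rw [hf, ← real_inner_self_eq_norm_sq, inner_algToL2_algToL2, hbb, map_smul, smul_eq_mul]
  have h2 := le_neg_inner_conv hneg (algToL2 a) s
  simp only [cosCoeff_algToL2] at h2
  nlinarith [mul_le_mul_of_nonneg_left h2 hlam]

include hneg hmono in
/-- A criterion for stability by a weighted Cauchy-Schwarz inequality: here `w = 1 - κ₂ ρ` with
the Gibbs density `ρ`, and `τ` is its inverse. The constant `α` is free because the perturbations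
have mean zero. -/
lemma isStable_of_weight {lam : ℝ} (hlam : 0 ≤ lam) {V : H} (τ : Alg) (α c₀ : ℝ) (hc₀ : 0 < c₀)
    (hτ : τ * (1 - (lam * -K.coeff 2 * π) • (sqrtDensity V * sqrtDensity V)) = 1)
    (hw : ∀ θ, c₀ ≤ ext (1 - (lam * -K.coeff 2 * π) • (sqrtDensity V * sqrtDensity V)) θ)
    (hJ : lam * (K.coeff 2 - K.coeff 1) * integ (τ * (sqrtDensity V * sqrtDensity V) *
      ((cosA 1 - α • 1) * (cosA 1 - α • 1))) < 1) : IsStable K lam V := by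
  set s := sqrtDensity V with hs
  set ρ := s * s with hρ
  set κ₂ := lam * -K.coeff 2 * π with hκ₂
  set κ₁ := lam * (K.coeff 2 - K.coeff 1) with hκ₁
  set w : Alg := 1 - κ₂ • ρ with hw_def
  set ψ : Alg := cosA 1 - α • 1 with hψ
  set J := integ (τ * ρ * (ψ * ψ)) with hJ_def
  have hs1 : inner ℝ (algToL2 s) (algToL2 s) = (1 : ℝ) := by
    rw [inner_algToL2_algToL2]; exact integ_sqrtDensity V
  have hκ₁0 : 0 ≤ κ₁ := mul_nonneg hlam (by linarith [hmono 1 le_rfl])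
  have hθ : 0 < 2 - κ₁ * J := by linarith
  have hwh (h : L2) : c₀ * ‖h‖ ^ 2 ≤ inner ℝ h (mulL w h) := by
    rw [← real_inner_self_eq_norm_sq, inner_L2, inner_L2, interval_eq, interval_eq,
      ← integral_const_mul]
    refine integral_mono_ae ((integrable_mul_L2 h h).const_mul _) (integrable_mul_L2 _ _) ?_
    filter_upwards [coe_mulL w h] with θ hθ
    rw [hθ]
    have := mul_le_mul_of_nonneg_right (hw θ) (mul_self_nonneg (h θ))
    linarith
  have hκ : 0 < (1 - κ₁ * J) / (2 - κ₁ * J) * c₀ := by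
    have : 0 < 1 - κ₁ * J := by linarith
    positivity
  refine isStable_of_coercive K (ε := min 1 ((1 - κ₁ * J) / (2 - κ₁ * J) * c₀))
    (lt_min one_pos hκ) fun g => ?_
  set h := projAlong s g with hh
  set β := inner ℝ (algToL2 s) g with hβ
  have hsh : inner ℝ (algToL2 s) h = 0 := by
    rw [hh, projAlong_apply, inner_sub_right, inner_smul_right, hs1]; ring
  have hnorm : ‖g‖ ^ 2 = ‖h‖ ^ 2 + β ^ 2 := by
    have hg : g = h + β • algToL2 s := by rw [hh, projAlong_apply]; module
    rw [← real_inner_self_eq_norm_sq, ← real_inner_self_eq_norm_sq]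
    conv_lhs => rw [hg]
    rw [inner_add_left, inner_add_right, inner_add_right, real_inner_smul_left, inner_smul_right,
      inner_smul_right, real_inner_smul_left, hs1, hsh, real_inner_comm (algToL2 s) h, hsh]
    ring
  have hf : fluctAdj s g = mulL s h := rfl
  rw [hf]
  set f := mulL s h with hf_def
  set b := inner ℝ (algToL2 (s * ψ)) h with hb
  -- the first coefficient of `f` does not change if a constant is subtracted from `cos (2θ)`
  have hc1 : cosCoeff 1 f = b := by
    have : s * cosA 1 = s * ψ + α • s := by rw [hψ, mul_sub, mul_smul_comm, mul_one]; module
    rw [cosCoeff_apply, hf_def, ← inner_mulL_algToL2, this, map_add, map_smul, inner_add_left,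
      real_inner_smul_left, hsh, mul_zero, add_zero]
  have hfn : ‖f‖ ^ 2 = inner ℝ h (mulL ρ h) := by
    rw [← real_inner_self_eq_norm_sq, hf_def, inner_mulL, mulL_mulL]
  set G := inner ℝ h (mulL w h) with hG
  have hGeq : G = ‖h‖ ^ 2 - κ₂ * ‖f‖ ^ 2 := by
    rw [hfn, hG, hw_def, sub_eq_add_neg, mulL_add, mulL_one, ← neg_smul, mulL_smul, inner_add_right,
      inner_smul_right, real_inner_self_eq_norm_sq]
    ring
  have hmain := neg_inner_conv_le hneg hmono f
  rw [hc1] at hmain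
  have hlow : β ^ 2 + (G - κ₁ * b ^ 2) ≤ ‖g‖ ^ 2 + lam * inner ℝ f (toL2 (conv K f)) := by
    rw [hnorm, hGeq, hκ₁, hκ₂]
    nlinarith [mul_le_mul_of_nonneg_left hmain hlam]
  -- the weighted Cauchy-Schwarz inequality
  have hcs : 0 ≤ G - 2 * (κ₁ * b) * b + (κ₁ * b) ^ 2 * J := by
    set d : L2 := algToL2 (τ * (s * ψ)) with hd
    have h0 := hwh (h - (κ₁ * b) • d)
    have hwd : mulL w d = algToL2 (s * ψ) := by
      rw [hd, mulL_algToL2, ← mul_assoc, mul_comm w τ, hτ, one_mul]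
    have e : inner ℝ (h - (κ₁ * b) • d) (mulL w (h - (κ₁ * b) • d))
        = G - 2 * (κ₁ * b) * b + (κ₁ * b) ^ 2 * J := by
      have e1 : inner ℝ d (mulL w h) = b := by rw [← inner_mulL, hwd]
      have e2 : inner ℝ h (algToL2 (s * ψ)) = b := real_inner_comm _ _
      have e3 : inner ℝ d (algToL2 (s * ψ)) = J := by
        rw [hd, inner_algToL2_algToL2, hJ_def, hρ]
        congr 1; ring
      rw [map_sub, map_smul, hwd, inner_sub_left, inner_sub_right, inner_sub_right,
        inner_smul_right, real_inner_smul_left, real_inner_smul_left, inner_smul_right, e1, e2, e3]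
      ring
    rw [e] at h0
    exact le_trans (by positivity) h0
  have hG0 := hwh h
  have hkey : (1 - κ₁ * J) / (2 - κ₁ * J) * G ≤ G - κ₁ * b ^ 2 := by
    rw [div_mul_eq_mul_div, div_le_iff₀ hθ]
    nlinarith
  have hr : 0 ≤ (1 - κ₁ * J) / (2 - κ₁ * J) := by
    have : 0 < 1 - κ₁ * J := by linarith
    positivity
  have h5 : (1 - κ₁ * J) / (2 - κ₁ * J) * c₀ * ‖h‖ ^ 2 ≤ G - κ₁ * b ^ 2 := by
    refine le_trans ?_ hkey
    rw [mul_assoc]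
    gcongr
  refine le_trans ?_ hlow
  rw [hnorm, mul_add]
  have h6 := mul_le_mul_of_nonneg_right
    (min_le_right 1 ((1 - κ₁ * J) / (2 - κ₁ * J) * c₀)) (sq_nonneg ‖h‖)
  have h7 := mul_le_mul_of_nonneg_right
    (min_le_left 1 ((1 - κ₁ * J) / (2 - κ₁ * J) * c₀)) (sq_nonneg β)
  linarith

end Signs

end

section

/-! ### Removal of the trivial solution -/

/-- The second-order remainder of the exponential: `e^{-a} = 1 - a + a² (expRem₂ a)`. -/
def expRem₂ (a : Alg) : Alg := (2⁻¹ : ℝ) • 1 - a * expRem a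

lemma expNeg_eq_expRem₂ (a : Alg) : expNeg a = 1 - a + a * a * expRem₂ a := by
  rw [expNeg_eq, expRem₂, mul_sub, mul_smul_comm, mul_one]
  ring

lemma contDiff_expRem₂ {n : WithTop ℕ∞} : ContDiff ℝ n expRem₂ := by
  have h := contDiff_expRem (n := n)
  unfold expRem₂
  fun_prop

lemma expRem₂_zero : expRem₂ 0 = (2⁻¹ : ℝ) • 1 := by rw [expRem₂, zero_mul, sub_zero]

variable (K : Kernel)

/-- The smooth extension of `(t, v) ↦ Γ(t v) / t` to `t = 0`. -/
def gammaQuot (p : ℝ × H) : H :=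
  (integ (expNeg (p.1 • embed p.2)))⁻¹ • conv K (algToL2
    (-embed p.2 + p.1 • (embed p.2 * embed p.2 * expRem₂ (p.1 • embed p.2))))

lemma smul_gammaQuot (t : ℝ) (v : H) : t • gammaQuot K (t, v) = Gamma K (t • v) := by
  rw [gammaQuot, Gamma_eq', map_smul, smul_comm, ← map_smul, ← map_smul]
  dsimp only
  have e : expNeg (embed (t • v)) = 1 + t •
      (-embed v + t • (embed v * embed v * expRem₂ (embed (t • v)))) := by
    rw [map_smul, expNeg_eq_expRem₂, smul_mul_smul_comm, smul_mul_assoc]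
    module
  rw [e, map_add algToL2 1, map_add (conv K), conv_algToL2_one, zero_add, map_smul algToL2]

lemma contDiff_gammaQuot {n : WithTop ℕ∞} : ContDiff ℝ n (gammaQuot K) := by
  have h1 : ContDiff ℝ n fun p : ℝ × H => embed p.2 := embed.contDiff.comp contDiff_snd
  have h2 : ContDiff ℝ n fun p : ℝ × H => p.1 • embed p.2 := contDiff_fst.smul h1
  have h3 : ContDiff ℝ n fun p : ℝ × H => (integ (expNeg (p.1 • embed p.2)))⁻¹ :=
    (integ.contDiff.comp (contDiff_expNeg.comp h2)).inv fun p => (integ_expNeg_pos _).ne'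
  have h4 : ContDiff ℝ n fun p : ℝ × H =>
      -embed p.2 + p.1 • (embed p.2 * embed p.2 * expRem₂ (p.1 • embed p.2)) :=
    h1.neg.add (contDiff_fst.smul ((h1.mul h1).mul (contDiff_expRem₂.comp h2)))
  exact h3.smul (((conv K).comp algToL2).contDiff.comp h4)

lemma gammaQuot_zero_left (v : H) : gammaQuot K (0, v) = -(2 * π)⁻¹ • conv K (toL2 v) := by
  simp only [gammaQuot]
  rw [zero_smul, zero_smul, add_zero, expNeg_zero, integ_one, map_neg, algToL2_embed, map_neg,
    smul_neg, neg_smul]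

/-! ### The reduced equation -/

/-- The coefficient of the mode `m` in the `H`-orthogonal expansion. -/
def modeCoeff (m : ℕ+) : H →L[ℝ] ℝ := (modeNormSq m)⁻¹ • innerSL ℝ (mode m)

lemma modeCoeff_apply (m : ℕ+) (u : H) : modeCoeff m u = (modeNormSq m)⁻¹ * inner ℝ (mode m) u :=
  rfl

lemma modeCoeff_mode (m : ℕ+) : modeCoeff m (mode m) = 1 := by
  rw [modeCoeff_apply, inner_mode_mode, if_pos rfl, ← modeNormSq,
    inv_mul_cancel₀ (modeNormSq_pos m).ne']

lemma modeCoeff_mode_ne {m n : ℕ+} (h : m ≠ n) : modeCoeff m (mode n) = 0 := by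
  rw [modeCoeff_apply, inner_mode_mode, if_neg h, mul_zero]

/-- The orthogonal projection of `H` to the complement of the mode `m`. -/
def offMode (m : ℕ+) : H →L[ℝ] H := 1 - (modeCoeff m).smulRight (mode m)

lemma offMode_apply (m : ℕ+) (u : H) : offMode m u = u - modeCoeff m u • mode m := rfl

lemma modeCoeff_offMode (m : ℕ+) (u : H) : modeCoeff m (offMode m u) = 0 := by
  rw [offMode_apply, map_sub, map_smul, modeCoeff_mode, smul_eq_mul, mul_one, sub_self]

lemma inner_mode_offMode (m : ℕ+) (u : H) : inner ℝ (mode m) (offMode m u) = 0 := by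
  have h := modeCoeff_offMode m u
  rw [modeCoeff_apply] at h
  exact (mul_eq_zero.1 h).resolve_left (inv_ne_zero (modeNormSq_pos m).ne')

/-- The equation `V = λ Γ(V)` for `V = t (φ_m + v)`, `v ⟂ φ_m`, divided by `t`. The unknowns `v`
and `λ` are encoded in a single `w ∈ H`: its component orthogonal to `φ_m` is `v`, its coefficient
along `φ_m` is `1 - λ / λ_m`. -/
def reducedEq (m : ℕ+) (p : ℝ × H) : H :=
  (mode m + offMode m p.2) - (K.criticalParam m * (1 - modeCoeff m p.2)) •
    gammaQuot K (p.1, mode m + offMode m p.2)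

lemma contDiff_reducedEq (m : ℕ+) {n : WithTop ℕ∞} : ContDiff ℝ n (reducedEq K m) := by
  have h1 : ContDiff ℝ n fun p : ℝ × H => mode m + offMode m p.2 :=
    contDiff_const.add ((offMode m).contDiff.comp contDiff_snd)
  have h2 : ContDiff ℝ n fun p : ℝ × H => K.criticalParam m * (1 - modeCoeff m p.2) :=
    contDiff_const.mul (contDiff_const.sub ((modeCoeff m).contDiff.comp contDiff_snd))
  exact h1.sub (h2.smul ((contDiff_gammaQuot K).comp (contDiff_fst.prodMk h1)))

lemma bifOp_eq (m : ℕ+) (u : H) : bifOp K m u =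
    u + (K.criticalParam m / (2 * π)) • conv K (toL2 u) + modeCoeff m u • mode m := by
  rw [bifOp_apply, modeCoeff_apply, smul_smul]

section Signs

variable {K} (hneg : ∀ m : ℕ, 1 ≤ m → K.coeff m < 0)
  (hmono : ∀ m : ℕ, 1 ≤ m → -K.coeff (m + 1) < -K.coeff m)

include hneg

lemma criticalParam_conv_mode (m : ℕ+) :
    (K.criticalParam m / (2 * π)) • conv K (toL2 (mode m)) = -mode m := by
  have hm := (hneg m m.pos).ne
  have hπ := pi_pos.ne'
  have e : K.criticalParam m / (2 * π) * (π * K.coeff m) = -1 := by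
    rw [Kernel.criticalParam]; field_simp
  rw [toL2_mode, conv_cosA, smul_smul, e]
  module

lemma reducedEq_zero_left (m : ℕ+) (w : H) : reducedEq K m (0, w) =
    bifOp K m w - modeCoeff m w •
      ((K.criticalParam m / (2 * π)) • conv K (toL2 (offMode m w))) := by
  have h := criticalParam_conv_mode hneg m
  set T := (K.criticalParam m / (2 * π)) • ((conv K).comp toL2) with hT
  have hTa (u : H) : T u = (K.criticalParam m / (2 * π)) • conv K (toL2 u) := rfl
  rw [← hTa] at h
  rw [reducedEq, gammaQuot_zero_left, bifOp_eq, ← hTa, ← hTa, smul_smul]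
  have e : K.criticalParam m * (1 - modeCoeff m w) * -(2 * π)⁻¹
      = -(1 - modeCoeff m w) * (K.criticalParam m / (2 * π)) := by ring
  dsimp only
  rw [e, ← smul_smul, ← hTa, map_add, offMode_apply, map_sub, map_smul, h]
  module

lemma reducedEq_zero (m : ℕ+) : reducedEq K m (0, 0) = 0 := by
  rw [reducedEq_zero_left hneg]
  simp

/-- The derivative of the reduced equation with respect to the unknown. -/
lemma fderiv_reducedEq_inr (m : ℕ+) :
    (fderiv ℝ (reducedEq K m) (0, 0)).comp (.inr ℝ ℝ H) = bifOp K m := by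
  have h1 : HasFDerivAt (reducedEq K m) (fderiv ℝ (reducedEq K m) (0, 0)) (0, 0) :=
    ((contDiff_reducedEq K m (n := 1)).differentiable (by simp)).differentiableAt.hasFDerivAt
  have h2 := h1.comp (0 : H) (hasFDerivAt_prodMk_right (0 : ℝ) (0 : H))
  have e : reducedEq K m ∘ (fun w => ((0 : ℝ), w)) = fun w => bifOp K m w - modeCoeff m w •
      ((K.criticalParam m / (2 * π)) • ((conv K).comp (toL2.comp (offMode m)))) w :=
    funext fun w => reducedEq_zero_left hneg m w
  rw [e] at h2
  have h3 := (bifOp K m).hasFDerivAt (x := 0) |>.sub ((modeCoeff m).hasFDerivAt (x := 0) |>.smul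
    (((K.criticalParam m / (2 * π)) •
      ((conv K).comp (toL2.comp (offMode m)))).hasFDerivAt (x := 0)))
  refine (h2.unique h3).trans ?_
  ext1 w
  simp

/-- The derivative of the reduced equation with respect to `t`; the factor `1 / 4` comes from
`φ_m² / 2 = φ_{2m} / 4 + 1 / 4`. -/
lemma fderiv_reducedEq_inl (m : ℕ+) :
    fderiv ℝ (reducedEq K m) (0, 0) (1, 0) =
      (K.coeff (2 * m) / K.coeff m / 4) • mode (2 * m) := by
  have h1 : HasFDerivAt (reducedEq K m) (fderiv ℝ (reducedEq K m) (0, 0)) (0, 0) :=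
    ((contDiff_reducedEq K m (n := 1)).differentiable (by simp)).differentiableAt.hasFDerivAt
  have h2 : HasDerivAt (fun t : ℝ => reducedEq K m (t, 0))
      (fderiv ℝ (reducedEq K m) (0, 0) (1, 0)) 0 :=
    h1.comp_hasDerivAt (f := fun t : ℝ => (t, (0 : H))) (0 : ℝ)
      ((hasDerivAt_id (0 : ℝ)).prodMk (hasDerivAt_const _ (0 : H)))
  set φ := embed (mode m) with hφ
  have hφ' : φ = cosA m := embed_mode m
  have h3 := (hasFDerivAt_expNeg ((0 : ℝ) • φ)).comp_hasDerivAt (f := fun t : ℝ => t • φ) (0 : ℝ)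
      ((hasDerivAt_id (0 : ℝ)).smul_const φ)
  have h4 : HasDerivAt (fun t : ℝ => integ (expNeg (t • φ))) 0 0 := by
    refine (integ.hasFDerivAt.comp_hasDerivAt (0 : ℝ) h3).congr_deriv ?_
    have : integ φ = 0 := by rw [hφ']; exact integ_cosA m.pos
    simp [expNeg_zero, this]
  have h5 := h4.inv (integ_expNeg_pos _).ne'
  have h6 : HasDerivAt (fun t : ℝ => -φ + t • (φ * φ * expRem₂ (t • φ)))
      ((2⁻¹ : ℝ) • (φ * φ)) 0 := by
    have hd : DifferentiableAt ℝ (fun t : ℝ => φ * φ * expRem₂ (t • φ)) 0 := by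
      have h : ContDiff ℝ 1 fun t : ℝ => φ * φ * expRem₂ (t • φ) :=
        contDiff_const.mul (contDiff_expRem₂.comp (contDiff_id.smul contDiff_const))
      exact h.differentiable (by simp) |>.differentiableAt
    refine (((hasDerivAt_id (0 : ℝ)).smul hd.hasDerivAt).const_add (-φ)).congr_deriv ?_
    simp [expRem₂_zero]
  have h7 := (((conv K).comp algToL2).hasFDerivAt (x := -φ + (0 : ℝ) •
    (φ * φ * expRem₂ ((0 : ℝ) • φ)))).comp_hasDerivAt (0 : ℝ) h6
  have h8 := ((h5.smul h7).const_smul (K.criticalParam m)).const_sub (mode m)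
  have e : (fun t : ℝ => reducedEq K m (t, 0)) = fun t => mode m - K.criticalParam m •
      ((integ (expNeg (t • φ)))⁻¹ • conv K (algToL2 (-φ + t • (φ * φ * expRem₂ (t • φ))))) := by
    funext t
    rw [reducedEq, gammaQuot]
    simp only [map_zero, add_zero, sub_zero, mul_one]
    rfl
  rw [e] at h2
  rw [h2.unique h8]
  have hsq : φ * φ = (2⁻¹ : ℝ) • cosA (2 * m) + (2⁻¹ : ℝ) • 1 := by
    have := cosA_mul m 0
    rw [add_zero, add_zero, cosA_zero] at this
    rw [hφ', this]
  have hc : conv K (algToL2 (cosA (2 * m))) = (π * K.coeff (2 * m)) • mode (2 * m) :=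
    conv_cosA K (2 * m)
  simp only [Function.comp_apply, ContinuousLinearMap.comp_apply]
  rw [hsq]
  have hm := (hneg m m.pos).ne
  have hπ := pi_pos.ne'
  simp only [map_add, map_smul, hc, conv_algToL2_one, zero_smul, expNeg_zero, integ_one, smul_smul,
    Kernel.criticalParam, neg_zero, zero_div, smul_zero, add_zero]
  have hZ : integ (expNeg 0) = 2 * π := by rw [expNeg_zero, integ_one]
  rw [← neg_smul]
  congr 1
  simp only [Pi.inv_apply, hZ, zero_smul]
  field_simp
  ring

include hmono

/-- The implicit function of the reduced equation. Its derivative at `0` is found from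
`D φ_{2m} = (1 - r) φ_{2m}` with `D = bifOp K m` and `r = k_{2m} / k_m`. -/
lemma exists_implicit (m : ℕ+) : ∃ ψ : ℝ → H, ψ 0 = 0 ∧ (∀ᶠ t in 𝓝 0, ContinuousAt ψ t) ∧
    HasDerivAt ψ (-(K.coeff (2 * m) / K.coeff m / (4 * (1 - K.coeff (2 * m) / K.coeff m))) •
      mode (2 * m)) 0 ∧
    (∀ᶠ p in 𝓝 ((0 : ℝ), (0 : H)), reducedEq K m p = 0 ↔ ψ p.1 = p.2) ∧
    ∀ᶠ t in 𝓝 0, reducedEq K m (t, ψ t) = 0 := by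
  obtain ⟨e, he⟩ := exists_bifOp_equiv hneg hmono m
  have hcd : ContDiffAt ℝ 1 (reducedEq K m) (0, 0) := (contDiff_reducedEq K m).contDiffAt
  have hinv : ((fderiv ℝ (reducedEq K m) (0, 0)).comp (.inr ℝ ℝ H)).IsInvertible := by
    rw [fderiv_reducedEq_inr hneg]
    exact ⟨e, he⟩
  have h0 := reducedEq_zero hneg m
  refine ⟨hcd.implicitFunction one_ne_zero hinv, hcd.implicitFunction_apply_self one_ne_zero hinv,
    ?_, ?_, ?_, ?_⟩
  · have := hcd.contDiffAt_implicitFunction one_ne_zero hinv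
    exact (this.eventually (by simp)).mono fun t ht => ht.continuousAt
  · refine (hcd.hasStrictFDerivAt_implicitFunction one_ne_zero
      hinv).hasFDerivAt.hasDerivAt.congr_deriv ?_
    have h1 : ((fderiv ℝ (reducedEq K m) (0, 0)).comp (.inl ℝ ℝ H)) 1
        = (K.coeff (2 * m) / K.coeff m / 4) • mode (2 * m) := fderiv_reducedEq_inl hneg m
    have hr : 1 - K.coeff (2 * m) / K.coeff m ≠ 0 := by
      have : K.coeff (2 * m) / K.coeff m < 1 := by
        rw [div_lt_one_of_neg (hneg m m.pos)]
        have := m.pos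
        exact coeff_strictMono hmono m.pos (by lia)
      linarith
    have h2 : e (mode (2 * m)) = (1 - K.coeff (2 * m) / K.coeff m) • mode (2 * m) := by
      have h := bifOp_mode hneg m (2 * m)
      have hne : m ≠ 2 * m := fun h => by
        have h' := congrArg PNat.val h
        have := m.pos
        rw [PNat.mul_coe] at h'
        change (m : ℕ) = 2 * m at h'
        lia
      rw [if_neg hne, add_zero, ← he] at h
      exact h
    have h3 : e.symm (mode (2 * m)) = (1 - K.coeff (2 * m) / K.coeff m)⁻¹ • mode (2 * m) := by
      rw [ContinuousLinearEquiv.symm_apply_eq, map_smul, h2, inv_smul_smul₀ hr]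
    have h4 (A : H →L[ℝ] H) (B : ℝ →L[ℝ] H) : (-A ∘L B) 1 = -A (B 1) := rfl
    rw [h4, h1, fderiv_reducedEq_inr hneg, ← he, ContinuousLinearMap.inverse_equiv, map_smul,
      ContinuousLinearEquiv.coe_coe, h3, smul_smul, ← neg_smul]
    congr 1
    field_simp
  · have := hcd.eventually_apply_eq_iff_implicitFunction one_ne_zero hinv
    rwa [h0] at this
  · have := hcd.eventually_apply_implicitFunction one_ne_zero hinv
    rwa [h0] at this

end Signs

end

section

/-! ### The bifurcating branches -/

lemma eventually_forall_Ioo {p : ℝ → Prop} (h : ∀ᶠ t in 𝓝 0, p t) :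
    ∀ᶠ δ in 𝓝[>] (0 : ℝ), ∀ t ∈ Ioo (-δ) δ, p t := by
  obtain ⟨ε, hε, hp⟩ := Metric.eventually_nhds_iff.1 h
  filter_upwards [Ioo_mem_nhdsGT hε] with δ hδ t ht
  refine hp ?_
  rw [Real.dist_eq, sub_zero]
  exact (abs_lt.2 ht).trans hδ.2

variable (K : Kernel)

lemma Gamma_zero : Gamma K 0 = 0 := by
  have := smul_gammaQuot K 0 0
  rwa [zero_smul, zero_smul, eq_comm] at this

lemma GammaDeriv_zero (V : H) : GammaDeriv K 0 V = -(2 * π)⁻¹ • conv K (toL2 V) := by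
  rw [GammaDeriv_apply, map_zero, expNeg_zero, integ_one, one_mul, algToL2_embed, conv_algToL2_one,
    smul_zero, add_zero]

/-- Near `(λ_m, 0)`, the nonlinear equation is a small perturbation of the linear one. -/
lemma eventually_norm_remainder_le (lam₀ : ℝ) {ε : ℝ} (hε : 0 < ε) :
    ∀ᶠ p in 𝓝 (lam₀, (0 : H)),
      ‖p.1 • Gamma K p.2 + (lam₀ / (2 * π)) • conv K (toL2 p.2)‖ ≤ ε * ‖p.2‖ := by
  have h0 : (fun V : H => Gamma K V - GammaDeriv K 0 V) =o[𝓝 0] fun V => V := by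
    have := (hasFDerivAt_Gamma K 0).isLittleO
    simpa [Gamma_zero] using this
  have hsnd : Tendsto (fun p : ℝ × H => p.2) (𝓝 (lam₀, 0)) (𝓝 0) :=
    (continuous_snd (X := ℝ) (Y := H)).tendsto (lam₀, 0)
  have hfst : Tendsto (fun p : ℝ × H => p.1) (𝓝 (lam₀, 0)) (𝓝 lam₀) :=
    (continuous_fst (X := ℝ) (Y := H)).tendsto (lam₀, 0)
  have h1 := h0.comp_tendsto hsnd
  have h2 : (fun p : ℝ × H => p.1) =O[𝓝 (lam₀, 0)] fun _ => (1 : ℝ) := hfst.isBigO_one ℝ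
  have h3 : (fun p : ℝ × H => p.1 - lam₀) =o[𝓝 (lam₀, 0)] fun _ => (1 : ℝ) := by
    rw [Asymptotics.isLittleO_one_iff]
    simpa using hfst.sub_const lam₀
  have h4 : (fun p : ℝ × H => GammaDeriv K 0 p.2) =O[𝓝 (lam₀, 0)] fun p => p.2 :=
    (GammaDeriv K 0).isBigO_comp _ _
  have h5 := (h2.smul_isLittleO h1).add (h3.smul_isBigO h4)
  have h6 := h5.def hε
  filter_upwards [h6] with p hp
  rw [Function.comp_apply, Function.comp_apply, one_smul] at hp
  have e : p.1 • Gamma K p.2 + (lam₀ / (2 * π)) • conv K (toL2 p.2) =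
      p.1 • (Gamma K p.2 - GammaDeriv K 0 p.2) + (p.1 - lam₀) • GammaDeriv K 0 p.2 := by
    rw [GammaDeriv_zero]
    module
  rw [e]
  exact hp

section Signs

variable {K} (hneg : ∀ m : ℕ, 1 ≤ m → K.coeff m < 0)
  (hmono : ∀ m : ℕ, 1 ≤ m → -K.coeff (m + 1) < -K.coeff m)

include hneg

lemma criticalParam_pos (m : ℕ+) : 0 < K.criticalParam m :=
  div_pos_of_neg_of_neg (by norm_num) (hneg m m.pos)

lemma bifOp_offMode (m : ℕ+) (V : H) :
    bifOp K m (offMode m V) = V + (K.criticalParam m / (2 * π)) • conv K (toL2 V) := by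
  have h : bifOp K m (mode m) = mode m := by
    rw [bifOp_mode hneg, if_pos rfl, div_self (hneg m m.pos).ne]
    module
  rw [offMode_apply, map_sub, map_smul, h, bifOp_eq]
  module

include hmono

/-- Solutions close to the bifurcation point are tangent to the mode `m`. -/
lemma eventually_norm_offMode_le (m : ℕ+) {ε : ℝ} (hε : 0 < ε) :
    ∀ᶠ p in 𝓝 (K.criticalParam m, (0 : H)), IsSolution K p.1 p.2 →
      ‖offMode m p.2‖ ≤ ε * |modeCoeff m p.2| := by
  obtain ⟨e, he⟩ := exists_bifOp_equiv hneg hmono m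
  set C := ‖(e.symm : H →L[ℝ] H)‖ + 1 with hC
  set N := ‖mode m‖ + 1 with hN
  have hC0 : 0 < C := by positivity
  have hN0 : 0 < N := by positivity
  set ε' := min (1 / (2 * C)) (ε / (2 * C * N)) with hε'
  have hε'0 : 0 < ε' := by positivity
  filter_upwards [eventually_norm_remainder_le K (K.criticalParam m) hε'0] with p hp hsol
  have h1 : ‖bifOp K m (offMode m p.2)‖ ≤ ε' * ‖p.2‖ := by
    rw [bifOp_offMode hneg]
    have hsol' : p.2 = p.1 • Gamma K p.2 := hsol
    rwa [← hsol'] at hp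
  have h2 : ‖offMode m p.2‖ ≤ C * ‖bifOp K m (offMode m p.2)‖ := by
    have h : offMode m p.2 = e.symm (bifOp K m (offMode m p.2)) := by
      rw [← he]; exact (e.symm_apply_apply _).symm
    conv_lhs => rw [h]
    refine ((e.symm : H →L[ℝ] H).le_opNorm _).trans ?_
    gcongr
    linarith
  have h3 : ‖p.2‖ ≤ ‖offMode m p.2‖ + |modeCoeff m p.2| * N := by
    have h : p.2 = offMode m p.2 + modeCoeff m p.2 • mode m := by
      rw [offMode_apply, sub_add_cancel]
    conv_lhs => rw [h]
    refine (norm_add_le _ _).trans ?_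
    rw [norm_smul, Real.norm_eq_abs]
    gcongr
    linarith
  have h4 : C * ε' ≤ 1 / 2 := by
    have := mul_le_mul_of_nonneg_left (min_le_left (1 / (2 * C)) (ε / (2 * C * N))) hC0.le
    refine this.trans_eq ?_
    field_simp
  have h5 : C * ε' * N ≤ ε / 2 := by
    have := mul_le_mul_of_nonneg_left (min_le_right (1 / (2 * C)) (ε / (2 * C * N)))
      (mul_pos hC0 hN0).le
    calc C * ε' * N = C * N * ε' := by ring
      _ ≤ _ := this
      _ = ε / 2 := by field_simp
  have h6 : ‖offMode m p.2‖ ≤ C * ε' * (‖offMode m p.2‖ + |modeCoeff m p.2| * N) := by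
    refine h2.trans ?_
    rw [mul_assoc]
    gcongr
    exact h1.trans (by gcongr)
  have h7 := mul_le_mul_of_nonneg_right h4 (norm_nonneg (offMode m p.2))
  have h8 := mul_le_mul_of_nonneg_right h5 (abs_nonneg (modeCoeff m p.2))
  linarith

/-- The pair of branches through `(λ_m, 0)`, with the tangent of the remainder. -/
theorem exists_branches (m : ℕ+) : ∃ (Λ : ℝ → ℝ) (z : ℝ → H),
    (∀ᶠ δ in 𝓝[>] (0 : ℝ), IsBifurcatingPair K (K.criticalParam m) (mode m) δ Λ z) ∧
    z 0 = 0 ∧ (∀ t, inner ℝ (mode m) (z t) = 0) ∧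
    HasDerivAt z (-(K.coeff (2 * m) / K.coeff m / (4 * (1 - K.coeff (2 * m) / K.coeff m))) •
      mode (2 * m)) 0 ∧
    ∀ᶠ t in 𝓝 0, mode m + z t = Λ t • gammaQuot K (t, mode m + z t) := by
  obtain ⟨ψ, hψ0, hψc, hψd, hψiff, hψeq⟩ := exists_implicit hneg hmono m
  have hlam := criticalParam_pos hneg m
  set lam₀ := K.criticalParam m with hlam₀
  set Λ : ℝ → ℝ := fun t => lam₀ * (1 - modeCoeff m (ψ t)) with hΛ
  set z : ℝ → H := fun t => offMode m (ψ t) with hz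
  have hcurve : ∀ᶠ t in 𝓝 0, mode m + z t = Λ t • gammaQuot K (t, mode m + z t) := by
    filter_upwards [hψeq] with t ht
    exact sub_eq_zero.1 ht
  have hcoeff (t : ℝ) : modeCoeff m (t • (mode m + z t)) = t := by
    rw [map_smul, map_add, modeCoeff_mode, hz, modeCoeff_offMode, add_zero, smul_eq_mul, mul_one]
  refine ⟨Λ, z, ?_, by rw [hz]; simp [hψ0], fun t => inner_mode_offMode m _, ?_, hcurve⟩
  swap
  · have hne : m ≠ 2 * m := fun h => by
      have h' := congrArg PNat.val h
      have := m.pos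
      rw [PNat.mul_coe] at h'
      change (m : ℕ) = 2 * m at h'
      lia
    refine ((offMode m).hasFDerivAt.comp_hasDerivAt (0 : ℝ) hψd).congr_deriv ?_
    rw [map_smul, offMode_apply m (mode (2 * m)), modeCoeff_mode_ne hne, zero_smul, sub_zero]
  -- the neighbourhood of the bifurcation point in which solutions are controlled
  obtain ⟨ε, hε, hiff⟩ := Metric.eventually_nhds_iff.1 hψiff
  have hW : ∀ᶠ p in 𝓝 (lam₀, (0 : H)),
      (IsSolution K p.1 p.2 → ‖offMode m p.2‖ ≤ ε / 2 * |modeCoeff m p.2|) ∧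
      |modeCoeff m p.2| < ε ∧ ‖(1 - p.1 / lam₀) • mode m‖ < ε / 2 := by
    refine (eventually_norm_offMode_le hneg hmono m (half_pos hε)).and (.and ?_ ?_)
    · have hc : Continuous fun p : ℝ × H => |modeCoeff m p.2| := by fun_prop
      refine hc.continuousAt.eventually_lt continuousAt_const ?_
      simpa using hε
    · have hc : Continuous fun p : ℝ × H => ‖(1 - p.1 / lam₀) • mode m‖ := by fun_prop
      refine hc.continuousAt.eventually_lt continuousAt_const ?_
      change ‖(1 - lam₀ / lam₀) • mode m‖ < ε / 2
      rw [div_self hlam.ne', sub_self, zero_smul, norm_zero]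
      exact half_pos hε
  obtain ⟨W₀, hW₀, hW₀o, hW₀m⟩ := eventually_nhds_iff.1 hW
  have hψ0c : ContinuousAt ψ 0 := hψc.self_of_nhds
  have hcurveW : ∀ᶠ t in 𝓝 0, (Λ t, t • (mode m + z t)) ∈ W₀ := by
    have hc : ContinuousAt (fun t => (Λ t, t • (mode m + z t))) 0 := by
      rw [hΛ, hz]
      fun_prop
    refine hc.eventually (hW₀o.mem_nhds ?_)
    simpa [hΛ, hψ0] using hW₀m
  filter_upwards [self_mem_nhdsWithin, eventually_forall_Ioo hψc, eventually_forall_Ioo hcurve,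
    eventually_forall_Ioo hcurveW] with δ hδ h1 h2 h3
  refine ⟨hδ, mode_ne_zero m, fun t ht => ?_, fun t ht => ?_, ?_, ?_, fun t _ =>
    inner_mode_offMode m _, W₀ ∩ {p | |modeCoeff m p.2| < δ}, hW₀o.inter ?_, ⟨hW₀m, ?_⟩, ?_⟩
  · have := h1 t ht
    refine ContinuousAt.continuousWithinAt ?_
    rw [hΛ]
    fun_prop
  · exact ((offMode m).continuous.continuousAt.comp (h1 t ht)).continuousWithinAt
  · simp [hΛ, hψ0]
  · simp [hz, hψ0]
  · exact isOpen_lt (by fun_prop) continuous_const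
  · simpa using hδ
  · ext p
    constructor
    · rintro ⟨⟨hp, hpδ⟩, hsol⟩
      by_cases hp0 : p.2 = 0
      · exact Or.inr ⟨⟨hp, hpδ⟩, hp0⟩
      left
      obtain ⟨ho, hc, hl⟩ := hW₀ p hp
      have ho := ho hsol
      set t := modeCoeff m p.2 with ht
      have hV : p.2 = t • mode m + offMode m p.2 := by rw [offMode_apply]; module
      have ht0 : t ≠ 0 := by
        intro h0
        rw [h0, abs_zero, mul_zero] at ho
        rw [h0, norm_le_zero_iff.1 ho, zero_smul, add_zero] at hV
        exact hp0 hV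
      -- the value of the implicit function that belongs to the solution `p`
      set w : H := t⁻¹ • offMode m p.2 + (1 - p.1 / lam₀) • mode m with hw
      have hw1 : modeCoeff m w = 1 - p.1 / lam₀ := by
        rw [hw, map_add, map_smul, map_smul, modeCoeff_offMode, modeCoeff_mode, smul_zero, zero_add,
          smul_eq_mul, mul_one]
      have hw2 : offMode m w = t⁻¹ • offMode m p.2 := by
        rw [offMode_apply, hw1, hw]; module
      have hw3 : mode m + offMode m w = t⁻¹ • p.2 := by
        conv_rhs => rw [hV]
        rw [hw2, smul_add, inv_smul_smul₀ ht0]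
      have hw4 : lam₀ * (1 - modeCoeff m w) = p.1 := by
        rw [hw1]
        field_simp
        ring
      have hred : reducedEq K m (t, w) = 0 := by
        have h := smul_gammaQuot K t (t⁻¹ • p.2)
        rw [smul_inv_smul₀ ht0] at h
        have hsol' : p.2 = p.1 • Gamma K p.2 := hsol
        rw [← h, smul_comm] at hsol'
        have h' : t⁻¹ • p.2 = p.1 • gammaQuot K (t, t⁻¹ • p.2) := by
          conv_lhs => rw [hsol']
          rw [inv_smul_smul₀ ht0]
        rw [reducedEq, hw3, ← hlam₀, hw4, sub_eq_zero]
        exact h'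
      have hnear : dist (t, w) ((0 : ℝ), (0 : H)) < ε := by
        rw [Prod.dist_eq, max_lt_iff]
        refine ⟨by simpa using hc, ?_⟩
        change dist w 0 < ε
        rw [dist_zero_right]
        refine (norm_add_le _ _).trans_lt ?_
        have : ‖t⁻¹ • offMode m p.2‖ ≤ ε / 2 := by
          rw [norm_smul, norm_inv, Real.norm_eq_abs, inv_mul_le_iff₀ (abs_pos.2 ht0)]
          linarith
        linarith
      have hψw : ψ t = w := (hiff hnear).1 hred
      refine ⟨t, abs_lt.1 hpδ, ?_⟩
      refine Prod.ext ?_ ?_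
      · change lam₀ * (1 - modeCoeff m (ψ t)) = p.1
        rw [hψw, hw4]
      · change t • (mode m + offMode m (ψ t)) = p.2
        rw [hψw, hw3, smul_inv_smul₀ ht0]
    · rintro (⟨t, ht, rfl⟩ | ⟨hp, hp0⟩)
      · refine ⟨⟨h3 t ht, ?_⟩, ?_⟩
        · change |modeCoeff m (t • (mode m + z t))| < δ
          rw [hcoeff]
          exact abs_lt.2 ht
        · change t • (mode m + z t) = Λ t • Gamma K (t • (mode m + z t))
          rw [← smul_gammaQuot, smul_comm, ← h2 t ht]
      · refine ⟨hp, ?_⟩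
        rw [IsSolution, hp0, Gamma_zero, smul_zero]

end Signs

end

section

/-! ### Expansion of the branches to second order -/

lemma cosA_mul_self (m : ℕ) : cosA m * cosA m = (2⁻¹ : ℝ) • cosA (2 * m) + (2⁻¹ : ℝ) • 1 := by
  have := cosA_mul m 0
  rwa [add_zero, add_zero, cosA_zero] at this

section Integrals

variable {m : ℕ} (hm : 1 ≤ m)
include hm

lemma integ_cosA_cube : integ (cosA m * cosA m * cosA m) = 0 := by
  rw [cosA_mul_self, add_mul, smul_mul_assoc, smul_mul_assoc, one_mul, map_add, map_smul, map_smul,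
    integ_cosA_mul (n := 2 * m) (m := m) (by lia), integ_cosA hm, smul_zero, add_zero]

lemma integ_cosA_sq_mul_double : integ (cosA m * cosA m * cosA (2 * m)) = π / 2 := by
  rw [cosA_mul_self, add_mul, smul_mul_assoc, smul_mul_assoc, one_mul, map_add, map_smul, map_smul,
    integ_cosA_mul_self (n := 2 * m) (by lia), integ_cosA (n := 2 * m) (by lia), smul_zero,
    add_zero, smul_eq_mul]
  ring

lemma integ_cosA_fourth : integ (cosA m * cosA m * (cosA m * cosA m)) = 3 * π / 4 := by
  have h : cosA m * cosA m * (cosA m * cosA m) =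
      (2⁻¹ : ℝ) • (cosA m * cosA m * cosA (2 * m)) + (2⁻¹ : ℝ) • (cosA m * cosA m) := by
    conv_lhs => rw [cosA_mul_self, mul_add, mul_smul_comm, mul_smul_comm, mul_one]
    rw [← cosA_mul_self]
  rw [h, map_add, map_smul, map_smul, integ_cosA_sq_mul_double hm, integ_cosA_mul_self hm]
  simp only [smul_eq_mul]
  ring

end Integrals

/-- The second-order term in the expansion of `e^{-t (φ + t y)}` with respect to `t`. -/
def quadTerm (φ : Alg) (t : ℝ) (y : Alg) : Alg :=
  -y + (φ + t • y) * (φ + t • y) * expRem₂ (t • (φ + t • y))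

lemma expNeg_eq_quadTerm (φ : Alg) (t : ℝ) (y : Alg) :
    expNeg (t • (φ + t • y)) = 1 - t • φ + t ^ 2 • quadTerm φ t y := by
  rw [expNeg_eq_expRem₂, quadTerm]
  generalize expRem₂ (t • (φ + t • y)) = e
  ext θ
  simp
  ring

lemma tendsto_quadTerm (φ : Alg) {l : Filter ℝ} (hl : Tendsto id l (𝓝 0)) {y : ℝ → Alg} {y₀ : Alg}
    (hy : Tendsto y l (𝓝 y₀)) :
    Tendsto (fun t => quadTerm φ t (y t)) l (𝓝 (-y₀ + (2⁻¹ : ℝ) • (φ * φ))) := by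
  have hc : Continuous fun p : ℝ × Alg => quadTerm φ p.1 p.2 := by
    have := contDiff_expRem₂ (n := 0) |>.continuous
    unfold quadTerm
    fun_prop
  have h := (hc.tendsto (0, y₀)).comp (hl.prodMk_nhds hy)
  have e : quadTerm φ 0 y₀ = -y₀ + (2⁻¹ : ℝ) • (φ * φ) := by
    rw [quadTerm, zero_smul, zero_smul, add_zero, expRem₂_zero, mul_smul_comm, mul_one]
  rwa [e] at h

variable (K : Kernel)

/-- A curve of pairs `(Λ t, V t)` with `V t = t (φ_m + t y)` and `Λ t = λ_m (1 + η t²)`, together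
with the limits of `y` and `η` as `t → 0` that hold on the branches bifurcating at `λ_m`. -/
structure BranchExpansion (m : ℕ+) (Λ : ℝ → ℝ) (V : ℝ → H) where
  /-- The second-order correction `y` of the solution. -/
  corr : ℝ → Alg
  /-- The second-order correction `η` of the parameter. -/
  param : ℝ → ℝ
  tendsto_corr : Tendsto corr (𝓝[≠] 0) (𝓝
    (-(K.coeff (2 * m) / K.coeff m / (4 * (1 - K.coeff (2 * m) / K.coeff m))) • cosA (2 * m)))
  tendsto_param : Tendsto param (𝓝[≠] 0) (𝓝
    ((1 - 2 * (K.coeff (2 * m) / K.coeff m)) / (8 * (1 - K.coeff (2 * m) / K.coeff m))))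
  embed_eq : ∀ t ≠ 0, embed (V t) = t • (cosA m + t • corr t)
  param_eq : ∀ t ≠ 0, Λ t = K.criticalParam m * (1 + param t * t ^ 2)

section Signs

variable {K} (hneg : ∀ m : ℕ, 1 ≤ m → K.coeff m < 0)
  (hmono : ∀ m : ℕ, 1 ≤ m → -K.coeff (m + 1) < -K.coeff m)

include hneg hmono

lemma coeff_ratio_lt_one {m : ℕ} (hm : 1 ≤ m) : K.coeff (2 * m) / K.coeff m < 1 := by
  rw [div_lt_one_of_neg (hneg m hm)]
  exact coeff_strictMono hmono hm (by lia)

/-- The expansion of the branches. The parameter is obtained by testing the equation with the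
mode `m`; its first-order correction vanishes because `∫ φ_m³ = 0`. -/
lemma exists_branchExpansion (m : ℕ+) {Λ : ℝ → ℝ} {z : ℝ → H} (hz0 : z 0 = 0)
    (hz : ∀ t, inner ℝ (mode m) (z t) = 0)
    (hzd : HasDerivAt z (-(K.coeff (2 * m) / K.coeff m /
      (4 * (1 - K.coeff (2 * m) / K.coeff m))) • mode (2 * m)) 0)
    (heq : ∀ᶠ t in 𝓝 0, mode m + z t = Λ t • gammaQuot K (t, mode m + z t)) :
    Nonempty (BranchExpansion K m Λ fun t => t • (mode m + z t)) := by
  have hr := coeff_ratio_lt_one hneg hmono m.pos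
  set r := K.coeff (2 * m) / K.coeff m with hr_def
  set b := -(r / (4 * (1 - r))) with hb
  have hkm := (hneg m m.pos).ne
  set φ := cosA m with hφ
  set y : ℝ → Alg := fun t => t⁻¹ • embed (z t) with hy
  set η : ℝ → ℝ := fun t => (Λ t / K.criticalParam m - 1) / t ^ 2 with hη
  have hyt : Tendsto y (𝓝[≠] 0) (𝓝 (b • cosA (2 * m))) := by
    have h := (embed.continuous.tendsto _).comp (hasDerivAt_iff_tendsto_slope.1 hzd)
    have e1 : embed (b • mode (2 * m)) = b • cosA (2 * m) := by
      rw [map_smul, embed_mode]; rfl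
    rw [e1] at h
    refine h.congr fun t => ?_
    rw [Function.comp_apply, slope_def_module, hz0, sub_zero, sub_zero, map_smul]
  have ht : Tendsto id (𝓝[≠] (0 : ℝ)) (𝓝 0) := tendsto_id.mono_left nhdsWithin_le_nhds
  have hv (t : ℝ) (ht : t ≠ 0) : embed (mode m + z t) = φ + t • y t := by
    rw [map_add, embed_mode, hy, smul_inv_smul₀ ht]
  have hlam : K.criticalParam m ≠ 0 := (criticalParam_pos hneg m).ne'
  have hpar (t : ℝ) (ht : t ≠ 0) : Λ t = K.criticalParam m * (1 + η t * t ^ 2) := by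
    rw [hη]
    field_simp
    ring
  set A : ℝ → Alg := fun t => quadTerm φ t (y t) with hA
  -- `integ (φ * A t) = t * I t`
  set F : ℝ × Alg → ℝ := fun p => integ (φ * φ * p.2) + p.1 / 2 * integ (φ * p.2 * p.2) -
    integ (φ * ((φ + p.1 • p.2) * (φ + p.1 • p.2) * (φ + p.1 • p.2)) *
      expRem (p.1 • (φ + p.1 • p.2))) with hF
  have hFc : Continuous F := by
    have := contDiff_expRem (n := 0) |>.continuous
    fun_prop
  have hI : Tendsto (fun t => F (t, y t)) (𝓝[≠] 0) (𝓝 (b * (π / 2) - π / 8)) := by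
    have h := (hFc.tendsto (0, b • cosA (2 * m))).comp (ht.prodMk_nhds hyt)
    have e : F (0, b • cosA (2 * m)) = b * (π / 2) - π / 8 := by
      have e1 : φ * (φ * φ * φ) * ((6⁻¹ : ℝ) • 1) = (6⁻¹ : ℝ) • (φ * φ * (φ * φ)) := by
        rw [mul_smul_comm, mul_one]
        congr 1
        ring
      rw [hF]
      dsimp only
      rw [zero_smul, zero_smul, add_zero, expRem_zero, e1, mul_smul_comm b (φ * φ),
        map_smul, map_smul, hφ, integ_cosA_sq_mul_double m.pos, integ_cosA_fourth m.pos]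
      simp only [smul_eq_mul]
      ring
    rwa [e] at h
  have hintA (t : ℝ) (ht : t ≠ 0) : integ (φ * A t) = t * F (t, y t) := by
    have h1 : integ (φ * y t) = 0 := by
      have h2 := inner_mode m (z t)
      rw [hz, eq_comm, mul_eq_zero, or_iff_right (by positivity), ← algToL2_embed,
        cosCoeff_algToL2] at h2
      rw [hy, mul_smul_comm, map_smul, h2, smul_zero]
    have h3 : φ * A t = -(φ * y t) + (2⁻¹ : ℝ) • (φ * φ * φ) + t • (φ * φ * y t) +
        (t ^ 2 / 2) • (φ * y t * y t) - t • (φ * ((φ + t • y t) * (φ + t • y t) * (φ + t • y t)) *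
          expRem (t • (φ + t • y t))) := by
      rw [hA]
      simp only [quadTerm, expRem₂]
      generalize expRem (t • (φ + t • y t)) = e
      ext θ
      simp
      ring
    rw [h3, map_sub, map_add, map_add, map_add, map_neg, map_smul, map_smul, map_smul, map_smul, h1,
      hφ, integ_cosA_cube m.pos, hF]
    simp only [smul_eq_mul]
    ring
  have hAt := tendsto_quadTerm φ ht hyt
  have hY : Tendsto (fun t => integ (A t)) (𝓝[≠] 0) (𝓝 (π / 2)) := by
    have h := (integ.continuous.tendsto _).comp hAt
    have e : integ (-(b • cosA (2 * m)) + (2⁻¹ : ℝ) • (φ * φ)) = π / 2 := by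
      have := m.pos
      rw [map_add, map_neg, map_smul, map_smul, integ_cosA (by lia), hφ, integ_cosA_mul_self m.pos]
      simp only [smul_eq_mul]
      ring
    rwa [e] at h
  -- the equation tested with the mode `m`
  have hmain : ∀ᶠ t in 𝓝[≠] 0, η t * (2 * π - 2 * t ^ 2 * F (t, y t)) =
      integ (A t) + 2 * F (t, y t) := by
    filter_upwards [heq.filter_mono nhdsWithin_le_nhds, self_mem_nhdsWithin] with t h0 ht0
    have ht0 : t ≠ 0 := ht0
    have hZ : integ (expNeg (t • (φ + t • y t))) = 2 * π + t ^ 2 * integ (A t) := by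
      rw [expNeg_eq_quadTerm, map_add, map_sub, map_smul, map_smul, integ_one, hφ,
        integ_cosA m.pos]
      simp only [smul_eq_mul]
      ring
    have hZ0 : 2 * π + t ^ 2 * integ (A t) ≠ 0 := hZ ▸ (integ_expNeg_pos _).ne'
    have h1 : cosCoeff m (toL2 (mode m + z t)) = π := by
      have h2 := inner_mode m (z t)
      rw [hz, eq_comm, mul_eq_zero, or_iff_right (by positivity)] at h2
      rw [map_add, map_add, cosCoeff_mode, h2, add_zero]
    have h2 := congrArg (fun u => cosCoeff m (toL2 u)) h0
    rw [h1, gammaQuot] at h2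
    dsimp only at h2
    have h3 : -(φ + t • y t) + t • ((φ + t • y t) * (φ + t • y t) * expRem₂ (t • (φ + t • y t))) =
        -φ + t • A t := by
      rw [hA]
      simp only [quadTerm]
      module
    rw [hv t ht0, h3, hZ, map_smul, map_smul, map_smul, map_smul, cosCoeff_conv, cosCoeff_algToL2,
      mul_add, mul_neg, mul_smul_comm, map_add, map_neg, map_smul, hintA t ht0,
      hφ, integ_cosA_mul_self m.pos, hpar t ht0, Kernel.criticalParam] at h2
    simp only [smul_eq_mul] at h2
    have hπ := pi_pos.ne'
    generalize hZd : 2 * π + t ^ 2 * integ (A t) = Z at hZ0 h2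
    field_simp at h2
    have ht2 : t ^ 2 ≠ 0 := by positivity
    apply mul_left_cancel₀ ht2
    linarith
  have hden : Tendsto (fun t => 2 * π - 2 * t ^ 2 * F (t, y t)) (𝓝[≠] 0) (𝓝 (2 * π)) := by
    have h := (((ht.pow 2).const_mul 2).mul hI).const_sub (2 * π)
    simpa using h
  refine ⟨⟨y, η, hyt, ?_, fun t ht0 => ?_, hpar⟩⟩
  · have h := (hY.add (hI.const_mul 2)).div hden (by positivity)
    have e : (π / 2 + 2 * (b * (π / 2) - π / 8)) / (2 * π) = (1 - 2 * r) / (8 * (1 - r)) := by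
      have hπ := pi_pos.ne'
      have h1 : 1 - r ≠ 0 := by linarith
      rw [hb]
      field_simp
      ring
    rw [e] at h
    refine h.congr' ?_
    filter_upwards [hmain, hden.eventually_ne (by positivity : (2 * π) ≠ 0)] with t h1 h2
    simp only [Pi.div_apply]
    rw [div_eq_iff h2, h1]
  · rw [map_smul, hv t ht0]

variable {m : ℕ+} {Λ : ℝ → ℝ} {V : ℝ → H}

/-- Supercriticality. -/
lemma BranchExpansion.eventually_lt (B : BranchExpansion K m Λ V)
    (h : 2 * K.coeff (2 * m) / K.coeff m < 1) : ∀ᶠ t in 𝓝[≠] 0, K.criticalParam m < Λ t := by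
  have hr := coeff_ratio_lt_one hneg hmono m.pos
  have h0 : 0 < (1 - 2 * (K.coeff (2 * m) / K.coeff m)) / (8 * (1 - K.coeff (2 * m) / K.coeff m)) :=
    div_pos (by rw [← mul_div_assoc]; linarith) (by linarith)
  filter_upwards [B.tendsto_param.eventually (lt_mem_nhds h0), self_mem_nhdsWithin] with t h1 ht
  rw [B.param_eq t ht]
  have ht : t ≠ 0 := ht
  have : 0 < B.param t * t ^ 2 := by positivity
  exact lt_mul_of_one_lt_right (criticalParam_pos hneg m) (by linarith)

/-- Subcriticality. -/
lemma BranchExpansion.eventually_gt (B : BranchExpansion K m Λ V)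
    (h : 1 < 2 * K.coeff (2 * m) / K.coeff m) : ∀ᶠ t in 𝓝[≠] 0, Λ t < K.criticalParam m := by
  have hr := coeff_ratio_lt_one hneg hmono m.pos
  have h0 : (1 - 2 * (K.coeff (2 * m) / K.coeff m)) / (8 * (1 - K.coeff (2 * m) / K.coeff m)) < 0 :=
    div_neg_of_neg_of_pos (by rw [← mul_div_assoc]; linarith) (by linarith)
  filter_upwards [B.tendsto_param.eventually (gt_mem_nhds h0), self_mem_nhdsWithin] with t h1 ht
  rw [B.param_eq t ht]
  have ht : t ≠ 0 := ht
  have : B.param t * t ^ 2 < 0 := mul_neg_of_neg_of_pos h1 (by positivity)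
  exact mul_lt_of_lt_one_right (criticalParam_pos hneg m) (by linarith)

end Signs

end

section

/-! ### Stability of the branches -/

variable {K : Kernel} (hneg : ∀ m : ℕ, 1 ≤ m → K.coeff m < 0)
  (hmono : ∀ m : ℕ, 1 ≤ m → -K.coeff (m + 1) < -K.coeff m)

lemma BranchExpansion.tendsto_parameter {m : ℕ+} {Λ : ℝ → ℝ} {V : ℝ → H}
    (B : BranchExpansion K m Λ V) : Tendsto Λ (𝓝[≠] 0) (𝓝 (K.criticalParam m)) := by
  have ht : Tendsto (fun t : ℝ => t) (𝓝[≠] (0 : ℝ)) (𝓝 0) :=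
    tendsto_id.mono_left nhdsWithin_le_nhds
  have h := ((B.tendsto_param.mul (ht.pow 2)).const_add 1).const_mul (K.criticalParam m)
  rw [zero_pow two_ne_zero, mul_zero, add_zero, mul_one] at h
  refine h.congr' ?_
  filter_upwards [self_mem_nhdsWithin] with t ht0
  exact (B.param_eq t ht0).symm

include hneg

lemma BranchExpansion.parameter_mul_coeff {m : ℕ+} {Λ : ℝ → ℝ} {V : ℝ → H}
    (B : BranchExpansion K m Λ V) {t : ℝ} (ht : t ≠ 0) :
    Λ t * K.coeff m = -2 * (1 + B.param t * t ^ 2) := by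
  have := (hneg m m.pos).ne
  rw [B.param_eq t ht, Kernel.criticalParam]
  field_simp

include hmono

/-- On a branch that does not bifurcate at the first eigenvalue, the first mode is unstable. -/
lemma BranchExpansion.eventually_isUnstable_of_two_le {m : ℕ+} (hm : 2 ≤ (m : ℕ)) {Λ : ℝ → ℝ}
    {V : ℝ → H} (B : BranchExpansion K m Λ V) : ∀ᶠ t in 𝓝[≠] 0, IsUnstable K (Λ t) (V t) := by
  have ht : Tendsto (fun t : ℝ => t) (𝓝[≠] (0 : ℝ)) (𝓝 0) :=
    tendsto_id.mono_left nhdsWithin_le_nhds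
  have hV : Tendsto (fun t => embed (V t)) (𝓝[≠] 0) (𝓝 0) := by
    have h := ht.smul ((ht.smul B.tendsto_corr).const_add (cosA m))
    rw [zero_smul] at h
    refine h.congr' ?_
    filter_upwards [self_mem_nhdsWithin] with t ht0
    exact (B.embed_eq t ht0).symm
  have hc : Continuous fun a : Alg =>
      integ (expNeg a) * integ (expNeg (-a) * (cosA 1 * cosA 1)) := by
    have := contDiff_expNeg (n := 0) |>.continuous
    fun_prop
  have h1 := (hc.tendsto 0).comp hV
  have h2 := ((B.tendsto_parameter).mul_const (-K.coeff 1 * π ^ 2))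
  rw [neg_zero, expNeg_zero, one_mul, integ_one, integ_cosA_mul_self le_rfl] at h1
  have hlam := criticalParam_pos hneg m
  have hlt : 2 * π * π < K.criticalParam m * (-K.coeff 1 * π ^ 2) := by
    have h3 : 1 < K.coeff 1 / K.coeff m := by
      rw [one_lt_div_of_neg (hneg m m.pos)]
      exact coeff_strictMono hmono le_rfl (by lia)
    have h4 : K.criticalParam m * (-K.coeff 1 * π ^ 2) = 2 * π ^ 2 * (K.coeff 1 / K.coeff m) := by
      rw [Kernel.criticalParam]
      ring
    have : 0 < 2 * π ^ 2 := by positivity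
    rw [h4]
    nlinarith
  filter_upwards [h1.eventually_lt h2 hlt,
    (B.tendsto_parameter).eventually (lt_mem_nhds hlam)] with t h5 h6
  refine isUnstable_of_test hneg h6.le (cosA 1) (integ_cosA le_rfl) {1} ?_
  rw [Finset.sum_singleton]
  refine lt_of_lt_of_eq h5 ?_
  have : integ (cosA ((1 : ℕ+) : ℕ) * cosA 1) = π := integ_cosA_mul_self le_rfl
  rw [this, PNat.one_coe]

/-- The supercritical branches at the first eigenvalue are stable. -/
lemma BranchExpansion.eventually_isStable {Λ : ℝ → ℝ} {V : ℝ → H} (B : BranchExpansion K 1 Λ V)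
    (h : 2 * K.coeff 2 / K.coeff 1 < 1) : ∀ᶠ t in 𝓝[≠] 0, IsStable K (Λ t) (V t) := by
  have hk1 := hneg 1 le_rfl
  have hk2 := hneg 2 one_le_two
  have hr : K.coeff 2 / K.coeff 1 < 1 := coeff_ratio_lt_one hneg hmono (m := 1) le_rfl
  have ht : Tendsto (fun t : ℝ => t) (𝓝[≠] (0 : ℝ)) (𝓝 0) :=
    tendsto_id.mono_left nhdsWithin_le_nhds
  have hy : Tendsto B.corr (𝓝[≠] 0) (𝓝 (-(K.coeff 2 / K.coeff 1 /
    (4 * (1 - K.coeff 2 / K.coeff 1))) • cosA 2)) := B.tendsto_corr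
  have hη : Tendsto B.param (𝓝[≠] 0) (𝓝 ((1 - 2 * (K.coeff 2 / K.coeff 1)) /
    (8 * (1 - K.coeff 2 / K.coeff 1)))) := B.tendsto_param
  have hrk : K.coeff 2 = K.coeff 2 / K.coeff 1 * K.coeff 1 := by field_simp [hk1.ne]
  rw [mul_div_assoc] at h
  set r := K.coeff 2 / K.coeff 1 with hr_def
  have hr1 : 0 < 1 - r := by linarith
  have hπ := pi_pos
  set b := -(r / (4 * (1 - r))) with hb
  -- `t α` is the constant subtracted from `cos (2θ)` in the weighted Cauchy-Schwarz inequality;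
  -- this `α` is the best choice to second order in `t`
  set α := -(1 / (2 * (1 - r))) with hα
  set φ := cosA 1 with hφ
  set y := B.corr with hy_def
  set η := B.param with hη_def
  set A : ℝ → Alg := fun t => quadTerm φ t (y t) with hA
  set Y : ℝ → ℝ := fun t => integ (A t) / (2 * π) with hY
  set D : ℝ → ℝ := fun t => 1 + t ^ 2 * Y t with hD
  set A' : ℝ → Alg := fun t => A t - Y t • 1 with hA'
  -- the Gibbs density is `(1 + t q) / 2π`
  set q : ℝ → Alg := fun t => (D t)⁻¹ • (-φ + t • A' t) with hq
  set R : ℝ → ℝ := fun t => r * (1 + η t * t ^ 2) with hR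
  set w : ℝ → Alg := fun t => 1 - R t • (1 + t • q t) with hw
  set τ : ℝ → Alg := fun t => Ring.inverse (w t) with hτ
  set ψ : ℝ → Alg := fun t => φ - (t * α) • 1 with hψ
  set C : ℝ → ℝ := fun t => (D t)⁻¹ * (2 * α * π + integ (A' t * (ψ t * ψ t))) +
    R t * integ (q t * q t * τ t * (ψ t * ψ t)) with hC
  -- the scalar condition of `isStable_of_weight` reads `1 + t² S t < 1`
  set S : ℝ → ℝ := fun t => η t / (1 - R t) + (1 - r) * (1 + η t * t ^ 2) *
    (2 * π * α ^ 2 / (1 - R t) + C t / (1 - R t) ^ 2) / π with hS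
  have hφφ : φ * φ = (2⁻¹ : ℝ) • cosA 2 + (2⁻¹ : ℝ) • 1 := cosA_mul_self 1
  have hφ1 : integ φ = 0 := integ_cosA le_rfl
  have hφ2 : integ (φ * φ) = π := integ_cosA_mul_self le_rfl
  have hφ3 : integ (φ * φ * φ) = 0 := integ_cosA_cube le_rfl
  have hφ22 : integ (φ * φ * cosA 2) = π / 2 := integ_cosA_sq_mul_double le_rfl
  have hφ4 : integ (φ * φ * (φ * φ)) = 3 * π / 4 := integ_cosA_fourth le_rfl
  -- limits
  have lA : Tendsto A (𝓝[≠] 0) (𝓝 (-(b • cosA 2) + (2⁻¹ : ℝ) • (φ * φ))) :=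
    tendsto_quadTerm φ ht hy
  have lY : Tendsto Y (𝓝[≠] 0) (𝓝 (1 / 4)) := by
    have h := ((integ.continuous.tendsto _).comp lA).div_const (2 * π)
    have e : integ (-(b • cosA 2) + (2⁻¹ : ℝ) • (φ * φ)) / (2 * π) = 1 / 4 := by
      rw [map_add, map_neg, map_smul, map_smul, integ_cosA one_le_two, hφ2]
      simp only [smul_eq_mul]
      field_simp
      ring
    rwa [e] at h
  have lD : Tendsto D (𝓝[≠] 0) (𝓝 1) := by simpa using ((ht.pow 2).mul lY).const_add 1
  have lA' : Tendsto A' (𝓝[≠] 0) (𝓝 ((1 / 4 - b) • cosA 2)) := by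
    have h := lA.sub (lY.smul_const (1 : Alg))
    have e : -(b • cosA 2) + (2⁻¹ : ℝ) • (φ * φ) - (1 / 4 : ℝ) • (1 : Alg) =
        (1 / 4 - b) • cosA 2 := by
      rw [hφφ]; module
    rwa [e] at h
  have lq : Tendsto q (𝓝[≠] 0) (𝓝 (-φ)) := by
    have h := (lD.inv₀ one_ne_zero).smul ((ht.smul lA').const_add (-φ))
    rwa [zero_smul, add_zero, inv_one, one_smul] at h
  have lηt : Tendsto (fun t => 1 + η t * t ^ 2) (𝓝[≠] 0) (𝓝 1) := by
    simpa using (hη.mul (ht.pow 2)).const_add 1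
  have lR : Tendsto R (𝓝[≠] 0) (𝓝 r) := by simpa using lηt.const_mul r
  have lw : Tendsto w (𝓝[≠] 0) (𝓝 ((1 - r) • 1)) := by
    have h := (lR.smul ((ht.smul lq).const_add 1)).const_sub (1 : Alg)
    have e : (1 : Alg) - r • ((1 : Alg) + (0 : ℝ) • -φ) = (1 - r) • 1 := by module
    rwa [e] at h
  set u : Algˣ := ⟨(1 - r) • 1, (1 - r)⁻¹ • 1, by
    rw [smul_mul_smul_comm, mul_inv_cancel₀ hr1.ne', one_smul, one_mul], by
    rw [smul_mul_smul_comm, inv_mul_cancel₀ hr1.ne', one_smul, one_mul]⟩ with hu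
  have lτ : Tendsto τ (𝓝[≠] 0) (𝓝 ((1 - r)⁻¹ • 1)) := by
    have h := (NormedRing.inverse_continuousAt u).tendsto.comp lw
    rwa [Ring.inverse_unit] at h
  have lψ : Tendsto ψ (𝓝[≠] 0) (𝓝 φ) := by
    have h := ((ht.mul_const α).smul_const (1 : Alg)).const_sub φ
    rwa [zero_mul, zero_smul, sub_zero] at h
  have lC : Tendsto C (𝓝[≠] 0) (𝓝 (2 * α * π + (1 / 4 - b) * (π / 2) +
      r * ((1 - r)⁻¹ * (3 * π / 4)))) := by
    have h1 := (integ.continuous.tendsto _).comp (lA'.mul (lψ.mul lψ))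
    have h2 := (integ.continuous.tendsto _).comp (((lq.mul lq).mul lτ).mul (lψ.mul lψ))
    have e1 : integ ((1 / 4 - b) • cosA 2 * (φ * φ)) = (1 / 4 - b) * (π / 2) := by
      rw [smul_mul_assoc, map_smul, mul_comm (cosA 2), hφ22, smul_eq_mul]
    have e2 : integ (-φ * -φ * ((1 - r)⁻¹ • 1) * (φ * φ)) = (1 - r)⁻¹ * (3 * π / 4) := by
      rw [neg_mul_neg, mul_smul_comm, mul_one, smul_mul_assoc, map_smul, hφ4, smul_eq_mul]
    rw [e1] at h1
    rw [e2] at h2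
    have h := ((lD.inv₀ one_ne_zero).mul (h1.const_add (2 * α * π))).add (lR.mul h2)
    rwa [inv_one, one_mul] at h
  have l1R : Tendsto (fun t => 1 - R t) (𝓝[≠] 0) (𝓝 (1 - r)) := lR.const_sub 1
  have lS : Tendsto S (𝓝[≠] 0) (𝓝 (-((1 - 2 * r) / (4 * (1 - r) ^ 2)))) := by
    have h := (hη.div l1R hr1.ne').add (((lηt.const_mul (1 - r)).mul
      ((((tendsto_const_nhds (x := 2 * π * α ^ 2)).div l1R hr1.ne').add
        (lC.div (l1R.pow 2) (pow_ne_zero 2 hr1.ne'))))).div_const π)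
    have e : (1 - 2 * r) / (8 * (1 - r)) / (1 - r) + (1 - r) * 1 * (2 * π * α ^ 2 / (1 - r) +
        (2 * α * π + (1 / 4 - b) * (π / 2) + r * ((1 - r)⁻¹ * (3 * π / 4))) / (1 - r) ^ 2) / π =
        -((1 - 2 * r) / (4 * (1 - r) ^ 2)) := by
      rw [hα, hb]
      have := hr1.ne'
      field_simp
      ring
    rwa [e] at h
  have hS0 : -((1 - 2 * r) / (4 * (1 - r) ^ 2)) < 0 := by
    have : 0 < 1 - 2 * r := by linarith
    rw [neg_lt_zero]
    positivity
  have hclose := Metric.tendsto_nhds.1 lw ((1 - r) / 2) (half_pos hr1)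
  filter_upwards [lS.eventually (gt_mem_nhds hS0), hclose,
    lw.eventually (Units.isOpen.mem_nhds u.isUnit),
    l1R.eventually (lt_mem_nhds hr1), lD.eventually (lt_mem_nhds one_pos), self_mem_nhdsWithin,
    (B.tendsto_parameter).eventually (lt_mem_nhds (criticalParam_pos hneg 1))]
    with t hSt hclose hunit hRt hDt ht0 hlam
  have ht0 : t ≠ 0 := ht0
  have hpar : Λ t * K.coeff 1 = -2 * (1 + η t * t ^ 2) := B.parameter_mul_coeff hneg ht0
  -- the Gibbs density
  have hexp : expNeg (embed (V t)) = 1 - t • φ + t ^ 2 • A t := by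
    rw [B.embed_eq t ht0]
    exact expNeg_eq_quadTerm φ t (y t)
  have hZ : integ (expNeg (embed (V t))) = 2 * π * D t := by
    rw [hexp, map_add, map_sub, map_smul, map_smul, integ_one, hφ1, hD, hY]
    simp only [smul_eq_mul]
    field_simp
    ring
  have hρ : sqrtDensity (V t) * sqrtDensity (V t) = (2 * π)⁻¹ • (1 + t • q t) := by
    have e : (1 : Alg) + t • q t = (D t)⁻¹ • (1 - t • φ + t ^ 2 • A t) := by
      have e1 : 1 - t • φ + t ^ 2 • A t = D t • (1 : Alg) + t • (-φ + t • A' t) := by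
        rw [hD, hA']
        module
      rw [e1, smul_add, inv_smul_smul₀ hDt.ne', hq, smul_comm]
    rw [sqrtDensity_mul_self, hZ, hexp, e, smul_smul, mul_inv]
  have hκ : (Λ t * -K.coeff 2 * π) • (sqrtDensity (V t) * sqrtDensity (V t)) =
      R t • (1 + t • q t) := by
    rw [hρ, smul_smul]
    congr 1
    rw [hrk, hR]
    field_simp
    linear_combination (-r) * hpar
  refine isStable_of_weight hneg hmono hlam.le (τ t) (t * α) ((1 - r) / 2) (half_pos hr1) ?_ ?_ ?_
  · rw [hκ]
    exact Ring.inverse_mul_cancel _ hunit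
  · intro θ
    rw [hκ]
    have h1 := norm_ext_le (w t - (1 - r) • 1) θ
    rw [dist_eq_norm] at hclose
    have h2 : ext (w t - (1 - r) • 1) θ = ext (w t) θ - (1 - r) * 1 := rfl
    have h3 := (abs_lt.1 (h1.trans_lt hclose)).1
    rw [h2] at h3
    change (1 - r) / 2 ≤ ext (w t) θ
    linarith
  -- the weighted integral, expanded around the constant density
  have hw1 : τ t * w t = 1 := Ring.inverse_mul_cancel _ hunit
  have hτx : (1 - R t) ^ 2 • (τ t * (1 + t • q t)) =
      (1 - R t) • 1 + t • q t + (t ^ 2 * R t) • (q t * q t * τ t) := by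
    ext θ
    have h1 := DFunLike.congr_fun hw1 θ
    rw [hw] at h1
    simp only [ContinuousMap.mul_apply, ContinuousMap.sub_apply, ContinuousMap.smul_apply,
      ContinuousMap.add_apply, ContinuousMap.one_apply, smul_eq_mul] at h1 ⊢
    linear_combination ((1 - R t) + t * q t θ) * h1
  have hψψ : integ (ψ t * ψ t) = π + 2 * π * (t * α) ^ 2 := by
    have e : ψ t * ψ t = φ * φ - (2 * (t * α)) • φ + (t * α) ^ 2 • 1 := by
      rw [hψ]
      ext θ
      simp
      ring
    rw [e, map_add, map_sub, map_smul, map_smul, hφ2, hφ1, integ_one]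
    simp only [smul_eq_mul]
    ring
  have hφψψ : integ (φ * (ψ t * ψ t)) = -(2 * (t * α) * π) := by
    have e : φ * (ψ t * ψ t) = φ * φ * φ - (2 * (t * α)) • (φ * φ) + (t * α) ^ 2 • φ := by
      rw [hψ]
      ext θ
      simp
      ring
    rw [e, map_add, map_sub, map_smul, map_smul, hφ2, hφ1, hφ3]
    simp only [smul_eq_mul]
    ring
  have hqψψ : integ (q t * (ψ t * ψ t)) =
      t * ((D t)⁻¹ * (2 * α * π + integ (A' t * (ψ t * ψ t)))) := by
    rw [hq]
    simp only
    rw [smul_mul_assoc, map_smul, add_mul, neg_mul, smul_mul_assoc, map_add, map_neg, map_smul,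
      hφψψ]
    simp only [smul_eq_mul]
    ring
  have hJ : (1 - R t) ^ 2 * integ (τ t * (1 + t • q t) * (ψ t * ψ t)) =
      (1 - R t) * (π + 2 * π * (t * α) ^ 2) + t ^ 2 * C t := by
    rw [← smul_eq_mul, ← map_smul, ← smul_mul_assoc, hτx, add_mul, add_mul, smul_mul_assoc, one_mul,
      smul_mul_assoc t (q t), smul_mul_assoc (t ^ 2 * R t), map_add, map_add, map_smul, map_smul, map_smul,
      hψψ, hqψψ, hC]
    simp only [smul_eq_mul]
    ring
  rw [hρ, mul_smul_comm, smul_mul_assoc, map_smul, smul_eq_mul]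
  have hκ₁ : Λ t * (K.coeff 2 - K.coeff 1) = 2 * (1 - r) * (1 + η t * t ^ 2) := by
    rw [hrk]
    linear_combination (r - 1) * hpar
  rw [hκ₁]
  change 2 * (1 - r) * (1 + η t * t ^ 2) *
    ((2 * π)⁻¹ * integ (τ t * (1 + t • q t) * (ψ t * ψ t))) < 1
  set J := integ (τ t * (1 + t • q t) * (ψ t * ψ t)) with hJ_def
  have hfin : 2 * (1 - r) * (1 + η t * t ^ 2) * ((2 * π)⁻¹ * J) = 1 + t ^ 2 * S t := by
    have hRne := hRt.ne'
    have hJ' : J = ((1 - R t) * (π + 2 * π * (t * α) ^ 2) + t ^ 2 * C t) / (1 - R t) ^ 2 := by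
      rw [eq_div_iff (pow_ne_zero 2 hRne), mul_comm, hJ]
    have hRη : (1 - r) * (1 + η t * t ^ 2) = (1 - R t) + η t * t ^ 2 := by
      rw [hR]; ring
    rw [hJ', hS]
    simp only
    field_simp
    linear_combination (π * (1 - R t)) * hRη
  rw [hfin]
  have h1 : t ^ 2 * S t < 0 := mul_neg_of_pos_of_neg (by positivity) hSt
  linarith only [h1]

/-- The subcritical branches at the first eigenvalue are unstable. -/
lemma BranchExpansion.eventually_isUnstable {Λ : ℝ → ℝ} {V : ℝ → H} (B : BranchExpansion K 1 Λ V)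
    (h : 1 < 2 * K.coeff 2 / K.coeff 1) : ∀ᶠ t in 𝓝[≠] 0, IsUnstable K (Λ t) (V t) := by
  have hk1 := hneg 1 le_rfl
  have hr : K.coeff 2 / K.coeff 1 < 1 := coeff_ratio_lt_one hneg hmono (m := 1) le_rfl
  have ht : Tendsto (fun t : ℝ => t) (𝓝[≠] (0 : ℝ)) (𝓝 0) :=
    tendsto_id.mono_left nhdsWithin_le_nhds
  have hy : Tendsto B.corr (𝓝[≠] 0) (𝓝 (-(K.coeff 2 / K.coeff 1 /
    (4 * (1 - K.coeff 2 / K.coeff 1))) • cosA 2)) := B.tendsto_corr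
  have hη : Tendsto B.param (𝓝[≠] 0) (𝓝 ((1 - 2 * (K.coeff 2 / K.coeff 1)) /
    (8 * (1 - K.coeff 2 / K.coeff 1)))) := B.tendsto_param
  have hrk : K.coeff 2 = K.coeff 2 / K.coeff 1 * K.coeff 1 := by field_simp [hk1.ne]
  rw [mul_div_assoc] at h
  set r := K.coeff 2 / K.coeff 1 with hr_def
  have hr1 : 0 < 1 - r := by linarith
  have hπ := pi_pos
  set b := -(r / (4 * (1 - r))) with hb
  -- the second coefficient `γ t` of the test function minimises the form to second order in `t`
  set γ := -(1 / (2 * (1 - r))) with hγ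
  set φ := cosA 1 with hφ
  set y := B.corr with hy_def
  set η := B.param with hη_def
  set Y : ℝ → ℝ := fun t => integ (quadTerm φ t (y t)) with hY
  set P : ℝ → Alg := fun t => quadTerm φ (-t) (-y t) with hP
  set a : ℝ → Alg := fun t => φ + (γ * t) • cosA 2 with ha
  set M : ℝ → ℝ := fun t => γ ^ 2 * π + γ * π + t * γ ^ 2 * integ (φ * cosA 2 * cosA 2) +
    integ (P t * (a t * a t)) with hM
  -- the quadratic form takes the value `t² S t` at the test function
  set S : ℝ → ℝ := fun t => 2 * π * M t + Y t * π + t ^ 2 * Y t * M t -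
    2 * π ^ 2 * (η t + r * γ ^ 2 + η t * r * γ ^ 2 * t ^ 2) with hS
  have hφ1 : integ φ = 0 := integ_cosA le_rfl
  have hφ2 : integ (φ * φ) = π := integ_cosA_mul_self le_rfl
  have hφ3 : integ (φ * φ * φ) = 0 := integ_cosA_cube le_rfl
  have hφ22 : integ (φ * φ * cosA 2) = π / 2 := integ_cosA_sq_mul_double le_rfl
  have hφ4 : integ (φ * φ * (φ * φ)) = 3 * π / 4 := integ_cosA_fourth le_rfl
  have hφ12 : integ (φ * cosA 2) = 0 := integ_cosA_mul (by norm_num)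
  have hφ21 : integ (cosA 2 * φ) = 0 := integ_cosA_mul (by norm_num)
  have h22 : integ (cosA 2 * cosA 2) = π := integ_cosA_mul_self one_le_two
  have h2 : integ (cosA 2) = 0 := integ_cosA one_le_two
  -- limits
  have lY : Tendsto Y (𝓝[≠] 0) (𝓝 (π / 2)) := by
    have h := (integ.continuous.tendsto _).comp (tendsto_quadTerm φ ht hy)
    have e : integ (-(b • cosA 2) + (2⁻¹ : ℝ) • (φ * φ)) = π / 2 := by
      rw [map_add, map_neg, map_smul, map_smul, h2, hφ2]
      simp only [smul_eq_mul]
      ring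
    rwa [e] at h
  have lP : Tendsto P (𝓝[≠] 0) (𝓝 (b • cosA 2 + (2⁻¹ : ℝ) • (φ * φ))) := by
    have hcont : Continuous fun p : ℝ × Alg => quadTerm φ p.1 p.2 := by
      have := contDiff_expRem₂ (n := 0) |>.continuous
      unfold quadTerm
      fun_prop
    have h := (hcont.tendsto (0, -(b • cosA 2))).comp ((by simpa using ht.neg :
      Tendsto (fun t : ℝ => -t) (𝓝[≠] (0 : ℝ)) (𝓝 0)).prodMk_nhds hy.neg)
    have e : quadTerm φ 0 (-(b • cosA 2)) = b • cosA 2 + (2⁻¹ : ℝ) • (φ * φ) := by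
      rw [quadTerm, zero_smul, zero_smul, add_zero, expRem₂_zero, mul_smul_comm, mul_one, neg_neg]
    rwa [e] at h
  have la : Tendsto a (𝓝[≠] 0) (𝓝 φ) := by
    have h := ((ht.const_mul γ).smul_const (cosA 2)).const_add φ
    rwa [mul_zero, zero_smul, add_zero] at h
  have lM : Tendsto M (𝓝[≠] 0) (𝓝 (γ ^ 2 * π + γ * π + (b * (π / 2) + 3 * π / 8))) := by
    have h1 := (integ.continuous.tendsto _).comp (lP.mul (la.mul la))
    have e : integ ((b • cosA 2 + (2⁻¹ : ℝ) • (φ * φ)) * (φ * φ)) = b * (π / 2) + 3 * π / 8 := by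
      rw [add_mul, smul_mul_assoc, smul_mul_assoc, mul_comm (cosA 2), map_add, map_smul, map_smul,
        hφ22, hφ4]
      simp only [smul_eq_mul]
      ring
    rw [e] at h1
    have h := (((ht.mul_const (γ ^ 2)).mul_const (integ (φ * cosA 2 * cosA 2))).const_add
      (γ ^ 2 * π + γ * π)).add h1
    rwa [zero_mul, zero_mul, add_zero] at h
  have lS : Tendsto S (𝓝[≠] 0) (𝓝 (2 * π ^ 2 * ((1 - 2 * r) / (4 * (1 - r))))) := by
    have h := (((lM.const_mul (2 * π)).add (lY.mul_const π)).add
      (((ht.pow 2).mul lY).mul lM)).sub (((hη.add_const (r * γ ^ 2)).add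
        (((hη.mul_const r).mul_const (γ ^ 2)).mul (ht.pow 2))).const_mul (2 * π ^ 2))
    refine (Eq.mp (congrArg (fun x => Tendsto _ _ (𝓝 x)) ?_) h)
    rw [hγ, hb]
    have := hr1.ne'
    field_simp
    ring
  have hS0 : 2 * π ^ 2 * ((1 - 2 * r) / (4 * (1 - r))) < 0 :=
    mul_neg_of_pos_of_neg (by positivity) (div_neg_of_neg_of_pos (by linarith) (by linarith))
  filter_upwards [lS.eventually (gt_mem_nhds hS0), self_mem_nhdsWithin,
    (B.tendsto_parameter).eventually (lt_mem_nhds (criticalParam_pos hneg 1))]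
    with t hSt ht0 hlam
  have ht0 : t ≠ 0 := ht0
  have hpar : Λ t * K.coeff 1 = -2 * (1 + η t * t ^ 2) := B.parameter_mul_coeff hneg ht0
  have hZ : integ (expNeg (embed (V t))) = 2 * π + t ^ 2 * Y t := by
    have e : embed (V t) = t • (φ + t • y t) := B.embed_eq t ht0
    rw [e, expNeg_eq_quadTerm, map_add, map_sub, map_smul, map_smul, integ_one, hφ1]
    simp only [smul_eq_mul]
    ring
  have hexp : expNeg (-embed (V t)) = 1 + t • φ + t ^ 2 • P t := by
    have e : -embed (V t) = (-t) • (φ + (-t) • -y t) := by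
      have e : embed (V t) = t • (φ + t • y t) := B.embed_eq t ht0
      rw [e]
      module
    rw [e, expNeg_eq_quadTerm]
    module
  have hφa : integ (φ * a t) = π := by
    rw [ha]
    simp only
    rw [mul_add, mul_smul_comm, map_add, map_smul, hφ2, hφ12, smul_zero, add_zero]
  have h2a : integ (cosA 2 * a t) = γ * t * π := by
    rw [ha]
    simp only
    rw [mul_add, mul_smul_comm, map_add, map_smul, h22, hφ21, zero_add, smul_eq_mul]
  have haa : integ (a t * a t) = π + t ^ 2 * (γ ^ 2 * π) := by
    have e : a t * a t = φ * φ + (2 * (γ * t)) • (φ * cosA 2) +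
        (γ * t) ^ 2 • (cosA 2 * cosA 2) := by
      rw [ha]
      ext θ
      simp
      ring
    rw [e, map_add, map_add, map_smul, map_smul, hφ2, hφ12, h22]
    simp only [smul_eq_mul]
    ring
  have hφaa : integ (φ * (a t * a t)) =
      t * (γ * π + t * γ ^ 2 * integ (φ * cosA 2 * cosA 2)) := by
    have e : φ * (a t * a t) = φ * φ * φ + (2 * (γ * t)) • (φ * φ * cosA 2) +
        (γ * t) ^ 2 • (φ * cosA 2 * cosA 2) := by
      rw [ha]
      ext θ
      simp
      ring
    rw [e, map_add, map_add, map_smul, map_smul, hφ3, hφ22]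
    simp only [smul_eq_mul]
    ring
  have hL : integ (expNeg (-embed (V t)) * (a t * a t)) = π + t ^ 2 * M t := by
    rw [hexp, add_mul, add_mul, one_mul, smul_mul_assoc, smul_mul_assoc, map_add, map_add, map_smul,
      map_smul, haa, hφaa, hM]
    simp only [smul_eq_mul]
    ring
  have ha0 : integ (a t) = 0 := by
    rw [ha]
    simp only
    rw [map_add, map_smul, hφ1, h2, smul_zero, add_zero]
  refine isUnstable_of_test hneg hlam.le (a t) ha0 {1, 2} ?_
  rw [Finset.sum_pair (by decide), hZ, hL]
  have e1 : integ (cosA ((1 : ℕ+) : ℕ) * a t) = π := hφa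
  have e2 : integ (cosA ((2 : ℕ+) : ℕ) * a t) = γ * t * π := h2a
  rw [e1, e2]
  change (2 * π + t ^ 2 * Y t) * (π + t ^ 2 * M t) <
    Λ t * (-K.coeff 1 * π ^ 2 + -K.coeff 2 * (γ * t * π) ^ 2)
  have hRHS : Λ t * (-K.coeff 1 * π ^ 2 + -K.coeff 2 * (γ * t * π) ^ 2) =
      2 * (1 + η t * t ^ 2) * π ^ 2 * (1 + r * γ ^ 2 * t ^ 2) := by
    rw [hrk]
    linear_combination (-π ^ 2 * (1 + r * γ ^ 2 * t ^ 2)) * hpar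
  have hdiff : (2 * π + t ^ 2 * Y t) * (π + t ^ 2 * M t) -
      2 * (1 + η t * t ^ 2) * π ^ 2 * (1 + r * γ ^ 2 * t ^ 2) = t ^ 2 * S t := by
    rw [hS]
    ring
  have h1 : t ^ 2 * S t < 0 := mul_neg_of_pos_of_neg (by positivity) hSt
  rw [hRHS]
  linarith only [h1, hdiff]

end

end DoiOnsager

end

theorem theorem2 (K : DoiOnsager.Kernel)
    (hneg : ∀ m : ℕ, 1 ≤ m → K.coeff m < 0)
    (hmono : ∀ m : ℕ, 1 ≤ m → -K.coeff (m + 1) < -K.coeff m)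
    (m : ℕ) (hm : 1 ≤ m) :
    ∃ (δ : ℝ) (Λ : ℝ → ℝ) (z : ℝ → DoiOnsager.H),
      -- bifurcation of a pair of branches at `λ_m`
      DoiOnsager.IsBifurcatingPair K (K.criticalParam m) (DoiOnsager.cosMode m hm) δ Λ z ∧
      -- criticality of both branches
      (2 * K.coeff (2 * m) / K.coeff m < 1 →
        ∀ t ∈ Set.Ioo (-δ) δ, t ≠ 0 → K.criticalParam m < Λ t) ∧
      (1 < 2 * K.coeff (2 * m) / K.coeff m →
        ∀ t ∈ Set.Ioo (-δ) δ, t ≠ 0 → Λ t < K.criticalParam m) ∧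
      -- stability of both branches
      (2 ≤ m → ∀ t ∈ Set.Ioo (-δ) δ, t ≠ 0 →
        DoiOnsager.IsUnstable K (Λ t) (t • (DoiOnsager.cosMode m hm + z t))) ∧
      (m = 1 → 2 * K.coeff 2 / K.coeff 1 < 1 → ∀ t ∈ Set.Ioo (-δ) δ, t ≠ 0 →
        DoiOnsager.IsStable K (Λ t) (t • (DoiOnsager.cosMode m hm + z t))) ∧
      (m = 1 → 1 < 2 * K.coeff 2 / K.coeff 1 → ∀ t ∈ Set.Ioo (-δ) δ, t ≠ 0 →
        DoiOnsager.IsUnstable K (Λ t) (t • (DoiOnsager.cosMode m hm + z t))) := by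
  open DoiOnsager Filter Topology in
  obtain ⟨Λ, z, hbif, hz0, hz, hzd, heq⟩ := exists_branches hneg hmono ⟨m, hm⟩
  obtain ⟨B⟩ := exists_branchExpansion hneg hmono ⟨m, hm⟩ hz0 hz hzd heq
  have near {c : Prop} {p : ℝ → Prop} (h : c → ∀ᶠ t in 𝓝[≠] 0, p t) :
      ∀ᶠ δ in 𝓝[>] (0 : ℝ), c → ∀ t ∈ Set.Ioo (-δ) δ, t ≠ 0 → p t := by
    by_cases hc : c
    · exact (eventually_forall_Ioo (eventually_nhdsWithin_iff.1 (h hc))).mono fun δ hδ _ => hδ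
    · exact .of_forall fun δ h => absurd h hc
  obtain ⟨δ, h⟩ := (hbif.and <| (near (B.eventually_lt hneg hmono)).and <|
    (near (B.eventually_gt hneg hmono)).and <|
    (near fun h => B.eventually_isUnstable_of_two_le hneg hmono h).and <|
    (near (c := m = 1 ∧ 2 * K.coeff 2 / K.coeff 1 < 1) (p := fun t =>
      IsStable K (Λ t) (t • (cosMode m hm + z t))) fun h => by
        obtain ⟨rfl, h⟩ := h
        exact B.eventually_isStable hneg hmono h).and <|
    near (c := m = 1 ∧ 1 < 2 * K.coeff 2 / K.coeff 1) (p := fun t =>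
      IsUnstable K (Λ t) (t • (cosMode m hm + z t))) fun h => by
        obtain ⟨rfl, h⟩ := h
        exact B.eventually_isUnstable hneg hmono h).exists
  obtain ⟨h1, h2, h3, h4, h5, h6⟩ := h
  exact ⟨δ, Λ, z, h1, h2, h3, h4, fun e h => h5 ⟨e, h⟩, fun e h => h6 ⟨e, h⟩⟩
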